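/- Let $\mathbb K$ be a field of characteristic $0$. A CDGA is a unital, non-negatively graded, graded commutative differential graded $\mathbb K$-algebra $(V,\mathrm d,\wedge)$ with differential of degree $1$; it is connected if $V^0=\mathrm{span}_{\mathbb K}\{1\}$ and of finite type if $\dim V^i<\infty$ for all $i$. An orientation of degree $n\in\mathbb N_0$ is a non-zero linear map $\mathrm{Or}:V\to\mathbb K$ vanishing on $V^i$ for $i\neq n$ and satisfying $\mathrm{Or}\circ\mathrm d=0$; it defines the pairing $\langle a,b\rangle=\mathrm{Or}(a\wedge b)$. $(V,\mathrm d,\wedge,\mathrm{Or})$ is an oriented PDGA of degree $n$ if the pairing induced on the cohomology $\mathrm H(V)$ is perfect. All subspaces below are graded and all maps $\rho$, $\widehat\rho$ are linear and degree-preserving. An $\mathcal H$-orthogonal decomposition is $V=\mathcal H\oplus\operatorname{im}\mathrm d\oplus C$ where $\mathcal H$ is a complement of $\operatorname{im}\mathrm d$ in $\ker\mathrm d$, $C$ is a complement of $\ker\mathrm d$ in $V$, and $\mathcal H\perp C$. Put $C^\perp=\{v\in V\mid\langle v,c\rangle=0\ \forall c\in C\}$. For a complement $E$ of $C^\perp\cap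 C$ in $C$ and a map $\rho$ defined on $E^i$ with values in $\operatorname{im}\mathrm d$, consider for given $i$ the conditions $$(1)\ \langle e_1,\rho(e_2)\rangle=\langle e_1,e_2\rangle,\qquad (2)\ \langle c,\rho(e_2)\rangle=0\qquad\text{for all } e_1\in E^{n-i},\ e_2\in E^i,\ c\in(C^\perp\cap C)^{n-i}.$$ A finitely generated Sullivan DGA is a CDGA which is, as a graded commutative algebra, free on finitely many generators $x_1,\dots,x_r$ of positive degrees such that $\mathrm d x_j$ lies in the subalgebra generated by $x_1,\dots,x_{j-1}$ for every $j$; it is acyclic if its cohomology is $\mathbb K\cdot[1]\cong\mathbb K$. **Lemma.** Let $(V,\mathrm d,\wedge,\mathrm{Or})$ be an oriented PDGA of degree $n\in\mathbb N_0$ which is connected and of finite type. (a) Let $l>\lceil n/2\rceil$, and let there be given an $\mathcal H$-orthogonal decomposition $V=\mathcal H\oplus\operatorname{im}\mathrm d\oplus C$, a complement $E$ of $C^\perp\cap C$ in $C$ and a map $\rho:E^{\lceil n/2\rceil}\oplus\dots\oplus E^{l-1}\to\operatorname{im}\mathrm d$ satisfying (1) and (2) for all $i\in\{\lceil n/2\rceil,\dots,l-1\}$.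 If $V^1\ne0$, $n=2k$ and $l=k+1$ for some $k\in\mathbb N$, suppose in addition that $E^k=0$. Then there exist an acyclic Sullivan DGA $\Lambda$ generated by finitely many elements of degrees $l-1$ and $l$ and an orientation $\widehat{\mathrm{Or}}$ of degree $n$ on the tensor product CDGA $\widehat V=V\otimes\Lambda$, with differential $\widehat{\mathrm d}$, such that: $(\widehat V,\widehat{\mathrm{Or}})$ is an oriented PDGA of degree $n$; the inclusion $V\hookrightarrow\widehat V$, $v\mapsto v\otimes1$, is a quasi-isomorphism with $\widehat{\mathrm{Or}}(v\otimes1)=\mathrm{Or}(v)$ for all $v\in V$; and there are an $\mathcal H$-orthogonal decomposition $\widehat V=\widehat{\mathcal H}\oplus\operatorname{im}\widehat{\mathrm d}\oplus\widehat C$, a complement $\widehat E$ of $\widehat C^\perp\cap\widehat C$ in $\widehat C$ with $\widehat E^i=E^i$ for all $i\in\{\lceil n/2\rceil,\dots,l-1\}$, and a map $\widehat\rho:\widehat E\to\operatorname{im}\widehat{\mathrm d}$ extending $\rho$ and satisfying (1) and (2) with respect to $\widehat C$, $\widehat E$ for all $i\in\{\lceil n/2\rceil,\dots,l\}$. (b)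 Suppose $V^1=0$ and let $l=\lceil n/2\rceil$. Then there exist an acyclic Sullivan DGA $\Lambda$ generated by finitely many elements of degrees $l-1$ and $l$ and an orientation $\widehat{\mathrm{Or}}$ of degree $n$ on $\widehat V=V\otimes\Lambda$ such that $(\widehat V,\widehat{\mathrm{Or}})$ is an oriented PDGA of degree $n$, the inclusion $V\hookrightarrow\widehat V$ is an orientation-preserving quasi-isomorphism, and there are an $\mathcal H$-orthogonal decomposition $\widehat V=\widehat{\mathcal H}\oplus\operatorname{im}\widehat{\mathrm d}\oplus\widehat C$, a complement $\widehat E$ of $\widehat C^\perp\cap\widehat C$ in $\widehat C$ and a map $\widehat\rho:\widehat E^l\to\operatorname{im}\widehat{\mathrm d}$ (so with values in $\widehat{\mathrm d}\widehat V^{l-1}$) satisfying (1) and (2) with respect to $\widehat C$, $\widehat E$ for $i=l$. -/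

import Mathlib

open scoped TensorProduct DirectSum

universe u v w

/-- A commutative differential graded algebra (CDGA) over `K`: unital, non-negatively graded,
graded commutative, with a differential of degree `1`. -/
structure CDGA (K : Type u) [Field K] where
  carrier : Type v
  [ring : Ring carrier]
  [algebra : Algebra K carrier]
  grading : ℕ → Submodule K carrier
  [graded : GradedAlgebra grading]
  d : carrier →ₗ[K] carrier
  d_mem : ∀ {i : ℕ} {a : carrier}, a ∈ grading i → d a ∈ grading (i + 1)
  d_d : ∀ a : carrier, d (d a) = 0
  leibniz : ∀ {i : ℕ} {a : carrier}, a ∈ grading i → ∀ b : carrier,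
    d (a * b) = d a * b + (-1 : K) ^ i • (a * d b)
  comm : ∀ {i j : ℕ} {a b : carrier}, a ∈ grading i → b ∈ grading j →
    a * b = (-1 : K) ^ (i * j) • (b * a)

namespace CDGA

instance {K : Type u} [Field K] : CoeSort (CDGA.{u, v} K) (Type v) := ⟨CDGA.carrier⟩

instance {K : Type u} [Field K] (V : CDGA.{u, v} K) : Ring V := V.ring
instance {K : Type u} [Field K] (V : CDGA.{u, v} K) : Algebra K V := V.algebra
instance {K : Type u} [Field K] (V : CDGA.{u, v} K) : GradedAlgebra V.grading := V.graded

section Basic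

variable {K : Type u} [Field K] (V : CDGA.{u, v} K)

/-- The sign involution `a ↦ (-1) ^ deg a • a`. -/
noncomputable def sgn : V →ₗ[K] V :=
  DirectSum.toModule K ℕ V (fun i => (-1 : K) ^ i • (V.grading i).subtype) ∘ₗ
    (DirectSum.decomposeLinearEquiv V.grading).toLinearMap

theorem sgn_of_mem {i : ℕ} {a : V} (ha : a ∈ V.grading i) : V.sgn a = (-1 : K) ^ i • a := by
  lift a to V.grading i using ha
  simp [sgn]

theorem hom_induction {P : V → Prop} (h0 : P 0) (hadd : ∀ a b, P a → P b → P (a + b))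
    (hom : ∀ i, ∀ a ∈ V.grading i, P a) (a : V) : P a :=
  DirectSum.Decomposition.inductionOn V.grading h0 (fun {i} m => hom i m m.2) hadd a

theorem d_mul (a b : V) : V.d (a * b) = V.d a * b + V.sgn a * V.d b := by
  induction a using V.hom_induction with
  | h0 => simp
  | hadd x y hx hy => simp only [add_mul, map_add, hx, hy]; abel
  | hom i x hx => rw [V.leibniz hx, V.sgn_of_mem hx, smul_mul_assoc]

theorem sgn_d (a : V) : V.sgn (V.d a) = - V.d (V.sgn a) := by
  induction a using V.hom_induction with
  | h0 => simp
  | hadd x y hx hy => simp only [map_add, hx, hy]; abel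
  | hom i x hx =>
    rw [V.sgn_of_mem hx, V.sgn_of_mem (V.d_mem hx), map_smul, pow_succ, mul_neg_one, neg_smul]

theorem sgn_sgn (a : V) : V.sgn (V.sgn a) = a := by
  induction a using V.hom_induction with
  | h0 => simp
  | hadd x y hx hy => simp only [map_add, hx, hy]
  | hom i x hx =>
    rw [V.sgn_of_mem hx, map_smul, V.sgn_of_mem hx, smul_smul, ← mul_pow]; simp

theorem d_one : V.d (1 : V) = 0 := by
  have h := V.leibniz (SetLike.GradedOne.one_mem (A := V.grading)) (1 : V)
  simpa using h

/-- Cohomology `ker d / im d`. -/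
abbrev Cohomology : Type v :=
  LinearMap.ker V.d ⧸ (LinearMap.range V.d).submoduleOf (LinearMap.ker V.d)

/-- `V` is connected: `V⁰` is spanned by the unit. -/
def IsConnected : Prop := V.grading 0 = Submodule.span K {(1 : V)}

/-- `V` is of finite type: each graded piece is finite-dimensional. -/
def IsFiniteType : Prop := ∀ i, Module.Finite K (V.grading i)

/-- `V` is acyclic: its reduced cohomology vanishes, that is, the unit map `K → H(V)`
is an isomorphism. -/
def IsAcyclic : Prop :=
  Function.Bijective (LinearMap.toSpanSingleton K V.Cohomology
    (Submodule.Quotient.mk ⟨1, LinearMap.mem_ker.2 V.d_one⟩))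

end Basic

/-! ### Morphisms -/

/-- Morphisms of CDGAs. -/
structure Hom {K : Type u} [Field K] (V : CDGA.{u, v} K) (W : CDGA.{u, w} K) where
  toAlgHom : V →ₐ[K] W
  map_mem : ∀ {i : ℕ} {a : V}, a ∈ V.grading i → toAlgHom a ∈ W.grading i
  map_d : ∀ a : V, toAlgHom (V.d a) = W.d (toAlgHom a)

namespace Hom

variable {K : Type u} [Field K] {V : CDGA.{u, v} K} {W : CDGA.{u, w} K}

instance : CoeFun (Hom V W) (fun _ => V → W) := ⟨fun f => f.toAlgHom⟩

/-- The map induced on cocycles. -/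
def cocycleMap (f : Hom V W) : LinearMap.ker V.d →ₗ[K] LinearMap.ker W.d :=
  f.toAlgHom.toLinearMap.restrict (p := LinearMap.ker V.d) (q := LinearMap.ker W.d) (by
    intro a ha
    rw [LinearMap.mem_ker] at ha ⊢
    simp [← f.map_d, ha])

/-- The map induced on cohomology. -/
def cohomologyMap (f : Hom V W) : V.Cohomology →ₗ[K] W.Cohomology :=
  Submodule.mapQ _ _ f.cocycleMap (by
    rintro ⟨a, ha⟩ ⟨b, hb⟩
    exact ⟨f b, by rw [← f.map_d, hb]; rfl⟩)

/-- A quasi-isomorphism induces an isomorphism on cohomology. -/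
def IsQuasiIso (f : Hom V W) : Prop := Function.Bijective f.cohomologyMap

end Hom

/-! ### Orientations, Poincaré duality, and the induced pairings -/

/-- An orientation of degree `n`: a non-zero linear functional supported in degree `n`
which vanishes on exact elements. -/
structure Orientation {K : Type u} [Field K] (V : CDGA.{u, v} K) (n : ℕ) where
  toFun : V →ₗ[K] K
  degree : ∀ {i : ℕ} {a : V}, i ≠ n → a ∈ V.grading i → toFun a = 0
  closed : ∀ a : V, toFun (V.d a) = 0
  ne_zero : toFun ≠ 0

namespace Orientation

variable {K : Type u} [Field K] {V : CDGA.{u, v} K} {n : ℕ} (o : V.Orientation n)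

/-- The cyclic structure `⟨a, b⟩ = Or (a ∧ b)`. -/
noncomputable def pairing : V →ₗ[K] V →ₗ[K] K := (LinearMap.mul K V).compr₂ o.toFun

theorem pairing_d_left {a b : V} (hb : V.d b = 0) : o.pairing (V.d a) b = 0 := by
  have h := o.closed (a * b)
  simpa [pairing, V.d_mul, hb] using h

theorem pairing_d_right {a b : V} (ha : V.d a = 0) : o.pairing a (V.d b) = 0 := by
  have h := o.closed (V.sgn a * b)
  have h2 : V.d (V.sgn a) = 0 := by
    rw [← neg_eq_zero, ← V.sgn_d, ha, map_zero]
  simpa [pairing, V.d_mul, V.sgn_sgn, h2] using h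

/-- The pairing induced on cohomology, `⟨[a], [b]⟩ = Or (a ∧ b)`. -/
noncomputable def cohomologyPairing : V.Cohomology →ₗ[K] V.Cohomology →ₗ[K] K :=
  Submodule.liftQ _
    (LinearMap.flip (Submodule.liftQ _
      (LinearMap.flip
        (o.pairing.domRestrict₁₂ (LinearMap.ker V.d) (LinearMap.ker V.d)))
      (by
        rintro ⟨b, hb⟩ ⟨b', rfl⟩
        ext ⟨a, ha⟩
        exact o.pairing_d_right ha)))
    (by
      rintro ⟨a, ha⟩ ⟨a', rfl⟩
      ext ⟨b, hb⟩
      exact o.pairing_d_left hb)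

/-- `(V, d, ∧, Or)` is an oriented Poincaré DGA (PDGA): the orientation makes the cohomology
a Poincaré duality algebra. -/
def IsPDGA : Prop := o.cohomologyPairing.IsPerfPair

/-- `C^⊥ ∩ C`, where `C^⊥ = {v | ∀ c ∈ C, ⟨v, c⟩ = 0}`. -/
def radical (C : Submodule K V) : Submodule K V where
  carrier := {v | v ∈ C ∧ ∀ c ∈ C, o.pairing v c = 0}
  add_mem' := fun ha hb => ⟨C.add_mem ha.1 hb.1, fun c hc => by
    rw [map_add, LinearMap.add_apply, ha.2 c hc, hb.2 c hc, add_zero]⟩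
  zero_mem' := ⟨C.zero_mem, fun c _ => by simp⟩
  smul_mem' := fun r a ha => ⟨C.smul_mem r ha.1, fun c hc => by
    rw [map_smul, LinearMap.smul_apply, ha.2 c hc, smul_zero]⟩

/-- `V = H ⊕ im d ⊕ C` is an `H`-orthogonal decomposition into graded subspaces: `H` is a
harmonic subspace (a complement of `im d` in `ker d`), `C` is a coexact part (a complement of
`ker d` in `V`), and `H ⟂ C`. -/
structure IsHOrthogonal (H C : Submodule K V) : Prop where
  harm_homogeneous : H.IsHomogeneous V.grading
  coexact_homogeneous : C.IsHomogeneous V.grading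
  harm_disjoint : Disjoint H (LinearMap.range V.d)
  harm_sup : H ⊔ LinearMap.range V.d = LinearMap.ker V.d
  coexact_isCompl : IsCompl (LinearMap.ker V.d) C
  orthogonal : ∀ h ∈ H, ∀ c ∈ C, o.pairing h c = 0

/-- `E` is a graded complement of `C^⊥ ∩ C` in `C`. -/
structure IsRadicalComplement (C E : Submodule K V) : Prop where
  homogeneous : E.IsHomogeneous V.grading
  disjoint : Disjoint E (o.radical C)
  sup : E ⊔ o.radical C = C

/-- The conditions `⟨e₁, ρ e₂⟩ = ⟨e₁, e₂⟩` and `⟨c, ρ e₂⟩ = 0` for all `i ∈ s`, `e₁ ∈ E^{n-i}`,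
`e₂ ∈ E^i` and `c ∈ (C^⊥ ∩ C)^{n-i}`, for a degree-preserving map `ρ : D → im d` defined on a
subspace `D` of `E` (which, where this is used, contains `E^i` for all `i ∈ s`). -/
structure SolvesTwist (C E : Submodule K V) (s : Set ℕ) {D : Submodule K V}
    (ρ : D →ₗ[K] LinearMap.range V.d) : Prop where
  homogeneous : ∀ (i : ℕ) (e : D), (e : V) ∈ V.grading i → (ρ e : V) ∈ V.grading i
  pairing_eq : ∀ i ∈ s, ∀ j, j + i = n → ∀ e₁ ∈ E ⊓ V.grading j, ∀ e₂ : D,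
    (e₂ : V) ∈ V.grading i → o.pairing e₁ (ρ e₂) = o.pairing e₁ e₂
  pairing_radical : ∀ i ∈ s, ∀ j, j + i = n → ∀ c ∈ o.radical C ⊓ V.grading j, ∀ e₂ : D,
    (e₂ : V) ∈ V.grading i → o.pairing c (ρ e₂) = 0

end Orientation

/-- The sum `⨁_{i ∈ s} E^i` of the components of `E` of degrees in `s`. -/
def degPart {K : Type u} [Field K] (V : CDGA.{u, v} K) (E : Submodule K V) (s : Set ℕ) :
    Submodule K V :=
  ⨆ i ∈ s, E ⊓ V.grading i

/-! ### Sullivan algebras -/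

/-- The relations `x_i x_j = (-1)^{deg x_i deg x_j} x_j x_i`. -/
inductive FreeCGARel (K : Type u) [Field K] {r : ℕ} (deg : Fin r → ℕ) :
    FreeAlgebra K (Fin r) → FreeAlgebra K (Fin r) → Prop
  | comm (i j : Fin r) : FreeCGARel K deg (FreeAlgebra.ι K i * FreeAlgebra.ι K j)
      ((-1 : K) ^ (deg i * deg j) • (FreeAlgebra.ι K j * FreeAlgebra.ι K i))

/-- The free graded commutative algebra on generators of the given degrees
(over a field of characteristic different from `2`). -/
abbrev FreeCGA (K : Type u) [Field K] {r : ℕ} (deg : Fin r → ℕ) : Type u :=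
  RingQuot (FreeCGARel K deg)

/-- The canonical map from the free graded commutative algebra determined by a choice of
homogeneous elements of the given degrees. -/
noncomputable def freeCGALift {K : Type u} [Field K] (V : CDGA.{u, v} K) {r : ℕ}
    (deg : Fin r → ℕ) (x : Fin r → V) (hx : ∀ i, x i ∈ V.grading (deg i)) :
    FreeCGA K deg →ₐ[K] V :=
  RingQuot.liftAlgHom K ⟨FreeAlgebra.lift K x, by
    rintro _ _ ⟨i, j⟩
    simpa using V.comm (hx i) (hx j)⟩

/-- `V` is a Sullivan DGA generated by finitely many elements of degrees in `s`: it is freely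
generated, as a graded commutative algebra, by elements `x_0, …, x_{r-1}` of positive degrees in
`s` such that `d x_j` lies in the subalgebra generated by the `x_i` with `i < j`. -/
def IsSullivanIn {K : Type u} [Field K] (V : CDGA.{u, v} K) (s : Set ℕ) : Prop :=
  ∃ (r : ℕ) (deg : Fin r → ℕ) (x : Fin r → V) (hx : ∀ i, x i ∈ V.grading (deg i)),
    (∀ i, 0 < deg i ∧ deg i ∈ s) ∧
    Function.Bijective (V.freeCGALift deg x hx) ∧
    ∀ j, V.d (x j) ∈ Algebra.adjoin K {y | ∃ i < j, y = x i}

/-! ### Tensor products -/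

section Tensor

variable {K : Type u} [Field K] (V : CDGA.{u, v} K) (W : CDGA.{u, w} K)

/-- The degree `k` component `⨁_{i+j=k} V^i ⊗ W^j` of the tensor product. -/
noncomputable def tensorGrading (k : ℕ) : Submodule K (V.grading ᵍ⊗[K] W.grading) :=
  Submodule.span K {t | ∃ i j, i + j = k ∧ ∃ a ∈ V.grading i, ∃ b ∈ W.grading j, t = a ᵍ⊗ₜ[K] b}

theorem tmul_mem {i j k : ℕ} (h : i + j = k) {a : V} {b : W} (ha : a ∈ V.grading i)
    (hb : b ∈ W.grading j) : (a ᵍ⊗ₜ[K] b : V.grading ᵍ⊗[K] W.grading) ∈ tensorGrading V W k :=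
  Submodule.subset_span ⟨i, j, h, a, ha, b, hb, rfl⟩

theorem tensor_induction {P : (V.grading ᵍ⊗[K] W.grading) → Prop} (h0 : P 0)
    (hadd : ∀ a b, P a → P b → P (a + b))
    (hom : ∀ i j, ∀ a ∈ V.grading i, ∀ b ∈ W.grading j, P (a ᵍ⊗ₜ[K] b))
    (t : V.grading ᵍ⊗[K] W.grading) : P t := by
  change V ⊗[K] W at t
  induction t using TensorProduct.induction_on with
  | zero => exact h0
  | add x y hx hy => exact hadd x y hx hy
  | tmul a b =>
    induction a using V.hom_induction with
    | h0 => rw [TensorProduct.zero_tmul]; exact h0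
    | hadd x y hx hy => rw [TensorProduct.add_tmul]; exact hadd _ _ hx hy
    | hom i a ha =>
      induction b using W.hom_induction with
      | h0 => rw [TensorProduct.tmul_zero]; exact h0
      | hadd x y hx hy => rw [TensorProduct.tmul_add]; exact hadd _ _ hx hy
      | hom j b hb => exact hom i j a ha b hb

theorem tensorGrading_induction {k : ℕ}
    {P : ∀ t : V.grading ᵍ⊗[K] W.grading, t ∈ tensorGrading V W k → Prop}
    (h0 : P 0 (Submodule.zero_mem _))
    (hadd : ∀ a b ha hb, P a ha → P b hb → P (a + b) (Submodule.add_mem _ ha hb))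
    (hom : ∀ i j (h : i + j = k), ∀ a (ha : a ∈ V.grading i), ∀ b (hb : b ∈ W.grading j),
      P (a ᵍ⊗ₜ[K] b) (tmul_mem V W h ha hb))
    {t : V.grading ᵍ⊗[K] W.grading} (ht : t ∈ tensorGrading V W k) : P t ht := by
  suffices h : ∀ r : K, P (r • t) (Submodule.smul_mem _ r ht) by simpa using h 1
  induction ht using Submodule.span_induction with
  | mem x hx =>
    obtain ⟨i, j, h, a, ha, b, hb, rfl⟩ := hx
    intro r
    exact hom i j h _ (Submodule.smul_mem _ r ha) b hb
  | zero => intro r; simpa using h0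
  | add x y hx' hy' hx hy =>
    intro r
    simpa only [smul_add] using hadd _ _ (Submodule.smul_mem _ r hx') (Submodule.smul_mem _ r hy')
      (hx r) (hy r)
  | smul s x _ hx => intro r; simpa only [smul_smul] using hx (r * s)

theorem smul_gtmul (r : K) (a : V) (b : W) :
    ((r • a) ᵍ⊗ₜ[K] b : V.grading ᵍ⊗[K] W.grading) = r • (a ᵍ⊗ₜ[K] b) := rfl

theorem gtmul_smul (r : K) (a : V) (b : W) :
    (a ᵍ⊗ₜ[K] (r • b) : V.grading ᵍ⊗[K] W.grading) = r • (a ᵍ⊗ₜ[K] b) :=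
  TensorProduct.tmul_smul r a b

theorem add_gtmul (a a' : V) (b : W) :
    ((a + a') ᵍ⊗ₜ[K] b : V.grading ᵍ⊗[K] W.grading) = a ᵍ⊗ₜ[K] b + a' ᵍ⊗ₜ[K] b :=
  TensorProduct.add_tmul a a' b

theorem gtmul_add (a : V) (b b' : W) :
    (a ᵍ⊗ₜ[K] (b + b') : V.grading ᵍ⊗[K] W.grading) = a ᵍ⊗ₜ[K] b + a ᵍ⊗ₜ[K] b' :=
  TensorProduct.tmul_add a b b'

theorem tmul_mul_tmul {j i' : ℕ} (a : V) {b : W} (hb : b ∈ W.grading j) {a' : V}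
    (ha' : a' ∈ V.grading i') (b' : W) :
    (a ᵍ⊗ₜ[K] b * a' ᵍ⊗ₜ[K] b' : V.grading ᵍ⊗[K] W.grading) =
      (-1 : K) ^ (j * i') • ((a * a') ᵍ⊗ₜ[K] (b * b')) := by
  have h := GradedTensorProduct.tmul_coe_mul_coe_tmul (R := K) V.grading W.grading a
    (⟨b, hb⟩ : W.grading j) (⟨a', ha'⟩ : V.grading i') b'
  refine h.trans ?_
  have hs : ∀ t : V.grading ᵍ⊗[K] W.grading, ((-1 : ℤˣ) ^ (j * i')) • t = (-1 : K) ^ (j * i') • t := by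
    intro t
    rcases Nat.even_or_odd (j * i') with h | h
    · rw [h.neg_one_pow, h.neg_one_pow, one_smul, one_smul]
    · rw [h.neg_one_pow, h.neg_one_pow, neg_one_smul, Units.neg_smul, one_smul]
  exact hs _

/-- Splitting the tensor product into its graded components. -/
noncomputable def tensorDecompose :
    (V.grading ᵍ⊗[K] W.grading) →ₗ[K] ⨁ k, tensorGrading V W k :=
  TensorProduct.lift
    ((DirectSum.toModule K ℕ ((⨁ j, W.grading j) →ₗ[K] ⨁ k, tensorGrading V W k) fun i =>
      LinearMap.flip (DirectSum.toModule K ℕ _ fun j =>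
        LinearMap.mk₂ K (fun (b : W.grading j) (a : V.grading i) =>
          DirectSum.lof K ℕ (fun k => tensorGrading V W k) (i + j)
            ⟨(a : V) ᵍ⊗ₜ[K] (b : W), tmul_mem V W rfl a.2 b.2⟩)
          (fun b b' a => by
            rw [← map_add]; congr 1; exact Subtype.ext (TensorProduct.tmul_add _ _ _))
          (fun r b a => by
            rw [← map_smul]; congr 1; exact Subtype.ext (TensorProduct.tmul_smul _ _ _))
          (fun b a a' => by
            rw [← map_add]; congr 1; exact Subtype.ext (TensorProduct.add_tmul _ _ _))
          (fun r b a => by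
            rw [← map_smul]; congr 1))).compl₁₂
      (DirectSum.decomposeLinearEquiv V.grading).toLinearMap
      (DirectSum.decomposeLinearEquiv W.grading).toLinearMap) ∘ₗ
    (GradedTensorProduct.of K V.grading W.grading).symm.toLinearMap

theorem tensorDecompose_tmul {i j : ℕ} {a : V} {b : W} (ha : a ∈ V.grading i)
    (hb : b ∈ W.grading j) : tensorDecompose V W (a ᵍ⊗ₜ[K] b) =
      DirectSum.lof K ℕ (fun k => tensorGrading V W k) (i + j)
        ⟨a ᵍ⊗ₜ[K] b, tmul_mem V W rfl ha hb⟩ := by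
  lift a to V.grading i using ha
  lift b to W.grading j using hb
  simp [tensorDecompose]

noncomputable instance tensorDecomposition : DirectSum.Decomposition (tensorGrading V W) :=
  DirectSum.Decomposition.ofLinearMap _ (tensorDecompose V W)
    (by
      refine LinearMap.ext fun t => ?_
      induction t using tensor_induction V W with
      | h0 => simp only [map_zero]
      | hadd x y hx hy => simp only [map_add, hx, hy]
      | hom i j a ha b hb =>
        rw [LinearMap.comp_apply, tensorDecompose_tmul V W ha hb, DirectSum.coeLinearMap_lof]
        rfl)
    (by
      ext k t : 2
      obtain ⟨t, ht⟩ := t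
      rw [LinearMap.comp_apply, LinearMap.comp_apply, DirectSum.coeLinearMap_lof]
      change tensorDecompose V W t = DirectSum.lof K ℕ (fun k => tensorGrading V W k) k ⟨t, ht⟩
      induction ht using tensorGrading_induction V W with
      | h0 => rw [map_zero]; exact (map_zero _).symm
      | hadd x y hx' hy' hx hy => rw [map_add, hx, hy, ← map_add]; rfl
      | hom i j h' a ha b hb =>
        cases h'
        exact tensorDecompose_tmul V W ha hb)

theorem tensor_mul_mem {k l : ℕ} {s t : V.grading ᵍ⊗[K] W.grading}
    (hs : s ∈ tensorGrading V W k) (ht : t ∈ tensorGrading V W l) :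
    s * t ∈ tensorGrading V W (k + l) := by
  induction hs using tensorGrading_induction V W with
  | h0 => rw [zero_mul]; exact Submodule.zero_mem _
  | hadd x y _ _ hx hy => rw [add_mul]; exact Submodule.add_mem _ hx hy
  | hom i j h a ha b hb =>
    induction ht using tensorGrading_induction V W with
    | h0 => rw [mul_zero]; exact Submodule.zero_mem _
    | hadd x y _ _ hx hy => rw [mul_add]; exact Submodule.add_mem _ hx hy
    | hom i' j' h' a' ha' b' hb' =>
      rw [tmul_mul_tmul V W a hb ha' b']
      exact Submodule.smul_mem _ _ (tmul_mem V W (i := i + i') (j := j + j') (by omega)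
        (SetLike.GradedMul.mul_mem ha ha') (SetLike.GradedMul.mul_mem hb hb'))

theorem tensor_one_mem : (1 : V.grading ᵍ⊗[K] W.grading) ∈ tensorGrading V W 0 :=
  tmul_mem V W (i := 0) (j := 0) (a := 1) (b := 1) (add_zero 0)
    (SetLike.GradedOne.one_mem (A := V.grading)) (SetLike.GradedOne.one_mem (A := W.grading))

noncomputable instance tensorGradedAlgebra : GradedAlgebra (tensorGrading V W) where
  one_mem := tensor_one_mem V W
  mul_mem _ _ _ _ hs ht := tensor_mul_mem V W hs ht

/-- The differential `d (a ⊗ b) = d a ⊗ b + (-1)^{deg a} a ⊗ d b`. -/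
noncomputable def tensorD :
    (V.grading ᵍ⊗[K] W.grading) →ₗ[K] (V.grading ᵍ⊗[K] W.grading) :=
  (GradedTensorProduct.of K V.grading W.grading).toLinearMap ∘ₗ
    (TensorProduct.map V.d LinearMap.id + TensorProduct.map V.sgn W.d) ∘ₗ
    (GradedTensorProduct.of K V.grading W.grading).symm.toLinearMap

theorem tensorD_tmul' (a : V) (b : W) :
    tensorD V W (a ᵍ⊗ₜ[K] b) = V.d a ᵍ⊗ₜ[K] b + V.sgn a ᵍ⊗ₜ[K] W.d b := rfl

theorem tensorD_tmul {i : ℕ} {a : V} (ha : a ∈ V.grading i) (b : W) :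
    tensorD V W (a ᵍ⊗ₜ[K] b) = V.d a ᵍ⊗ₜ[K] b + (-1 : K) ^ i • a ᵍ⊗ₜ[K] W.d b := by
  rw [tensorD_tmul', V.sgn_of_mem ha]
  rfl

theorem tensorD_leibniz {k : ℕ} {s : V.grading ᵍ⊗[K] W.grading}
    (hs : s ∈ tensorGrading V W k) (t : V.grading ᵍ⊗[K] W.grading) :
    tensorD V W (s * t) = tensorD V W s * t + (-1 : K) ^ k • (s * tensorD V W t) := by
  induction hs using tensorGrading_induction V W with
  | h0 => simp only [zero_mul, map_zero, smul_zero, add_zero]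
  | hadd x y _ _ hx hy => simp only [add_mul, map_add, hx, hy, smul_add]; abel
  | hom i j h a ha b hb =>
    induction t using tensor_induction V W with
    | h0 => simp only [mul_zero, map_zero, smul_zero, add_zero]
    | hadd x y hx hy => simp only [mul_add, map_add, hx, hy, smul_add]; abel
    | hom i' j' a' ha' b' hb' =>
      subst h
      have e1 := tmul_mul_tmul V W a hb ha' b'
      have e2 := tmul_mul_tmul V W (V.d a) hb ha' b'
      have e3 := tmul_mul_tmul V W a (W.d_mem hb) ha' b'
      have e4 := tmul_mul_tmul V W a hb (V.d_mem ha') b'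
      have e5 := tmul_mul_tmul V W a hb ha' (W.d b')
      rw [e1, map_smul, tensorD_tmul V W (SetLike.GradedMul.mul_mem ha ha'), tensorD_tmul V W ha,
        tensorD_tmul V W ha', add_mul, smul_mul_assoc, mul_add, mul_smul_comm, e2, e3, e4, e5,
        V.leibniz ha, W.leibniz hb]
      simp only [add_gtmul, gtmul_add, smul_gtmul, gtmul_smul, smul_add, smul_smul]
      simp only [pow_add, add_mul, mul_add, mul_one, one_mul]
      rcases neg_one_pow_eq_or K i with hi | hi <;> rcases neg_one_pow_eq_or K j with hj | hj <;>
        rcases neg_one_pow_eq_or K i' with hi' | hi' <;> simp only [hi, hj, hi'] <;> module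

theorem tensor_comm {k l : ℕ} {s t : V.grading ᵍ⊗[K] W.grading}
    (hs : s ∈ tensorGrading V W k) (ht : t ∈ tensorGrading V W l) :
    s * t = (-1 : K) ^ (k * l) • (t * s) := by
  induction hs using tensorGrading_induction V W with
  | h0 => simp only [zero_mul, mul_zero, smul_zero]
  | hadd x y _ _ hx hy => rw [add_mul, mul_add, smul_add, hx, hy]
  | hom i j h a ha b hb =>
    induction ht using tensorGrading_induction V W with
    | h0 => simp only [zero_mul, mul_zero, smul_zero]
    | hadd x y _ _ hx hy => rw [add_mul, mul_add, smul_add, hx, hy]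
    | hom i' j' h' a' ha' b' hb' =>
      subst h h'
      rw [tmul_mul_tmul V W a hb ha' b', tmul_mul_tmul V W a' hb' ha b, V.comm ha ha',
        W.comm hb hb']
      simp only [smul_gtmul, gtmul_smul, smul_smul]
      congr 1
      simp only [pow_add, add_mul, mul_add]
      rw [mul_comm j' i]
      rcases neg_one_pow_eq_or K (i * j') with h1 | h1 <;> rw [h1] <;> ring

/-- The tensor product of CDGAs. -/
noncomputable def tensor : CDGA.{u, max v w} K where
  carrier := V.grading ᵍ⊗[K] W.grading
  grading := tensorGrading V W
  d := tensorD V W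
  d_mem := by
    intro k t ht
    induction ht using tensorGrading_induction V W with
    | h0 => rw [map_zero]; exact Submodule.zero_mem _
    | hadd x y _ _ hx hy => rw [map_add]; exact Submodule.add_mem _ hx hy
    | hom i j h a ha b hb =>
      rw [tensorD_tmul V W ha]
      exact Submodule.add_mem _ (tmul_mem V W (by omega) (V.d_mem ha) hb)
        (Submodule.smul_mem _ _ (tmul_mem V W (by omega) ha (W.d_mem hb)))
  d_d := by
    intro t
    induction t using tensor_induction V W with
    | h0 => simp only [map_zero]
    | hadd x y hx hy => rw [map_add, map_add, hx, hy, add_zero]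
    | hom i j a ha b hb =>
      rw [tensorD_tmul', map_add, tensorD_tmul', tensorD_tmul', V.d_d, W.d_d, V.sgn_d]
      simp [GradedTensorProduct.tmul, TensorProduct.neg_tmul]
  leibniz := tensorD_leibniz V W
  comm := tensor_comm V W

/-- The canonical inclusion `V → V ⊗ W`, `a ↦ a ⊗ 1`. -/
noncomputable def inl : Hom V (tensor V W) where
  toAlgHom := GradedTensorProduct.includeLeft V.grading W.grading
  map_mem := fun ha => tmul_mem V W (add_zero _) ha SetLike.GradedOne.one_mem
  map_d := by
    intro a
    refine Eq.symm ((tensorD_tmul' V W a 1).trans ?_)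
    have h : (V.sgn a ᵍ⊗ₜ[K] (0 : W) : V.grading ᵍ⊗[K] W.grading) = 0 :=
      TensorProduct.tmul_zero W (V.sgn a)
    rw [W.d_one, h, add_zero]
    rfl

end Tensor

end CDGA

/-! `Λ` is the contractible algebra on generators `y_j` of degree `l - 1` and `z_j = d y_j`. In
characteristic zero it is acyclic and `V → V ⊗ Λ` is a quasi-isomorphism, so the only real choice is
the orientation. It extends `Or`, vanishes on words of length at least two in the generators and
satisfies `Or (a ⊗ y_j) = τ_j a`; closedness then forces its values on `a ⊗ z_j`. The `τ_j` generate
the space `twistFunctionals` of all functionals of degree `n + 1 - l` that vanish on `H`, on `C` and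
on the image of `ρ`. Vanishing on `H` keeps the harmonic part orthogonal to the `y_j`. Vanishing on
`C` lets the `y_j` join the coexact part without changing its quotient by the radical in the old
degrees. Vanishing on the image of `ρ` preserves the old solution, since `⟨y_j, ρ e⟩ = 0 = ⟨y_j,
e⟩`.

In degree `l` one needs, for each `e`, an exact `x` with `⟨c, x⟩ = ⟨c, e⟩` for all coexact `c` of
degree `n - l`. With `x = d w`, integration by parts turns the left side into `± ⟨d c, w⟩`. Hence
every functional on `C^{n-l}` must have the form `c ↦ τ (d c) + ⟨d c, u⟩`
(`SolvesTwist.exists_functional`). As `d` is injective on `C`, this is a matter of functionals on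
the exact elements of degree `n + 1 - l`, and only the condition on the image of `ρ` is an obstacle.
That degree lies in the domain of `ρ` only if `n = 2k` and `l = k + 1`. Then the pairing on `E^k` is
perfect, and because `⟨u, ρ e⟩ = ⟨u, e⟩`, some `u ∈ E^k` absorbs the prescribed values on `ρ (E^k)`.

Connectedness shows that below degree `l`, and in degree `l` as well if `V^1 = 0`, the extension is
`V` plus the `y_j`, the `z_j` and decomposables, which lie in the radical (`koszul_cover`). This
determines the new coexact part there (`mem_twistCoexact_of_mem`), which suffices to check all
conditions. Both parts of the theorem are cases of `exists_twist_extension`; in part (b) the initial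
`ρ` has zero domain. -/

namespace CDGA

/-! ### Free graded commutative algebras and their universal property. -/

namespace FreeCGA

section Basic

variable (K : Type u) [Field K] {R : ℕ} (deg : Fin R → ℕ)

/-- The generators of the free graded commutative algebra. -/
noncomputable def gen (i : Fin R) : FreeCGA K deg :=
  RingQuot.mkAlgHom K _ (FreeAlgebra.ι K i)

theorem gen_mul_gen (i j : Fin R) :
    gen K deg i * gen K deg j = (-1 : K) ^ (deg i * deg j) • (gen K deg j * gen K deg i) := by
  have h := RingQuot.mkAlgHom_rel K (FreeCGARel.comm (K := K) (deg := deg) i j)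
  simpa [gen] using h

variable {K deg}

/-- The universal property of the free graded commutative algebra. -/
noncomputable def lift {B : Type*} [Semiring B] [Algebra K B] (f : Fin R → B)
    (hf : ∀ i j, f i * f j = (-1 : K) ^ (deg i * deg j) • (f j * f i)) : FreeCGA K deg →ₐ[K] B :=
  RingQuot.liftAlgHom K ⟨FreeAlgebra.lift K f, by
    rintro _ _ ⟨i, j⟩
    simpa using hf i j⟩

@[simp]
theorem lift_gen {B : Type*} [Semiring B] [Algebra K B] (f : Fin R → B)
    (hf : ∀ i j, f i * f j = (-1 : K) ^ (deg i * deg j) • (f j * f i)) (i : Fin R) :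
    lift f hf (gen K deg i) = f i := by
  simp [lift, gen]

theorem hom_ext {B : Type*} [Semiring B] [Algebra K B] {f g : FreeCGA K deg →ₐ[K] B}
    (h : ∀ i, f (gen K deg i) = g (gen K deg i)) : f = g := by
  refine RingQuot.ringQuot_ext' K f g ?_
  ext i
  exact h i

theorem induction {P : FreeCGA K deg → Prop} (hscalar : ∀ r : K, P (algebraMap K _ r))
    (hgen : ∀ i, P (gen K deg i)) (hadd : ∀ a b, P a → P b → P (a + b))
    (hmul : ∀ a b, P a → P b → P (a * b)) (a : FreeCGA K deg) : P a := by
  obtain ⟨a, rfl⟩ := RingQuot.mkAlgHom_surjective K _ a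
  induction a using FreeAlgebra.induction with
  | grade0 r => simpa using hscalar r
  | grade1 i => exact hgen i
  | mul a b ha hb => rw [map_mul]; exact hmul _ _ ha hb
  | add a b ha hb => rw [map_add]; exact hadd _ _ ha hb

end Basic

/-! ### Gradings by degree and by word length. -/

section Weights

variable (K : Type u) [Field K] {R : ℕ} (deg : Fin R → ℕ)

/-- The monomial given by a word in the generators. -/
noncomputable def word (s : List (Fin R)) : FreeCGA K deg := (s.map (gen K deg)).prod

@[simp] theorem word_nil : word K deg [] = 1 := rfl

@[simp] theorem word_cons (i : Fin R) (s : List (Fin R)) :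
    word K deg (i :: s) = gen K deg i * word K deg s := by
  simp [word]

theorem word_append (s t : List (Fin R)) :
    word K deg (s ++ t) = word K deg s * word K deg t := by
  simp [word]

/-- The span of all words of total weight `p`. -/
noncomputable def weightSpace (wt : Fin R → ℕ) (p : ℕ) : Submodule K (FreeCGA K deg) :=
  Submodule.span K {a | ∃ s : List (Fin R), (s.map wt).sum = p ∧ word K deg s = a}

variable {K deg} {wt : Fin R → ℕ}

theorem word_mem (s : List (Fin R)) : word K deg s ∈ weightSpace K deg wt (s.map wt).sum :=
  Submodule.subset_span ⟨s, rfl, rfl⟩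

theorem gen_mem (i : Fin R) : gen K deg i ∈ weightSpace K deg wt (wt i) := by
  simpa using word_mem (K := K) (deg := deg) (wt := wt) [i]

theorem weightSpace_le {p : ℕ} {S : Submodule K (FreeCGA K deg)}
    (h : ∀ s : List (Fin R), (s.map wt).sum = p → word K deg s ∈ S) :
    weightSpace K deg wt p ≤ S := by
  refine Submodule.span_le.2 ?_
  rintro _ ⟨s, hs, rfl⟩
  exact h s hs

instance : SetLike.GradedMonoid (weightSpace K deg wt) where
  one_mem := by simpa using word_mem (K := K) (deg := deg) (wt := wt) []
  mul_mem p q a b ha hb := by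
    have h : weightSpace K deg wt p * weightSpace K deg wt q ≤ weightSpace K deg wt (p + q) := by
      rw [weightSpace, weightSpace, Submodule.span_mul_span, Submodule.span_le]
      rintro _ ⟨_, ⟨s, rfl, rfl⟩, _, ⟨t, rfl, rfl⟩, rfl⟩
      exact Submodule.subset_span ⟨s ++ t, by simp, word_append K deg s t⟩
    exact h (Submodule.mul_mem_mul ha hb)

variable (K deg wt) in
/-- The splitting of the free graded commutative algebra by weight. -/
noncomputable def weightSplit : FreeCGA K deg →ₐ[K] ⨁ p, weightSpace K deg wt p :=
  lift (fun i => DirectSum.of (fun p => weightSpace K deg wt p) (wt i) ⟨gen K deg i, gen_mem i⟩)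
    (by
      intro i j
      rw [DirectSum.of_mul_of, DirectSum.of_mul_of, ← DirectSum.lof_eq_of K, ← DirectSum.lof_eq_of K,
        ← map_smul]
      rw [DirectSum.lof_eq_of, DirectSum.lof_eq_of]
      -- The two sides sit in weights `wt i + wt j` and `wt j + wt i`, which are equal only
      -- propositionally; hence the comparison in the sigma type.
      exact DirectSum.of_eq_of_gradedMonoid_eq
        (Sigma.subtype_ext (add_comm _ _) (gen_mul_gen K deg i j)))

theorem weightSplit_word (s : List (Fin R)) :
    weightSplit K deg wt (word K deg s) =
      DirectSum.of (fun p => weightSpace K deg wt p) (s.map wt).sum ⟨word K deg s, word_mem s⟩ := by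
  induction s with
  | nil => exact map_one _
  | cons i s ih =>
    refine (congrArg _ (word_cons K deg i s)).trans ?_
    rw [map_mul, ih, weightSplit, lift_gen, DirectSum.of_mul_of]
    exact DirectSum.of_eq_of_gradedMonoid_eq
      (Sigma.subtype_ext rfl rfl)

noncomputable instance : GradedAlgebra (weightSpace K deg wt) :=
  GradedAlgebra.ofAlgHom _ (weightSplit K deg wt)
    (hom_ext fun i => by
      rw [AlgHom.comp_apply, weightSplit, lift_gen, DirectSum.coeAlgHom_of]; rfl)
    (by
      rintro p ⟨a, ha⟩
      -- The elements on which the splitting is the tautological inclusion form a submodule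
      -- containing every word of weight `p`.
      have h : weightSpace K deg wt p ≤ (LinearMap.eqLocus
          (DirectSum.lof K ℕ (fun p => weightSpace K deg wt p) p)
          ((weightSplit K deg wt).toLinearMap ∘ₗ (weightSpace K deg wt p).subtype)).map
          (weightSpace K deg wt p).subtype := by
        refine weightSpace_le ?_
        rintro s rfl
        exact ⟨⟨word K deg s, word_mem s⟩, (weightSplit_word s).symm, rfl⟩
      obtain ⟨b, hb, rfl⟩ := h ha
      exact hb.symm)

theorem word_mul_word (s t : List (Fin R)) : word K deg s * word K deg t =
    (-1 : K) ^ ((s.map deg).sum * (t.map deg).sum) • (word K deg t * word K deg s) := by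
  have h1 (i : Fin R) (t : List (Fin R)) : gen K deg i * word K deg t =
      (-1 : K) ^ (deg i * (t.map deg).sum) • (word K deg t * gen K deg i) := by
    induction t with
    | nil => simp
    | cons j t ih =>
      rw [word_cons, ← mul_assoc, gen_mul_gen, smul_mul_assoc, mul_assoc, ih, mul_smul_comm,
        smul_smul, List.map_cons, List.sum_cons, mul_add, pow_add, mul_assoc]
  induction s with
  | nil => simp
  | cons i s ih =>
    rw [word_cons, mul_assoc, ih, mul_smul_comm, ← mul_assoc, h1, smul_mul_assoc, smul_smul,
      List.map_cons, List.sum_cons, add_mul, pow_add, mul_assoc, mul_comm ((-1 : K) ^ _)]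

theorem graded_comm {p q : ℕ} {a b : FreeCGA K deg} (ha : a ∈ weightSpace K deg deg p)
    (hb : b ∈ weightSpace K deg deg q) : a * b = (-1 : K) ^ (p * q) • (b * a) := by
  induction ha using Submodule.span_induction with
  | zero => simp
  | add x y _ _ hx hy => rw [add_mul, mul_add, hx, hy, smul_add]
  | smul r x _ hx => rw [smul_mul_assoc, mul_smul_comm, hx, smul_comm]
  | mem x hx =>
    obtain ⟨s, rfl, rfl⟩ := hx
    induction hb using Submodule.span_induction with
    | zero => simp
    | add x y _ _ hx hy => rw [add_mul, mul_add, hx, hy, smul_add]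
    | smul r x _ hx => rw [smul_mul_assoc, mul_smul_comm, hx, smul_comm]
    | mem y hy =>
      obtain ⟨t, rfl, rfl⟩ := hy
      exact word_mul_word s t

end Weights

/-! ### Odd derivations with prescribed values on generators. -/

section Derivations

variable {K : Type u} [Field K] {R : ℕ} {deg : Fin R → ℕ}

variable (K deg) in
/-- The sign automorphism of the free graded commutative algebra. -/
noncomputable def signHom : FreeCGA K deg →ₐ[K] FreeCGA K deg :=
  lift (fun i => (-1 : K) ^ deg i • gen K deg i) fun i j => by
    rw [smul_mul_smul_comm, gen_mul_gen, smul_mul_smul_comm, smul_comm, mul_comm ((-1 : K) ^ deg i)]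

@[simp] theorem signHom_gen (i : Fin R) :
    signHom K deg (gen K deg i) = (-1 : K) ^ deg i • gen K deg i := lift_gen _ _ i

theorem signHom_of_mem {p : ℕ} {a : FreeCGA K deg} (ha : a ∈ weightSpace K deg deg p) :
    signHom K deg a = (-1 : K) ^ p • a := by
  have hw (s : List (Fin R)) : signHom K deg (word K deg s) =
      (-1 : K) ^ (s.map deg).sum • word K deg s := by
    induction s with
    | nil => simp
    | cons i s ih =>
      rw [word_cons, map_mul, ih, signHom_gen, smul_mul_smul_comm, List.map_cons, List.sum_cons,
        pow_add]
  have h : weightSpace K deg deg p ≤ LinearMap.eqLocus (signHom K deg).toLinearMap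
      ((-1 : K) ^ p • LinearMap.id) := by
    refine weightSpace_le ?_
    rintro s rfl
    exact hw s
  exact h ha

theorem signHom_signHom (a : FreeCGA K deg) : signHom K deg (signHom K deg a) = a := by
  have h : (signHom K deg).comp (signHom K deg) = AlgHom.id K _ := hom_ext fun i => by
    simp [smul_smul, ← mul_pow]
  exact DFunLike.congr_fun h a

/-- The compatibility with signs of values on generators which makes them extend to an odd
derivation. -/
def IsOdd (D : Fin R → FreeCGA K deg) : Prop :=
  ∀ i j, D i * gen K deg j = (-1 : K) ^ ((deg i + 1) * deg j) • (gen K deg j * D i)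

variable {D : Fin R → FreeCGA K deg}

/-- The algebra map `a ↦ [[sign a, D a], [0, a]]` encoding the odd derivation with given values on
generators. -/
noncomputable def derivMatrix (hD : IsOdd D) : FreeCGA K deg →ₐ[K] Matrix (Fin 2) (Fin 2) (FreeCGA K deg) :=
  lift (fun i => !![(-1 : K) ^ deg i • gen K deg i, D i; 0, gen K deg i]) fun i j => by
    -- The upper right entry of the commutation relation: `IsOdd` for `(i, j)` and for `(j, i)`
    -- exchanges the two summands.
    have h1 : ((-1 : K) ^ deg i • gen K deg i) * D j + D i * gen K deg j =
        (-1 : K) ^ (deg i * deg j) •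
          (((-1 : K) ^ deg j • gen K deg j) * D i + D j * gen K deg i) := by
      rw [hD i j, hD j i, smul_mul_assoc, smul_mul_assoc, smul_add, smul_smul, smul_smul, add_comm]
      congr 1
      · congr 1
        rw [add_mul, one_mul, pow_add]
      · congr 1
        rw [add_mul, one_mul, pow_add, ← mul_assoc, mul_comm (deg j), ← mul_pow]
        simp
    have h2 : ((-1 : K) ^ deg i • gen K deg i) * ((-1 : K) ^ deg j • gen K deg j) =
        (-1 : K) ^ (deg i * deg j) •
          (((-1 : K) ^ deg j • gen K deg j) * ((-1 : K) ^ deg i • gen K deg i)) := by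
      simpa using congrArg (signHom K deg) (gen_mul_gen K deg i j)
    rw [Matrix.mul_fin_two, Matrix.mul_fin_two, h1, h2, gen_mul_gen K deg i j]
    ext a b
    fin_cases a <;> fin_cases b <;> simp

/-- The odd derivation with given values on generators. -/
noncomputable def oddDeriv (hD : IsOdd D) : FreeCGA K deg →ₗ[K] FreeCGA K deg :=
  (Matrix.entryLinearMap K (FreeCGA K deg) 0 1) ∘ₗ (derivMatrix hD).toLinearMap

@[simp] theorem oddDeriv_gen (hD : IsOdd D) (i : Fin R) : oddDeriv hD (gen K deg i) = D i := by
  simp [oddDeriv, derivMatrix]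

/-- Identifying the entries turns multiplicativity of `derivMatrix` into the signed Leibniz rule
`oddDeriv_mul`. -/
theorem derivMatrix_apply (hD : IsOdd D) (a : FreeCGA K deg) :
    derivMatrix hD a = !![signHom K deg a, oddDeriv hD a; 0, a] := by
  have key : derivMatrix hD a 0 0 = signHom K deg a ∧ derivMatrix hD a 1 0 = 0 ∧
      derivMatrix hD a 1 1 = a := by
    induction a using FreeCGA.induction with
    | hscalar r => simp [Matrix.algebraMap_matrix_apply]
    | hgen i => simp [derivMatrix]
    | hadd a b ha hb => simp [ha, hb]
    | hmul a b ha hb => simp [Matrix.mul_apply, Fin.sum_univ_two, ha, hb]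
  ext i j
  fin_cases i <;> fin_cases j
  · exact key.1
  · rfl
  · exact key.2.1
  · exact key.2.2

theorem oddDeriv_mul (hD : IsOdd D) (a b : FreeCGA K deg) :
    oddDeriv hD (a * b) = oddDeriv hD a * b + signHom K deg a * oddDeriv hD b := by
  have h := congrFun (congrFun (map_mul (derivMatrix hD) a b) 0) 1
  rw [derivMatrix_apply, derivMatrix_apply, derivMatrix_apply, Matrix.mul_fin_two] at h
  simpa [add_comm] using h

@[simp] theorem oddDeriv_one (hD : IsOdd D) : oddDeriv hD 1 = 0 := by
  simpa using oddDeriv_mul hD 1 1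

theorem oddDeriv_algebraMap (hD : IsOdd D) (r : K) : oddDeriv hD (algebraMap K _ r) = 0 := by
  rw [Algebra.algebraMap_eq_smul_one, map_smul, oddDeriv_one, smul_zero]

/-- This anticommutation removes the cross terms when two odd derivations are composed on a product,
both in `d ∘ d = 0` and in the homotopy formula. -/
theorem signHom_oddDeriv (hD : IsOdd D)
    (hs : ∀ i, signHom K deg (D i) = (-1 : K) ^ (deg i + 1) • D i) (a : FreeCGA K deg) :
    signHom K deg (oddDeriv hD a) + oddDeriv hD (signHom K deg a) = 0 := by
  induction a using FreeCGA.induction with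
  | hscalar r => simp [oddDeriv_algebraMap]
  | hgen i =>
    rw [oddDeriv_gen, hs, signHom_gen, map_smul, oddDeriv_gen, ← add_smul, pow_succ, mul_neg_one,
      neg_add_cancel, zero_smul]
  | hadd a b ha hb =>
    rw [map_add, map_add, map_add, map_add, add_add_add_comm, ha, hb, add_zero]
  | hmul a b ha hb =>
    rw [map_mul (signHom K deg) a b, oddDeriv_mul, oddDeriv_mul, map_add, map_mul, map_mul, add_add_add_comm, ← add_mul,
      ← mul_add, ha, hb, zero_mul, mul_zero, add_zero]

/-- The weight is kept arbitrary so that the lemma serves for the degree, with `k = 1`, and for the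
word length, with `k = 0`. -/
theorem oddDeriv_mem (hD : IsOdd D) {wt : Fin R → ℕ} {k : ℕ}
    (hk : ∀ i, D i ∈ weightSpace K deg wt (wt i + k)) {p : ℕ} {a : FreeCGA K deg}
    (ha : a ∈ weightSpace K deg wt p) : oddDeriv hD a ∈ weightSpace K deg wt (p + k) := by
  have hw (s : List (Fin R)) :
      oddDeriv hD (word K deg s) ∈ weightSpace K deg wt ((s.map wt).sum + k) := by
    induction s with
    | nil => simp
    | cons i s ih =>
      rw [word_cons, oddDeriv_mul, oddDeriv_gen, signHom_gen, List.map_cons, List.sum_cons]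
      refine Submodule.add_mem _ ?_ ?_
      · have := SetLike.GradedMul.mul_mem (hk i) (word_mem (K := K) (deg := deg) (wt := wt) s)
        rwa [add_right_comm] at this
      · rw [smul_mul_assoc]
        have := SetLike.GradedMul.mul_mem (gen_mem (K := K) (deg := deg) (wt := wt) i) ih
        rw [← add_assoc] at this
        exact Submodule.smul_mem _ _ this
  have h : weightSpace K deg wt p ≤ (weightSpace K deg wt (p + k)).comap (oddDeriv hD) := by
    refine weightSpace_le ?_
    rintro s rfl
    exact hw s
  exact h ha

end Derivations

/-! ### Augmentation and linear coefficients. -/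

section Linear

variable {K : Type u} [Field K] {R : ℕ} {deg : Fin R → ℕ}

variable (K deg) in
/-- The projection to the constant and linear parts. -/
noncomputable def linearize : FreeCGA K deg →ₐ[K] TrivSqZeroExt K (Fin R → K) :=
  lift (fun i => TrivSqZeroExt.inr (Pi.single i 1)) fun i j => by
    rw [TrivSqZeroExt.inr_mul_inr, TrivSqZeroExt.inr_mul_inr, smul_zero]

variable (K deg) in
/-- The augmentation, sending all generators to zero. -/
noncomputable def aug : FreeCGA K deg →ₐ[K] K :=
  (TrivSqZeroExt.fstHom K K (Fin R → K)).comp (linearize K deg)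

/-- The coefficient of a generator. -/
noncomputable def coeff (i : Fin R) : FreeCGA K deg →ₗ[K] K :=
  LinearMap.proj i ∘ₗ TrivSqZeroExt.sndHom K (Fin R → K) ∘ₗ (linearize K deg).toLinearMap

@[simp] theorem aug_gen (i : Fin R) : aug K deg (gen K deg i) = 0 := by
  simp [aug, linearize]

@[simp] theorem coeff_gen (i j : Fin R) :
    coeff i (gen K deg j) = (Pi.single j 1 : Fin R → K) i := by
  simp [coeff, linearize]

@[simp] theorem coeff_one (i : Fin R) : coeff i (1 : FreeCGA K deg) = 0 := by
  simp [coeff]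

theorem coeff_mul (i : Fin R) (a b : FreeCGA K deg) :
    coeff i (a * b) = aug K deg a * coeff i b + aug K deg b * coeff i a := by
  simp [coeff, aug]

theorem aug_of_mem {wt : Fin R → ℕ} {p : ℕ} (hp : p ≠ 0) {a : FreeCGA K deg}
    (ha : a ∈ weightSpace K deg wt p) : aug K deg a = 0 := by
  have h : weightSpace K deg wt p ≤ LinearMap.ker (aug K deg).toLinearMap := by
    refine weightSpace_le ?_
    rintro (_ | ⟨i, s⟩) rfl
    · simp at hp
    · simp
  exact h ha

theorem coeff_of_mem {wt : Fin R → ℕ} {p : ℕ} {i : Fin R} (hp : p ≠ wt i) {a : FreeCGA K deg}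
    (ha : a ∈ weightSpace K deg wt p) : coeff i a = 0 := by
  have h : weightSpace K deg wt p ≤ LinearMap.ker (coeff (K := K) (deg := deg) i) := by
    refine weightSpace_le ?_
    rintro (_ | ⟨j, _ | ⟨k, s⟩⟩) rfl
    · simp
    · have : i ≠ j := by rintro rfl; simp at hp
      simp [this]
    · simp [coeff_mul]
  exact h ha

theorem aug_oddDeriv {D : Fin R → FreeCGA K deg} (hD : IsOdd D) (h : ∀ i, aug K deg (D i) = 0)
    (a : FreeCGA K deg) : aug K deg (oddDeriv hD a) = 0 := by
  induction a using FreeCGA.induction with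
  | hscalar r => rw [oddDeriv_algebraMap, map_zero]
  | hgen i => rw [oddDeriv_gen, h]
  | hadd a b ha hb => rw [map_add, map_add, ha, hb, add_zero]
  | hmul a b ha hb => rw [oddDeriv_mul, map_add, map_mul, map_mul, ha, hb, zero_mul, mul_zero, add_zero]

theorem aug_signHom (a : FreeCGA K deg) : aug K deg (signHom K deg a) = aug K deg a := by
  have h : (aug K deg).comp (signHom K deg) = aug K deg := hom_ext fun i => by simp
  exact DFunLike.congr_fun h a

/-- Covers both the differential `y_j ↦ z_j` and the contraction `z_j ↦ y_j`: each generator goes to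
zero or to a generator of opposite parity. -/
theorem isOdd_of_gen {D : Fin R → FreeCGA K deg}
    (h : ∀ i, D i = 0 ∨ ∃ k, D i = gen K deg k ∧ (-1 : K) ^ deg k = (-1 : K) ^ (deg i + 1)) :
    IsOdd D := by
  intro i j
  rcases h i with h | ⟨k, h, hk⟩
  · simp [h]
  · rw [h, gen_mul_gen, pow_mul, hk, ← pow_mul]

theorem signHom_of_gen {D : Fin R → FreeCGA K deg}
    (h : ∀ i, D i = 0 ∨ ∃ k, D i = gen K deg k ∧ (-1 : K) ^ deg k = (-1 : K) ^ (deg i + 1))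
    (i : Fin R) : signHom K deg (D i) = (-1 : K) ^ (deg i + 1) • D i := by
  rcases h i with h | ⟨k, h, hk⟩
  · simp [h]
  · rw [h, signHom_gen, hk]

end Linear

end FreeCGA

/-! ### The contractible Sullivan algebra on `y_j` and `z_j = d y_j`. -/

section Koszul

open FreeCGA

variable (K : Type u) [Field K] (r m : ℕ)

/-- The degrees of the generators of the contractible algebra: `r` generators `z_j` of degree
`m + 1`, followed by `r` generators `y_j` of degree `m`. -/
def koszulDeg : Fin (r + r) → ℕ := Fin.addCases (fun _ => m + 1) (fun _ => m)

@[simp] theorem koszulDeg_castAdd (j : Fin r) : koszulDeg r m (Fin.castAdd r j) = m + 1 := by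
  simp [koszulDeg]

@[simp] theorem koszulDeg_natAdd (j : Fin r) : koszulDeg r m (Fin.natAdd r j) = m :=
  Fin.addCases_right j

/-- The generators of degree `m`. -/
noncomputable def koszulY (j : Fin r) : FreeCGA K (koszulDeg r m) := gen K _ (Fin.natAdd r j)

/-- The generators of degree `m + 1`. -/
noncomputable def koszulZ (j : Fin r) : FreeCGA K (koszulDeg r m) := gen K _ (Fin.castAdd r j)

/-- The values `y_j ↦ z_j`, `z_j ↦ 0` of the differential on generators. -/
noncomputable def koszulDVal : Fin (r + r) → FreeCGA K (koszulDeg r m) :=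
  Fin.addCases (fun _ => 0) (koszulZ K r m)

/-- The values `z_j ↦ y_j`, `y_j ↦ 0` of the contracting derivation on generators. -/
noncomputable def koszulHVal : Fin (r + r) → FreeCGA K (koszulDeg r m) :=
  Fin.addCases (koszulY K r m) (fun _ => 0)

theorem koszulDVal_spec (i : Fin (r + r)) : koszulDVal K r m i = 0 ∨
    ∃ k, koszulDVal K r m i = gen K _ k ∧
      (-1 : K) ^ koszulDeg r m k = (-1 : K) ^ (koszulDeg r m i + 1) := by
  induction i using Fin.addCases with
  | left j => exact Or.inl (by simp [koszulDVal])
  | right j => exact Or.inr ⟨Fin.castAdd r j, Fin.addCases_right j, by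
      rw [koszulDeg_castAdd, koszulDeg_natAdd]⟩

theorem koszulHVal_spec (i : Fin (r + r)) : koszulHVal K r m i = 0 ∨
    ∃ k, koszulHVal K r m i = gen K _ k ∧
      (-1 : K) ^ koszulDeg r m k = (-1 : K) ^ (koszulDeg r m i + 1) := by
  induction i using Fin.addCases with
  | left j => exact Or.inr ⟨Fin.natAdd r j, Fin.addCases_left j, by
      rw [koszulDeg_castAdd, koszulDeg_natAdd]; simp [pow_succ]⟩
  | right j => exact Or.inl (Fin.addCases_right j)

/-- The differential of the contractible algebra. -/
noncomputable def koszulD : FreeCGA K (koszulDeg r m) →ₗ[K] FreeCGA K (koszulDeg r m) :=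
  oddDeriv (isOdd_of_gen (koszulDVal_spec K r m))

/-- The contracting derivation. -/
noncomputable def koszulH : FreeCGA K (koszulDeg r m) →ₗ[K] FreeCGA K (koszulDeg r m) :=
  oddDeriv (isOdd_of_gen (koszulHVal_spec K r m))

@[simp] theorem koszulD_y (j : Fin r) : koszulD K r m (koszulY K r m j) = koszulZ K r m j :=
  (oddDeriv_gen _ _).trans (Fin.addCases_right j)

@[simp] theorem koszulD_z (j : Fin r) : koszulD K r m (koszulZ K r m j) = 0 := by
  simp [koszulD, koszulZ, koszulDVal]

@[simp] theorem koszulH_z (j : Fin r) : koszulH K r m (koszulZ K r m j) = koszulY K r m j := by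
  simp [koszulH, koszulZ, koszulHVal]

@[simp] theorem koszulH_y (j : Fin r) : koszulH K r m (koszulY K r m j) = 0 :=
  (oddDeriv_gen _ _).trans (Fin.addCases_right j)

theorem koszul_cases {P : FreeCGA K (koszulDeg r m) → Prop} (hz : ∀ j, P (koszulZ K r m j))
    (hy : ∀ j, P (koszulY K r m j)) (i : Fin (r + r)) : P (gen K _ i) := by
  induction i using Fin.addCases with
  | left j => exact hz j
  | right j => exact hy j

theorem koszulD_koszulD (a : FreeCGA K (koszulDeg r m)) : koszulD K r m (koszulD K r m a) = 0 := by
  induction a using FreeCGA.induction with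
  | hscalar c => rw [koszulD, FreeCGA.oddDeriv_algebraMap, map_zero]
  | hgen i =>
    exact koszul_cases K r m (P := fun a => koszulD K r m (koszulD K r m a) = 0)
      (by simp) (by simp) i
  | hadd a b ha hb => rw [map_add, map_add, ha, hb, add_zero]
  | hmul a b ha hb =>
    have hs := signHom_oddDeriv (isOdd_of_gen (koszulDVal_spec K r m))
      (signHom_of_gen (koszulDVal_spec K r m)) a
    rw [koszulD] at ha hb ⊢
    rw [oddDeriv_mul, map_add, oddDeriv_mul, oddDeriv_mul, ha, hb, zero_mul, mul_zero, zero_add, add_zero,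
      ← add_mul, hs, zero_mul]

/-- The anticommutator of two odd derivations is an even derivation. This one fixes every generator,
so it multiplies a word by its length. -/
theorem koszulD_koszulH_add (s : List (Fin (r + r))) :
    koszulD K r m (koszulH K r m (word K _ s)) + koszulH K r m (koszulD K r m (word K _ s)) =
      (s.length : K) • word K _ s := by
  induction s with
  | nil => simp [koszulD, koszulH]
  | cons i s ih =>
    have hg : koszulD K r m (koszulH K r m (gen K _ i)) +
        koszulH K r m (koszulD K r m (gen K _ i)) = gen K _ i :=
      koszul_cases K r m (P := fun a => koszulD K r m (koszulH K r m a) +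
        koszulH K r m (koszulD K r m a) = a) (by simp) (by simp) i
    have hs := signHom_oddDeriv (isOdd_of_gen (koszulDVal_spec K r m))
      (signHom_of_gen (koszulDVal_spec K r m)) (gen K _ i)
    have hs' := signHom_oddDeriv (isOdd_of_gen (koszulHVal_spec K r m))
      (signHom_of_gen (koszulHVal_spec K r m)) (gen K _ i)
    rw [word_cons]
    generalize gen K (koszulDeg r m) i = a at *
    generalize word K (koszulDeg r m) s = b at *
    rw [koszulD, koszulH] at *
    simp only [oddDeriv_mul, map_add, signHom_signHom]
    calc _ = (oddDeriv (isOdd_of_gen (koszulDVal_spec K r m))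
            (oddDeriv (isOdd_of_gen (koszulHVal_spec K r m)) a) +
          oddDeriv (isOdd_of_gen (koszulHVal_spec K r m))
            (oddDeriv (isOdd_of_gen (koszulDVal_spec K r m)) a)) * b +
        a * (oddDeriv (isOdd_of_gen (koszulDVal_spec K r m))
            (oddDeriv (isOdd_of_gen (koszulHVal_spec K r m)) b) +
          oddDeriv (isOdd_of_gen (koszulHVal_spec K r m))
            (oddDeriv (isOdd_of_gen (koszulDVal_spec K r m)) b)) +
        ((signHom K _ (oddDeriv (isOdd_of_gen (koszulHVal_spec K r m)) a) +
          oddDeriv (isOdd_of_gen (koszulHVal_spec K r m)) (signHom K _ a)) *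
            oddDeriv (isOdd_of_gen (koszulDVal_spec K r m)) b +
        (signHom K _ (oddDeriv (isOdd_of_gen (koszulDVal_spec K r m)) a) +
          oddDeriv (isOdd_of_gen (koszulDVal_spec K r m)) (signHom K _ a)) *
            oddDeriv (isOdd_of_gen (koszulHVal_spec K r m)) b) := by
          simp only [add_mul, mul_add]; abel
      _ = _ := by
        rw [hs, hs', hg, ih, zero_mul, zero_mul, add_zero, add_zero, mul_smul_comm,
          List.length_cons, Nat.cast_succ, add_smul, one_smul]
        exact add_comm _ _

/-- Division of the part of word length `p` by `p`. -/
noncomputable def lengthInv : FreeCGA K (koszulDeg r m) →ₗ[K] FreeCGA K (koszulDeg r m) :=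
  DirectSum.toModule K ℕ _ (fun p => (p : K)⁻¹ •
    (weightSpace K (koszulDeg r m) (fun _ => 1) p).subtype) ∘ₗ
    (DirectSum.decomposeLinearEquiv (weightSpace K (koszulDeg r m) (fun _ => 1))).toLinearMap

theorem lengthInv_of_mem {p : ℕ} {a : FreeCGA K (koszulDeg r m)}
    (ha : a ∈ weightSpace K (koszulDeg r m) (fun _ => 1) p) :
    lengthInv K r m a = (p : K)⁻¹ • a := by
  lift a to weightSpace K (koszulDeg r m) (fun _ => 1) p using ha
  simp [lengthInv]

/-- The contracting homotopy. -/
noncomputable def koszulHomotopy : FreeCGA K (koszulDeg r m) →ₗ[K] FreeCGA K (koszulDeg r m) :=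
  koszulH K r m ∘ₗ lengthInv K r m

theorem span_word : Submodule.span K (Set.range (word K (koszulDeg r m))) = ⊤ := by
  rw [eq_top_iff]
  rintro a -
  induction a using FreeCGA.induction with
  | hscalar c =>
    rw [Algebra.algebraMap_eq_smul_one]
    exact Submodule.smul_mem _ _ (Submodule.subset_span ⟨[], rfl⟩)
  | hgen i => exact Submodule.subset_span ⟨[i], by simp⟩
  | hadd a b ha hb => exact Submodule.add_mem _ ha hb
  | hmul a b ha hb =>
    have h := Submodule.mul_mem_mul ha hb
    rw [Submodule.span_mul_span] at h
    refine Submodule.span_mono ?_ h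
    rintro _ ⟨_, ⟨s, rfl⟩, _, ⟨t, rfl⟩, rfl⟩
    exact ⟨s ++ t, word_append K _ s t⟩

theorem koszulHomotopy_spec [CharZero K] (a : FreeCGA K (koszulDeg r m)) :
    koszulD K r m (koszulHomotopy K r m a) + koszulHomotopy K r m (koszulD K r m a) +
      aug K _ a • 1 = a := by
  have h : (koszulD K r m ∘ₗ koszulHomotopy K r m + koszulHomotopy K r m ∘ₗ koszulD K r m +
      LinearMap.toSpanSingleton K _ 1 ∘ₗ (aug K (koszulDeg r m)).toLinearMap) = LinearMap.id := by
    refine LinearMap.ext_on_range (span_word K r m) fun s => ?_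
    have hw : word K (koszulDeg r m) s ∈ weightSpace K (koszulDeg r m) (fun _ => 1) s.length := by
      simpa using word_mem (K := K) (deg := koszulDeg r m) (wt := fun _ => 1) s
    have hdw : koszulD K r m (word K (koszulDeg r m) s) ∈
        weightSpace K (koszulDeg r m) (fun _ => 1) s.length := by
      refine oddDeriv_mem (k := 0) _ (fun i => ?_) hw
      rcases koszulDVal_spec K r m i with h | ⟨k, h, -⟩
      · rw [h]; exact Submodule.zero_mem _
      · rw [h]; exact gen_mem (K := K) (deg := koszulDeg r m) (wt := fun _ => 1) k
    simp only [LinearMap.add_apply, LinearMap.comp_apply, koszulHomotopy, lengthInv_of_mem K r m hw,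
      lengthInv_of_mem K r m hdw, map_smul, ← smul_add, koszulD_koszulH_add, LinearMap.id_apply,
      AlgHom.toLinearMap_apply, LinearMap.toSpanSingleton_apply]
    -- On the empty word the division by length is by `0⁻¹ = 0` and only the augmentation term
    -- survives. On any other word the length is invertible and the augmentation vanishes.
    cases s with
    | nil => simp
    | cons i s =>
      rw [smul_smul, inv_mul_cancel₀ (by simp only [List.length_cons]; exact Nat.cast_ne_zero.2 (by omega)), one_smul]
      simp
  exact LinearMap.congr_fun h a

/-- The contractible algebra: the free graded commutative algebra on `y_j` of degree `m` and
`z_j = d y_j` of degree `m + 1`, for `j < r`. -/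
noncomputable def koszul : CDGA.{u, u} K where
  carrier := FreeCGA K (koszulDeg r m)
  ring := Algebra.semiringToRing K
  grading := weightSpace K (koszulDeg r m) (koszulDeg r m)
  d := koszulD K r m
  d_mem := by
    intro i a ha
    refine oddDeriv_mem (k := 1) _ (fun i => ?_) ha
    induction i using Fin.addCases with
    | left j => simp [koszulDVal]
    | right j =>
      have := gen_mem (K := K) (deg := koszulDeg r m) (wt := koszulDeg r m) (Fin.castAdd r j)
      rw [koszulDeg_castAdd] at this
      rw [koszulDeg_natAdd]
      have e : koszulDVal K r m (Fin.natAdd r j) = koszulZ K r m j := Fin.addCases_right j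
      rw [e]
      exact this
  d_d := koszulD_koszulD K r m
  leibniz := by
    intro i a ha b
    have := oddDeriv_mul (isOdd_of_gen (koszulDVal_spec K r m)) a b
    rw [signHom_of_mem ha, smul_mul_assoc] at this
    exact this
  comm := graded_comm

/-- The `z_j` are numbered before the `y_j`, so `d y_j = z_j` is an earlier generator. The
conditions on `m` are required only if there is a generator; `r = 0` gives the ground field for
every `m`. -/
theorem koszul_isSullivanIn {s : Set ℕ} (h : Fin r → 0 < m ∧ m ∈ s ∧ m + 1 ∈ s) :
    (koszul K r m).IsSullivanIn s := by
  refine ⟨r + r, koszulDeg r m, gen K _, fun i => gen_mem i, fun i => ?_, ?_, fun j => ?_⟩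
  · induction i using Fin.addCases with
    | left j => simpa using (h j).2.2
    | right j => rw [koszulDeg_natAdd]; exact ⟨(h j).1, (h j).2.1⟩
  · have : (koszul K r m).freeCGALift (koszulDeg r m) (gen K _) (fun i => gen_mem i) =
        AlgHom.id K (FreeCGA K (koszulDeg r m)) :=
      hom_ext fun i => lift_gen (K := K) (deg := koszulDeg r m) (gen K _) (gen_mul_gen K _) i
    rw [this]
    exact Function.bijective_id
  · induction j using Fin.addCases with
    | left j =>
      have : (koszul K r m).d (gen K (koszulDeg r m) (Fin.castAdd r j)) = 0 := koszulD_z K r m j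
      rw [this]
      exact Subalgebra.zero_mem _
    | right j =>
      have : (koszul K r m).d (gen K (koszulDeg r m) (Fin.natAdd r j)) = koszulZ K r m j :=
        koszulD_y K r m j
      rw [this]
      refine Algebra.subset_adjoin ⟨Fin.castAdd r j, ?_, rfl⟩
      rw [Fin.lt_def, Fin.val_castAdd, Fin.val_natAdd]
      omega

/-- The augmentation of the contractible algebra. -/
noncomputable def koszulAug : koszul K r m →ₐ[K] K := aug K (koszulDeg r m)

theorem koszulAug_d (a : koszul K r m) : koszulAug K r m ((koszul K r m).d a) = 0 := by
  refine aug_oddDeriv _ (fun i => ?_) a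
  rcases koszulDVal_spec K r m i with h | ⟨k, h, -⟩ <;> simp [h]

/-- The augmentation kills exact elements, so no nonzero scalar is exact; the homotopy makes every
cocycle cohomologous to its augmentation. -/
theorem koszul_isAcyclic [CharZero K] : (koszul K r m).IsAcyclic := by
  constructor
  · rw [injective_iff_map_eq_zero]
    intro c hc
    rw [LinearMap.toSpanSingleton_apply, ← Submodule.Quotient.mk_smul,
      Submodule.Quotient.mk_eq_zero] at hc
    obtain ⟨b, hb⟩ := hc
    have := congrArg (koszulAug K r m) hb
    rw [koszulAug_d] at this
    simpa using this.symm
  · intro q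
    obtain ⟨⟨a, ha⟩, rfl⟩ := Submodule.Quotient.mk_surjective _ q
    refine ⟨koszulAug K r m a, ?_⟩
    rw [LinearMap.toSpanSingleton_apply, ← Submodule.Quotient.mk_smul, eq_comm,
      Submodule.Quotient.eq]
    refine ⟨koszulHomotopy K r m a, ?_⟩
    have h := koszulHomotopy_spec K r m a
    have ha' : koszulD K r m a = 0 := ha
    rw [ha', map_zero, add_zero] at h
    exact eq_sub_of_add_eq h

/-- The coefficient of the generator `y_j`. -/
noncomputable def coeffY (j : Fin r) : koszul K r m →ₗ[K] K :=
  coeff (K := K) (deg := koszulDeg r m) (Fin.natAdd r j)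

/-- The coefficient of the generator `z_j`. -/
noncomputable def coeffZ (j : Fin r) : koszul K r m →ₗ[K] K :=
  coeff (K := K) (deg := koszulDeg r m) (Fin.castAdd r j)

/-- The generator `y_j`, as an element of the contractible algebra. -/
noncomputable def genY (j : Fin r) : koszul K r m := koszulY K r m j

/-- The generator `z_j`, as an element of the contractible algebra. -/
noncomputable def genZ (j : Fin r) : koszul K r m := koszulZ K r m j

theorem genY_mem (j : Fin r) : genY K r m j ∈ (koszul K r m).grading m := by
  have := gen_mem (K := K) (deg := koszulDeg r m) (wt := koszulDeg r m) (Fin.natAdd r j)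
  rwa [koszulDeg_natAdd] at this

theorem genZ_mem (j : Fin r) : genZ K r m j ∈ (koszul K r m).grading (m + 1) := by
  have := gen_mem (K := K) (deg := koszulDeg r m) (wt := koszulDeg r m) (Fin.castAdd r j)
  rwa [koszulDeg_castAdd] at this

theorem d_genY (j : Fin r) : (koszul K r m).d (genY K r m j) = genZ K r m j := koszulD_y K r m j

theorem coeffY_genY (i j : Fin r) :
    coeffY K r m i (genY K r m j) = (Pi.single j 1 : Fin r → K) i := by
  refine (coeff_gen _ _).trans ?_
  simp [Pi.single_apply]

theorem coeffY_genZ (i j : Fin r) : coeffY K r m i (genZ K r m j) = 0 := by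
  refine (coeff_gen _ _).trans ?_
  rw [Pi.single_apply, if_neg]
  intro h
  have := congrArg Fin.val h
  simp at this
  omega

theorem coeffZ_genY (i j : Fin r) : coeffZ K r m i (genY K r m j) = 0 := by
  refine (coeff_gen _ _).trans ?_
  rw [Pi.single_apply, if_neg]
  intro h
  have := congrArg Fin.val h
  simp at this
  omega

theorem coeffZ_genZ (i j : Fin r) :
    coeffZ K r m i (genZ K r m j) = (Pi.single j 1 : Fin r → K) i := by
  refine (coeff_gen _ _).trans ?_
  simp [Pi.single_apply]

theorem koszulAug_genY (j : Fin r) : koszulAug K r m (genY K r m j) = 0 := aug_gen _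

theorem koszulAug_genZ (j : Fin r) : koszulAug K r m (genZ K r m j) = 0 := aug_gen _

theorem coeffY_one (j : Fin r) : coeffY K r m j 1 = 0 := coeff_one _

theorem coeffZ_one (j : Fin r) : coeffZ K r m j 1 = 0 := coeff_one _

theorem coeffY_mul (j : Fin r) (a b : koszul K r m) : coeffY K r m j (a * b) =
    koszulAug K r m a * coeffY K r m j b + koszulAug K r m b * coeffY K r m j a := coeff_mul _ _ _

theorem coeffZ_mul (j : Fin r) (a b : koszul K r m) : coeffZ K r m j (a * b) =
    koszulAug K r m a * coeffZ K r m j b + koszulAug K r m b * coeffZ K r m j a := coeff_mul _ _ _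

theorem koszulAug_of_mem {p : ℕ} (hp : p ≠ 0) {a : koszul K r m}
    (ha : a ∈ (koszul K r m).grading p) : koszulAug K r m a = 0 := aug_of_mem hp ha

theorem coeffY_of_mem {p : ℕ} (hp : p ≠ m) {a : koszul K r m}
    (ha : a ∈ (koszul K r m).grading p) (j : Fin r) : coeffY K r m j a = 0 :=
  coeff_of_mem (by rwa [koszulDeg_natAdd]) ha

theorem coeffZ_of_mem {p : ℕ} (hp : p ≠ m + 1) {a : koszul K r m}
    (ha : a ∈ (koszul K r m).grading p) (j : Fin r) : coeffZ K r m j a = 0 :=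
  coeff_of_mem (by simpa using hp) ha

/-- The differential preserves word length, and on linear parts it is `y_j ↦ z_j`. -/
theorem coeff_d (a : koszul K r m) (j : Fin r) :
    coeffY K r m j ((koszul K r m).d a) = 0 ∧
      coeffZ K r m j ((koszul K r m).d a) = coeffY K r m j a := by
  have haug (a : FreeCGA K (koszulDeg r m)) : aug K _ (koszulD K r m a) = 0 := koszulAug_d K r m a
  have key (a : FreeCGA K (koszulDeg r m)) :
      coeff (Fin.natAdd r j) (koszulD K r m a) = 0 ∧
        coeff (Fin.castAdd r j) (koszulD K r m a) = coeff (Fin.natAdd r j) a := by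
    induction a using FreeCGA.induction with
    | hscalar c =>
      rw [koszulD, FreeCGA.oddDeriv_algebraMap, Algebra.algebraMap_eq_smul_one]
      simp
    | hgen i =>
      refine koszul_cases K r m (P := fun a => coeff (Fin.natAdd r j) (koszulD K r m a) = 0 ∧
        coeff (Fin.castAdd r j) (koszulD K r m a) = coeff (Fin.natAdd r j) a)
        (fun k => ?_) (fun k => ?_) i
      · rw [koszulD_z, map_zero, map_zero]
        exact ⟨rfl, (coeffY_genZ K r m j k).symm⟩
      · rw [koszulD_y]
        exact ⟨coeffY_genZ K r m j k, (coeffZ_genZ K r m j k).trans (coeffY_genY K r m j k).symm⟩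
    | hadd a b ha hb =>
      rw [map_add, map_add, map_add, map_add, ha.1, hb.1, ha.2, hb.2, add_zero]
      exact ⟨rfl, rfl⟩
    | hmul a b ha hb =>
      have e : koszulD K r m (a * b) = koszulD K r m a * b + signHom K _ a * koszulD K r m b :=
        oddDeriv_mul _ a b
      rw [e, map_add, map_add, coeff_mul, coeff_mul, coeff_mul, coeff_mul, coeff_mul, haug, haug,
        ha.1, ha.2, hb.1, hb.2, aug_signHom]
      constructor <;> ring
  exact key a

/-- The part of a homogeneous element beyond its constant and linear parts. -/
theorem exists_linear_part {p : ℕ} {a : koszul K r m} (ha : a ∈ (koszul K r m).grading p) :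
    ∃ b ∈ (koszul K r m).grading p, koszulAug K r m b = 0 ∧ (∀ j, coeffY K r m j b = 0) ∧
      (∀ j, coeffZ K r m j b = 0) ∧
      a = koszulAug K r m a • 1 + ∑ j, coeffY K r m j a • genY K r m j +
        ∑ j, coeffZ K r m j a • genZ K r m j + b := by
  refine ⟨a - (koszulAug K r m a • 1 + ∑ j, coeffY K r m j a • genY K r m j +
        ∑ j, coeffZ K r m j a • genZ K r m j), ?_, ?_, fun j => ?_, fun j => ?_,
        (add_sub_cancel _ _).symm⟩
  · refine Submodule.sub_mem _ ha (Submodule.add_mem _ (Submodule.add_mem _ ?_ ?_) ?_)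
    · rcases eq_or_ne p 0 with rfl | hp
      · exact Submodule.smul_mem _ _ SetLike.GradedOne.one_mem
      · rw [koszulAug_of_mem K r m hp ha, zero_smul]; exact Submodule.zero_mem _
    · refine Submodule.sum_mem _ fun j _ => ?_
      rcases eq_or_ne p m with rfl | hp
      · exact Submodule.smul_mem _ _ (genY_mem K r p j)
      · rw [coeffY_of_mem K r m hp ha, zero_smul]; exact Submodule.zero_mem _
    · refine Submodule.sum_mem _ fun j _ => ?_
      rcases eq_or_ne p (m + 1) with rfl | hp
      · exact Submodule.smul_mem _ _ (genZ_mem K r m j)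
      · rw [coeffZ_of_mem K r m hp ha, zero_smul]; exact Submodule.zero_mem _
  · simp [koszulAug_genY, koszulAug_genZ]
  · simp [coeffY_genY, coeffY_genZ, coeffY_one, Pi.single_apply]
  · simp [coeffZ_genY, coeffZ_genZ, coeffZ_one, Pi.single_apply]

end Koszul

/-! ### Graded subspaces, graded complements and componentwise linear maps. -/

section Graded

variable {K : Type u} [Field K] (V : CDGA.{u, v} K)

/-- The projection to the component of degree `i`. -/
noncomputable def comp (i : ℕ) : V →ₗ[K] V := GradedAlgebra.proj V.grading i

variable {V}

theorem comp_mem (i : ℕ) (a : V) : V.comp i a ∈ V.grading i := by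
  rw [comp, GradedAlgebra.proj_apply]
  exact SetLike.coe_mem _

theorem comp_of_mem {i : ℕ} {a : V} (ha : a ∈ V.grading i) : V.comp i a = a := by
  rw [comp, GradedAlgebra.proj_apply, DirectSum.decompose_of_mem_same _ ha]

theorem comp_of_mem_ne {i j : ℕ} {a : V} (ha : a ∈ V.grading i) (h : i ≠ j) : V.comp j a = 0 := by
  rw [comp, GradedAlgebra.proj_apply, DirectSum.decompose_of_mem_ne _ ha h]

theorem isHomogeneous_iff {P : Submodule K V} :
    P.IsHomogeneous V.grading ↔ ∀ i, ∀ a ∈ P, V.comp i a ∈ P := Iff.rfl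

theorem comp_mem_of_mem {P : Submodule K V} (hP : P.IsHomogeneous V.grading) (i : ℕ) {a : V}
    (ha : a ∈ P) : V.comp i a ∈ P := hP i ha

theorem mem_of_comp {P : Submodule K V} {a : V} (h : ∀ i, V.comp i a ∈ P) : a ∈ P := by
  classical
  rw [← DirectSum.sum_support_decompose V.grading a]
  exact Submodule.sum_mem _ fun i _ => h i

theorem linearMap_ext_hom {M : Type*} [AddCommGroup M] [Module K M] {f g : V →ₗ[K] M}
    (h : ∀ i, ∀ a ∈ V.grading i, f a = g a) : f = g := by
  ext a
  induction a using V.hom_induction with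
  | h0 => simp
  | hadd a b ha hb => rw [map_add, map_add, ha, hb]
  | hom i a ha => exact h i a ha

theorem comp_d (i : ℕ) (a : V) : V.comp (i + 1) (V.d a) = V.d (V.comp i a) := by
  induction a using V.hom_induction with
  | h0 => simp
  | hadd a b ha hb => simp only [map_add, ha, hb]
  | hom j a ha =>
    rcases eq_or_ne j i with rfl | h
    · rw [comp_of_mem ha, comp_of_mem (V.d_mem ha)]
    · rw [comp_of_mem_ne ha h, comp_of_mem_ne (V.d_mem ha) (by omega), map_zero]

theorem comp_zero_d (a : V) : V.comp 0 (V.d a) = 0 := by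
  induction a using V.hom_induction with
  | h0 => simp
  | hadd a b ha hb => simp only [map_add, ha, hb, add_zero]
  | hom j a ha => exact comp_of_mem_ne (V.d_mem ha) (by omega)

theorem homogeneous_range_d : (LinearMap.range V.d).IsHomogeneous V.grading := by
  rw [isHomogeneous_iff]
  rintro (_ | i) _ ⟨a, rfl⟩
  · rw [comp_zero_d]; exact Submodule.zero_mem _
  · rw [comp_d]; exact ⟨_, rfl⟩

theorem homogeneous_ker_d : (LinearMap.ker V.d).IsHomogeneous V.grading := by
  rw [isHomogeneous_iff]
  intro i a ha
  rw [LinearMap.mem_ker] at ha ⊢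
  rw [← comp_d, ha, map_zero]

theorem homogeneous_bot : (⊥ : Submodule K V).IsHomogeneous V.grading := by
  rw [isHomogeneous_iff]
  intro i a ha
  rw [Submodule.mem_bot] at ha
  simp [ha]

theorem homogeneous_sup {P Q : Submodule K V} (hP : P.IsHomogeneous V.grading)
    (hQ : Q.IsHomogeneous V.grading) : (P ⊔ Q).IsHomogeneous V.grading := by
  rw [isHomogeneous_iff]
  intro i a ha
  obtain ⟨p, hp, q, hq, rfl⟩ := Submodule.mem_sup.1 ha
  rw [map_add]
  exact Submodule.add_mem_sup (hP i hp) (hQ i hq)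

theorem homogeneous_inf {P Q : Submodule K V} (hP : P.IsHomogeneous V.grading)
    (hQ : Q.IsHomogeneous V.grading) : (P ⊓ Q).IsHomogeneous V.grading := by
  rw [isHomogeneous_iff]
  intro i a ha
  exact ⟨hP i ha.1, hQ i ha.2⟩

theorem homogeneous_span {S : Set V} (hS : ∀ a ∈ S, ∃ i, a ∈ V.grading i) :
    (Submodule.span K S).IsHomogeneous V.grading := by
  rw [isHomogeneous_iff]
  intro i a ha
  have h : Submodule.span K S ≤ (Submodule.span K S).comap (V.comp i) := by
    rw [Submodule.span_le]
    intro a ha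
    obtain ⟨j, hj⟩ := hS a ha
    rcases eq_or_ne j i with rfl | hne
    · rw [SetLike.mem_coe, Submodule.mem_comap]
      rw [comp_of_mem hj]
      exact Submodule.subset_span ha
    · rw [SetLike.mem_coe, Submodule.mem_comap]
      rw [comp_of_mem_ne hj hne]
      exact Submodule.zero_mem _
  exact h ha

theorem Hom.comp_apply {W : CDGA.{u, w} K} (f : Hom V W) (i : ℕ) (a : V) :
    W.comp i (f a) = f (V.comp i a) := by
  induction a using V.hom_induction with
  | h0 => simp
  | hadd a b ha hb => simp only [map_add, ha, hb]
  | hom j a ha =>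
    rcases eq_or_ne j i with rfl | h
    · rw [comp_of_mem ha, comp_of_mem (f.map_mem ha)]
    · rw [comp_of_mem_ne ha h, comp_of_mem_ne (f.map_mem ha) h, map_zero]

theorem homogeneous_map {W : CDGA.{u, w} K} (f : Hom V W) {P : Submodule K V}
    (hP : P.IsHomogeneous V.grading) :
    (P.map f.toAlgHom.toLinearMap).IsHomogeneous W.grading := by
  rw [isHomogeneous_iff]
  rintro i _ ⟨a, ha, rfl⟩
  exact ⟨V.comp i a, hP i ha, (f.comp_apply i a).symm⟩

theorem homogeneous_degPart {E : Submodule K V} (s : Set ℕ) :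
    (V.degPart E s).IsHomogeneous V.grading := by
  rw [isHomogeneous_iff]
  intro i a ha
  have h : V.degPart E s ≤ (V.degPart E s).comap (V.comp i) := by
    refine iSup₂_le fun j hj a ha => ?_
    rcases eq_or_ne j i with rfl | hne
    · rw [Submodule.mem_comap]
      rw [comp_of_mem ha.2]
      exact Submodule.mem_iSup_of_mem j (Submodule.mem_iSup_of_mem hj ha)
    · rw [Submodule.mem_comap]
      rw [comp_of_mem_ne ha.2 hne]
      exact Submodule.zero_mem _
  exact h ha

theorem degPart_le (E : Submodule K V) (s : Set ℕ) : V.degPart E s ≤ E :=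
  iSup₂_le fun _ _ => inf_le_left

theorem mem_degPart {E : Submodule K V} {s : Set ℕ} {i : ℕ} (hi : i ∈ s) {a : V} (ha : a ∈ E)
    (hai : a ∈ V.grading i) : a ∈ V.degPart E s :=
  Submodule.mem_iSup_of_mem i (Submodule.mem_iSup_of_mem hi ⟨ha, hai⟩)

/-- Two linear maps on a sum of components agree if they agree on homogeneous elements. -/
theorem degPart_ext {E : Submodule K V} {s : Set ℕ} {M : Type*} [AddCommGroup M] [Module K M]
    {f g : V.degPart E s →ₗ[K] M}
    (h : ∀ i ∈ s, ∀ a : V.degPart E s, (a : V) ∈ E → (a : V) ∈ V.grading i → f a = g a) :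
    f = g := by
  have key : V.degPart E s ≤ (LinearMap.eqLocus f g).map (V.degPart E s).subtype :=
    iSup₂_le fun i hi a ha => ⟨⟨a, mem_degPart hi ha.1 ha.2⟩, h i hi _ ha.1 ha.2, rfl⟩
  ext ⟨a, ha⟩
  obtain ⟨b, hb, hba⟩ := key ha
  have : b = ⟨a, ha⟩ := Subtype.ext hba
  rw [← this]
  exact hb

/-- A graded subspace `D ≤ Q` disjoint from the graded subspace `P ≤ Q` extends to a graded
complement of `P` in `Q`. -/
theorem exists_homogeneous_compl {P Q D : Submodule K V} (hP : P.IsHomogeneous V.grading)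
    (hQ : Q.IsHomogeneous V.grading) (hD : D.IsHomogeneous V.grading) (hPQ : P ≤ Q) (hDQ : D ≤ Q)
    (hDP : Disjoint D P) :
    ∃ C : Submodule K V, C.IsHomogeneous V.grading ∧ D ≤ C ∧ Disjoint C P ∧ C ⊔ P = Q := by
  -- The complement is chosen in each degree; the final space consists of the elements all of whose
  -- components lie in the chosen pieces.
  have key (i : ℕ) : ∃ C : Submodule K V, D ⊓ V.grading i ≤ C ∧ Disjoint C P ∧
      C ⊔ P ⊓ V.grading i = Q ⊓ V.grading i := by
    obtain ⟨X, hX, hX'⟩ := exists_isCompl (D ⊓ V.grading i ⊔ P ⊓ V.grading i)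
    have hle : D ⊓ V.grading i ⊔ P ⊓ V.grading i ≤ Q ⊓ V.grading i :=
      sup_le (inf_le_inf_right _ hDQ) (inf_le_inf_right _ hPQ)
    refine ⟨D ⊓ V.grading i ⊔ X ⊓ (Q ⊓ V.grading i), le_sup_left, ?_, ?_⟩
    · rw [Submodule.disjoint_def]
      intro a ha hap
      obtain ⟨b, hb, x, hx, rfl⟩ := Submodule.mem_sup.1 ha
      have hxi : b + x ∈ V.grading i := Submodule.add_mem _ hb.2 hx.2.2
      have hx0 : x = 0 := by
        refine (Submodule.disjoint_def.1 hX) x ?_ hx.1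
        have : x = -b + (b + x) := by abel
        rw [this]
        exact Submodule.add_mem_sup (Submodule.neg_mem _ hb) ⟨hap, hxi⟩
      subst hx0
      rw [add_zero] at hap ⊢
      exact Submodule.disjoint_def.1 hDP b hb.1 hap
    · rw [sup_right_comm, ← sup_inf_assoc_of_le X hle, hX'.eq_top, top_inf_eq]
  choose F hF1 hF2 hF3 using key
  have hFi (i : ℕ) : F i ≤ Q ⊓ V.grading i := by rw [← hF3]; exact le_sup_left
  refine ⟨⨅ i, (F i).comap (V.comp i), ?_, ?_, ?_, ?_⟩
  · rw [isHomogeneous_iff]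
    intro i a ha
    simp only [Submodule.mem_iInf, Submodule.mem_comap] at ha ⊢
    intro j
    rcases eq_or_ne i j with rfl | h
    · rw [comp_of_mem (comp_mem i a)]; exact ha i
    · rw [comp_of_mem_ne (comp_mem i a) h]; exact Submodule.zero_mem _
  · intro a ha
    simp only [Submodule.mem_iInf, Submodule.mem_comap]
    exact fun i => hF1 i ⟨hD i ha, comp_mem i a⟩
  · rw [Submodule.disjoint_def]
    intro a ha hap
    simp only [Submodule.mem_iInf, Submodule.mem_comap] at ha
    refine (Submodule.mem_bot K).1 (mem_of_comp fun i => ?_)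
    exact (Submodule.mem_bot K).2 (Submodule.disjoint_def.1 (hF2 i) _ (ha i) (hP i hap))
  · apply le_antisymm
    · refine sup_le (fun a ha => mem_of_comp fun i => ?_) hPQ
      simp only [Submodule.mem_iInf, Submodule.mem_comap] at ha
      exact (hFi i (ha i)).1
    · intro a ha
      refine mem_of_comp fun i => ?_
      have h : V.comp i a ∈ F i ⊔ P ⊓ V.grading i := by
        rw [hF3]; exact ⟨hQ i ha, comp_mem i a⟩
      obtain ⟨x, hx, p, hp, hxp⟩ := Submodule.mem_sup.1 h
      rw [← hxp]
      refine Submodule.add_mem_sup ?_ hp.1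
      simp only [Submodule.mem_iInf, Submodule.mem_comap]
      intro j
      rcases eq_or_ne i j with rfl | h
      · rw [comp_of_mem (hFi i hx).2]; exact hx
      · rw [comp_of_mem_ne (hFi i hx).2 h]; exact Submodule.zero_mem _

/-- Linear maps on the components of a graded subspace assemble to a linear map. -/
theorem exists_linearMap_of_components {E P : Submodule K V}
    (f : ∀ i, ↥(E ⊓ V.grading i) →ₗ[K] P) :
    ∃ F : E →ₗ[K] P, ∀ i (e : E) (he : (e : V) ∈ V.grading i), F e = f i ⟨e, e.2, he⟩ := by
  -- Once each `f i` is extended to `V`, the pieces can be summed over the decomposition of `V`.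
  have hdec (i : ℕ) : ∃ g : V →ₗ[K] P, ∀ e (he : e ∈ E ⊓ V.grading i), g e = f i ⟨e, he⟩ := by
    obtain ⟨g, hg⟩ := LinearMap.exists_extend (f i)
    exact ⟨g, fun e he => LinearMap.congr_fun hg ⟨e, he⟩⟩
  choose g hg using hdec
  refine ⟨(DirectSum.toModule K ℕ P (fun i => g i ∘ₗ (V.grading i).subtype) ∘ₗ
    (DirectSum.decomposeLinearEquiv V.grading).toLinearMap) ∘ₗ E.subtype, fun i e he => ?_⟩
  obtain ⟨e, heE⟩ := e
  rw [← hg i e ⟨heE, he⟩]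
  change e ∈ V.grading i at he
  lift e to V.grading i using he
  simp

end Graded

/-! ### The pairing in complementary degrees, the radical and the twist conditions. -/

namespace Orientation

variable {K : Type u} [Field K] {V : CDGA.{u, v} K} {n : ℕ} (o : V.Orientation n)

theorem pairing_apply (a b : V) : o.pairing a b = o.toFun (a * b) := rfl

theorem pairing_of_mem_ne {i j : ℕ} (h : i + j ≠ n) {a b : V} (ha : a ∈ V.grading i)
    (hb : b ∈ V.grading j) : o.pairing a b = 0 :=
  o.degree h (SetLike.GradedMul.mul_mem ha hb)

theorem pairing_comm {i j : ℕ} {a b : V} (ha : a ∈ V.grading i) (hb : b ∈ V.grading j) :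
    o.pairing a b = (-1 : K) ^ (i * j) * o.pairing b a := by
  rw [pairing_apply, V.comm ha hb, map_smul, smul_eq_mul, pairing_apply]

theorem pairing_comp_left {i j : ℕ} (h : i + j = n) (a : V) {b : V} (hb : b ∈ V.grading j) :
    o.pairing (V.comp i a) b = o.pairing a b := by
  induction a using V.hom_induction with
  | h0 => simp
  | hadd x y hx hy => simp only [map_add, LinearMap.add_apply, hx, hy]
  | hom k a ha =>
    rcases eq_or_ne k i with rfl | hk
    · rw [comp_of_mem ha]
    · rw [comp_of_mem_ne ha hk, map_zero, LinearMap.zero_apply,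
        o.pairing_of_mem_ne (by omega) ha hb]

theorem pairing_comp_right {i j : ℕ} (h : i + j = n) {a : V} (ha : a ∈ V.grading i) (b : V) :
    o.pairing a (V.comp j b) = o.pairing a b := by
  induction b using V.hom_induction with
  | h0 => simp
  | hadd x y hx hy => simp only [map_add, hx, hy]
  | hom k b hb =>
    rcases eq_or_ne k j with rfl | hk
    · rw [comp_of_mem hb]
    · rw [comp_of_mem_ne hb hk, map_zero, o.pairing_of_mem_ne (by omega) ha hb]

theorem pairing_eq_zero_of_lt_left {i : ℕ} (h : n < i) {a : V} (ha : a ∈ V.grading i) (b : V) :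
    o.pairing a b = 0 := by
  induction b using V.hom_induction with
  | h0 => simp
  | hadd x y hx hy => rw [map_add, hx, hy, add_zero]
  | hom k b hb => exact o.pairing_of_mem_ne (by omega) ha hb

theorem pairing_eq_zero_of_lt_right {i : ℕ} (h : n < i) (a : V) {b : V} (hb : b ∈ V.grading i) :
    o.pairing a b = 0 := by
  induction a using V.hom_induction with
  | h0 => simp
  | hadd x y hx hy => rw [map_add, LinearMap.add_apply, hx, hy, add_zero]
  | hom k a ha => exact o.pairing_of_mem_ne (by omega) ha hb

/-- Orthogonality to a graded subspace may be tested in complementary degree. -/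
theorem pairing_eq_of_comp {i : ℕ} {C : Submodule K V} {b b' : V} (hb : b ∈ V.grading i)
    (hb' : b' ∈ V.grading i) (hC : C.IsHomogeneous V.grading)
    (h : ∀ j, j + i = n → ∀ c ∈ C, c ∈ V.grading j → o.pairing c b = o.pairing c b') (c : V)
    (hc : c ∈ C) : o.pairing c b = o.pairing c b' := by
  rcases le_or_gt i n with hi | hi
  · rw [← o.pairing_comp_left (i := n - i) (by omega) c hb,
      ← o.pairing_comp_left (i := n - i) (by omega) c hb']
    exact h _ (by omega) _ (hC _ hc) (comp_mem _ _)
  · rw [o.pairing_eq_zero_of_lt_right hi c hb, o.pairing_eq_zero_of_lt_right hi c hb']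

theorem radical_le (C : Submodule K V) : o.radical C ≤ C := fun _ h => h.1

theorem mem_radical_of_comp {i : ℕ} {C : Submodule K V} (hC : C.IsHomogeneous V.grading) {a : V}
    (ha : a ∈ V.grading i) (haC : a ∈ C)
    (h : ∀ j, i + j = n → ∀ c ∈ C, c ∈ V.grading j → o.pairing a c = 0) : a ∈ o.radical C := by
  refine ⟨haC, fun c hc => ?_⟩
  rcases le_or_gt i n with hi | hi
  · rw [← o.pairing_comp_right (j := n - i) (by omega) ha c]
    exact h _ (by omega) _ (hC _ hc) (comp_mem _ _)
  · exact o.pairing_eq_zero_of_lt_left hi ha c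

theorem homogeneous_radical {C : Submodule K V} (hC : C.IsHomogeneous V.grading) :
    (o.radical C).IsHomogeneous V.grading := by
  rw [isHomogeneous_iff]
  intro i a ha
  refine o.mem_radical_of_comp hC (comp_mem i a) (hC i ha.1) fun j hj c hc hcj => ?_
  rw [o.pairing_comp_left hj a hcj, ha.2 c hc]

/-- The radical is defined by orthogonality on one side; graded commutativity makes it two-sided,
after passing to components because the sign depends on the degrees. -/
theorem pairing_radical_right {C : Submodule K V} (hC : C.IsHomogeneous V.grading) {a c : V}
    (ha : a ∈ o.radical C) (hc : c ∈ C) : o.pairing c a = 0 := by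
  have h : ∀ i, V.comp i c ∈ LinearMap.ker (o.pairing.flip a) := by
    intro i
    rw [LinearMap.mem_ker, LinearMap.flip_apply]
    rcases le_or_gt i n with hi | hi
    · rw [← o.pairing_comp_right (j := n - i) (by omega) (comp_mem i c) a,
        o.pairing_comm (comp_mem i c) (comp_mem _ a),
        (comp_mem_of_mem (o.homogeneous_radical hC) (n - i) ha).2 _ (comp_mem_of_mem hC i hc), mul_zero]
    · exact o.pairing_eq_zero_of_lt_left hi (comp_mem i c) a
  exact mem_of_comp h

/-- The two twist conditions together say that `e - ρ e` is orthogonal to `C`. -/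
theorem SolvesTwist.pairing_eq_of_mem {o : V.Orientation n} {C E : Submodule K V} {s : Set ℕ}
    {D : Submodule K V} {ρ : D →ₗ[K] LinearMap.range V.d} (h : o.SolvesTwist C E s ρ)
    (hC : C.IsHomogeneous V.grading) (hE : o.IsRadicalComplement C E) (hDC : D ≤ C)
    {i : ℕ} (hi : i ∈ s) (e : D) (he : (e : V) ∈ V.grading i) {c : V} (hc : c ∈ C) :
    o.pairing c (ρ e) = o.pairing c e := by
  refine o.pairing_eq_of_comp (h.homogeneous i e he) he hC (fun j hj c hc hcj => ?_) c hc
  rw [← hE.sup] at hc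
  obtain ⟨a, ha, b, hb, rfl⟩ := Submodule.mem_sup.1 hc
  have key : V.comp j a + V.comp j b = a + b := by rw [← map_add, comp_of_mem hcj]
  rw [← key, map_add, LinearMap.add_apply, LinearMap.add_apply,
    h.pairing_eq i hi j hj _ ⟨comp_mem_of_mem hE.homogeneous j ha, comp_mem j a⟩ e he,
    h.pairing_radical i hi j hj _ ⟨comp_mem_of_mem (o.homogeneous_radical hC) j hb, comp_mem j b⟩ e he,
    (comp_mem_of_mem (o.homogeneous_radical hC) j hb).2 e (hDC e.2)]

/-- Elements of the radical are orthogonal to `e ∈ C`, so the single identity `⟨c, ρ e⟩ = ⟨c, e⟩` on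
`C` contains both conditions. -/
theorem SolvesTwist.of_pairing_eq {C E : Submodule K V} {s : Set ℕ}
    {D : Submodule K V} {ρ : D →ₗ[K] LinearMap.range V.d} (hE : o.IsRadicalComplement C E)
    (hDC : D ≤ C) (hom : ∀ (i : ℕ) (e : D), (e : V) ∈ V.grading i → (ρ e : V) ∈ V.grading i)
    (h : ∀ i ∈ s, ∀ e : D, (e : V) ∈ V.grading i → ∀ j, j + i = n → ∀ c ∈ C, c ∈ V.grading j →
      o.pairing c (ρ e) = o.pairing c e) : o.SolvesTwist C E s ρ where
  homogeneous := hom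
  pairing_eq i hi j hj e₁ he₁ e₂ he₂ :=
    h i hi e₂ he₂ j hj e₁ (by rw [← hE.sup]; exact Submodule.mem_sup_left he₁.1) he₁.2
  pairing_radical i hi j hj c hc e₂ he₂ := by
    rw [h i hi e₂ he₂ j hj c hc.1.1 hc.2]
    exact hc.1.2 e₂ (hDC e₂.2)

end Orientation

/-! ### Quasi-isomorphisms, harmonic subspaces and existence of orthogonal decompositions. -/

section QuasiIso

variable {K : Type u} [Field K] {V : CDGA.{u, v} K} {A : CDGA.{u, w} K}

theorem Cohomology.mk_eq_zero {a : V} (ha : a ∈ LinearMap.ker V.d) :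
    (Submodule.Quotient.mk ⟨a, ha⟩ : V.Cohomology) = 0 ↔ a ∈ LinearMap.range V.d :=
  Submodule.Quotient.mk_eq_zero _

theorem Cohomology.mk_eq_mk {a b : V} (ha : a ∈ LinearMap.ker V.d) (hb : b ∈ LinearMap.ker V.d) :
    (Submodule.Quotient.mk ⟨a, ha⟩ : V.Cohomology) = Submodule.Quotient.mk ⟨b, hb⟩ ↔
      a - b ∈ LinearMap.range V.d :=
  Submodule.Quotient.eq _

theorem Hom.isQuasiIso_iff (f : Hom V A) : f.IsQuasiIso ↔
    (∀ a, V.d a = 0 → f a ∈ LinearMap.range A.d → a ∈ LinearMap.range V.d) ∧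
      ∀ x, A.d x = 0 → ∃ a, V.d a = 0 ∧ x - f a ∈ LinearMap.range A.d := by
  refine and_congr ?_ ?_
  · rw [injective_iff_map_eq_zero]
    constructor
    · intro h a ha hfa
      have := h (Submodule.Quotient.mk ⟨a, ha⟩)
        ((Cohomology.mk_eq_zero (f.cocycleMap ⟨a, ha⟩).2).2 hfa)
      exact (Cohomology.mk_eq_zero ha).1 this
    · intro h q hq
      obtain ⟨⟨a, ha⟩, rfl⟩ := Submodule.Quotient.mk_surjective _ q
      exact (Cohomology.mk_eq_zero ha).2
        (h a ha ((Cohomology.mk_eq_zero (f.cocycleMap ⟨a, ha⟩).2).1 hq))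
  · constructor
    · intro h x hx
      obtain ⟨q, hq⟩ := h (Submodule.Quotient.mk ⟨x, hx⟩)
      obtain ⟨⟨a, ha⟩, rfl⟩ := Submodule.Quotient.mk_surjective _ q
      exact ⟨a, ha, (Cohomology.mk_eq_mk hx (f.cocycleMap ⟨a, ha⟩).2).1 hq.symm⟩
    · intro h q
      obtain ⟨⟨x, hx⟩, rfl⟩ := Submodule.Quotient.mk_surjective _ q
      obtain ⟨a, ha, hax⟩ := h x hx
      exact ⟨Submodule.Quotient.mk ⟨a, ha⟩, ((Cohomology.mk_eq_mk hx (f.cocycleMap ⟨a, ha⟩).2).2 hax).symm⟩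

/-- Poincaré duality is transported along orientation-preserving quasi-isomorphisms. -/
theorem Orientation.IsPDGA.of_quasiIso {n : ℕ} {o : V.Orientation n} (h : o.IsPDGA)
    {o' : A.Orientation n} {f : Hom V A} (hf : f.IsQuasiIso)
    (hor : ∀ a, o'.toFun (f a) = o.toFun a) : o'.IsPDGA := by
  let e := LinearEquiv.ofBijective f.cohomologyMap hf
  have key (p q : V.Cohomology) :
      o'.cohomologyPairing (e p) (e q) = o.cohomologyPairing p q := by
    obtain ⟨⟨a, ha⟩, rfl⟩ := Submodule.Quotient.mk_surjective _ p
    obtain ⟨⟨b, hb⟩, rfl⟩ := Submodule.Quotient.mk_surjective _ q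
    change o'.toFun (f a * f b) = o.toFun (a * b)
    rw [← map_mul, hor]
  have := h
  unfold IsPDGA at this ⊢
  refine LinearMap.IsPerfPair.congr (p := o.cohomologyPairing) e.symm e.symm _ ?_
  exact LinearMap.ext fun p => LinearMap.ext fun q => key p q

variable (V) in
/-- `H` is a harmonic subspace: a graded complement of `im d` in `ker d`. -/
structure IsHarmonic (H : Submodule K V) : Prop where
  homogeneous : H.IsHomogeneous V.grading
  disjoint : Disjoint H (LinearMap.range V.d)
  sup : H ⊔ LinearMap.range V.d = LinearMap.ker V.d

theorem range_d_le_ker : LinearMap.range V.d ≤ LinearMap.ker V.d := by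
  rintro _ ⟨a, rfl⟩
  exact V.d_d a

variable (V) in
theorem exists_isHarmonic : ∃ H : Submodule K V, V.IsHarmonic H := by
  obtain ⟨H, h1, -, h2, h3⟩ := exists_homogeneous_compl
    (homogeneous_range_d (V := V)) homogeneous_ker_d (D := ⊥) homogeneous_bot range_d_le_ker bot_le disjoint_bot_left
  exact ⟨H, h1, h2, h3⟩

theorem IsHarmonic.d_eq_zero {H : Submodule K V} (hH : V.IsHarmonic H) {h : V} (hh : h ∈ H) :
    V.d h = 0 := by
  have : h ∈ LinearMap.ker V.d := by rw [← hH.sup]; exact Submodule.mem_sup_left hh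
  exact this

/-- Injectivity on cohomology gives disjointness from the exact elements, surjectivity gives that
the sum is all of the cocycles. -/
theorem IsHarmonic.map {H : Submodule K V} (hH : V.IsHarmonic H) {f : Hom V A}
    (hf : f.IsQuasiIso) : A.IsHarmonic (H.map f.toAlgHom.toLinearMap) := by
  rw [Hom.isQuasiIso_iff] at hf
  refine ⟨homogeneous_map f hH.homogeneous, ?_, ?_⟩
  · rw [Submodule.disjoint_def]
    rintro _ ⟨h, hh, rfl⟩ hr
    have : h = 0 := Submodule.disjoint_def.1 hH.disjoint h hh (hf.1 h (hH.d_eq_zero hh) hr)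
    rw [this, map_zero]
  · apply le_antisymm
    · refine sup_le ?_ range_d_le_ker
      rintro _ ⟨h, hh, rfl⟩
      rw [LinearMap.mem_ker]
      exact (f.map_d h).symm.trans (by rw [hH.d_eq_zero hh, map_zero])
    · intro x hx
      obtain ⟨a, ha, b, hb⟩ := hf.2 x hx
      have ha' : a ∈ H ⊔ LinearMap.range V.d := by rw [hH.sup]; exact ha
      obtain ⟨h, hh, _, ⟨c, rfl⟩, rfl⟩ := Submodule.mem_sup.1 ha'
      refine Submodule.mem_sup.2 ⟨f h, ⟨h, hh, rfl⟩, A.d (b + f c), ⟨_, rfl⟩, ?_⟩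
      rw [map_add, hb, ← f.map_d, map_add]
      abel

theorem Orientation.IsHOrthogonal.isHarmonic {n : ℕ} {o : V.Orientation n} {H C : Submodule K V}
    (h : o.IsHOrthogonal H C) : V.IsHarmonic H :=
  ⟨h.harm_homogeneous, h.harm_disjoint, h.harm_sup⟩

namespace IsHarmonic

variable {n : ℕ} {o : V.Orientation n} {H : Submodule K V}

/-- Every functional is represented on harmonic elements by a harmonic element. -/
theorem exists_pairing_eq (hH : V.IsHarmonic H) (hPD : o.IsPDGA) (F : V →ₗ[K] K) :
    ∃ h₀ ∈ H, ∀ h ∈ H, o.pairing h h₀ = F h := by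
  have hker : H ≤ LinearMap.ker V.d := fun h hh => hH.d_eq_zero hh
  let π : H →ₗ[K] V.Cohomology := Submodule.mkQ _ ∘ₗ Submodule.inclusion hker
  have hπ : LinearMap.ker π = ⊥ := by
    rw [LinearMap.ker_eq_bot']
    intro h hh
    have h2 := (Submodule.Quotient.mk_eq_zero _).1 hh
    exact Subtype.ext (Submodule.disjoint_def.1 hH.disjoint h h.2 h2)
  -- `g` transports the functional from `H` to cohomology, where the perfect pairing represents it.
  obtain ⟨g, hg⟩ := LinearMap.exists_leftInverse_of_injective π hπ
  obtain ⟨q, hq⟩ := hPD.bijective_right.2 (F ∘ₗ H.subtype ∘ₗ g)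
  obtain ⟨⟨a, ha⟩, rfl⟩ := Submodule.Quotient.mk_surjective _ q
  have ha' : a ∈ H ⊔ LinearMap.range V.d := by rw [hH.sup]; exact ha
  obtain ⟨h₀, hh₀, _, ⟨b, rfl⟩, rfl⟩ := Submodule.mem_sup.1 ha'
  refine ⟨h₀, hh₀, fun h hh => ?_⟩
  have h1 := LinearMap.congr_fun hq (π ⟨h, hh⟩)
  have h2 : g (π ⟨h, hh⟩) = ⟨h, hh⟩ := LinearMap.congr_fun hg ⟨h, hh⟩
  have h3 : o.pairing h (h₀ + V.d b) = F (g (π ⟨h, hh⟩)) := h1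
  rw [h2] at h3
  rwa [map_add, o.pairing_d_right (hH.d_eq_zero hh), add_zero] at h3

theorem eq_zero_of_pairing (hH : V.IsHarmonic H) (hPD : o.IsPDGA) {h₀ : V} (h₀H : h₀ ∈ H)
    (h : ∀ h ∈ H, o.pairing h h₀ = 0) : h₀ = 0 := by
  have hk := hH.d_eq_zero h₀H
  have h1 : (Submodule.Quotient.mk ⟨h₀, hk⟩ : V.Cohomology) = 0 := by
    apply hPD.bijective_right.1
    rw [map_zero]
    refine LinearMap.ext fun q => ?_
    obtain ⟨⟨a, ha⟩, rfl⟩ := Submodule.Quotient.mk_surjective _ q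
    have ha' : a ∈ H ⊔ LinearMap.range V.d := by rw [hH.sup]; exact ha
    obtain ⟨c, hc, _, ⟨b, rfl⟩, rfl⟩ := Submodule.mem_sup.1 ha'
    change o.pairing (c + V.d b) h₀ = 0
    rw [map_add, LinearMap.add_apply, h c hc, o.pairing_d_left hk, add_zero]
  exact Submodule.disjoint_def.1 hH.disjoint _ h₀H ((Cohomology.mk_eq_zero hk).1 h1)

/-- A graded subspace which is orthogonal to the harmonic elements and contains no non-zero exact
elements extends to the coexact part of an `H`-orthogonal decomposition. -/
theorem exists_isHOrthogonal (hH : V.IsHarmonic H) (hPD : o.IsPDGA) {D : Submodule K V}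
    (hD : D.IsHomogeneous V.grading) (hDH : ∀ h ∈ H, ∀ c ∈ D, o.pairing h c = 0)
    (hDr : Disjoint D (LinearMap.range V.d)) : ∃ C, o.IsHOrthogonal H C ∧ D ≤ C := by
  -- `W = H^⊥` contains the exact elements, and duality on `H` gives `V = H ⊕ W`. A complement of
  -- `im d` in `W` is therefore a complement of `ker d = H ⊕ im d` in `V`.
  let W : Submodule K V := ⨅ h : H, LinearMap.ker (o.pairing h)
  have mem_W (x : V) : x ∈ W ↔ ∀ h ∈ H, o.pairing h x = 0 := by
    simp [W, Submodule.mem_iInf]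
  have hW : W.IsHomogeneous V.grading := by
    rw [isHomogeneous_iff]
    intro i a ha
    rw [mem_W] at ha ⊢
    intro h hh
    rcases le_or_gt i n with hi | hi
    · rw [← o.pairing_comp_left (i := n - i) (by omega) h (comp_mem i a),
        o.pairing_comp_right (by omega) (comp_mem _ h)]
      exact ha _ (comp_mem_of_mem hH.homogeneous _ hh)
    · exact o.pairing_eq_zero_of_lt_right hi h (comp_mem i a)
  have hr : LinearMap.range V.d ≤ W := by
    rintro _ ⟨b, rfl⟩
    rw [mem_W]
    exact fun h hh => o.pairing_d_right (hH.d_eq_zero hh)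
  obtain ⟨C, hC, hDC, hCr, hsup⟩ := exists_homogeneous_compl homogeneous_range_d hW hD hr
    (fun c hc => (mem_W c).2 fun h hh => hDH h hh c hc) hDr
  have hCW : C ≤ W := by rw [← hsup]; exact le_sup_left
  refine ⟨C, ⟨hH.homogeneous, hC, hH.disjoint, hH.sup, ⟨?_, ?_⟩,
    fun h hh c hc => (mem_W c).1 (hCW hc) h hh⟩, hDC⟩
  · rw [Submodule.disjoint_def]
    intro x hx hxC
    rw [← hH.sup] at hx
    obtain ⟨h₀, hh₀, e, he, rfl⟩ := Submodule.mem_sup.1 hx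
    have h0 : h₀ = 0 := by
      refine hH.eq_zero_of_pairing hPD hh₀ fun h hh => ?_
      have h1 := (mem_W _).1 (hCW hxC) h hh
      rwa [map_add, (mem_W _).1 (hr he) h hh, add_zero] at h1
    subst h0
    rw [zero_add] at hxC ⊢
    exact Submodule.disjoint_def.1 hCr e hxC he
  · rw [codisjoint_iff, eq_top_iff]
    rintro x -
    obtain ⟨h₀, hh₀, hx⟩ := hH.exists_pairing_eq hPD (o.pairing.flip x)
    have h1 : x - h₀ ∈ C ⊔ LinearMap.range V.d := by
      rw [hsup, mem_W]
      intro h hh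
      rw [map_sub, hx h hh, LinearMap.flip_apply, sub_self]
    obtain ⟨c, hc, e, he, h2⟩ := Submodule.mem_sup.1 h1
    refine Submodule.mem_sup.2 ⟨h₀ + e, ?_, c, hc, ?_⟩
    · rw [← hH.sup]; exact Submodule.add_mem_sup hh₀ he
    · rw [add_assoc, add_comm e, h2]; abel

end IsHarmonic

namespace Orientation

variable {n : ℕ} {o : V.Orientation n}

theorem exists_isRadicalComplement {C D : Submodule K V} (hC : C.IsHomogeneous V.grading)
    (hD : D.IsHomogeneous V.grading) (hDC : D ≤ C) (hDr : Disjoint D (o.radical C)) :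
    ∃ E, o.IsRadicalComplement C E ∧ D ≤ E := by
  obtain ⟨E, h1, h2, h3, h4⟩ := exists_homogeneous_compl (o.homogeneous_radical hC) hC hD
    (o.radical_le C) hDC hDr
  exact ⟨E, ⟨h1, h3, h4⟩, h2⟩

theorem IsRadicalComplement.le {C E : Submodule K V} (h : o.IsRadicalComplement C E) : E ≤ C := by
  rw [← h.sup]; exact le_sup_left

variable {H C : Submodule K V}

theorem IsHOrthogonal.exists_decomp (h : o.IsHOrthogonal H C) (x : V) :
    ∃ a ∈ H, ∃ b ∈ C, ∃ c ∈ C, x = a + V.d b + c := by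
  have top (x : V) : ∃ k ∈ LinearMap.ker V.d, ∃ c ∈ C, k + c = x := by
    apply Submodule.mem_sup.1
    rw [h.coexact_isCompl.sup_eq_top]
    exact Submodule.mem_top
  obtain ⟨k, hk, c, hc, rfl⟩ := top x
  rw [← h.harm_sup] at hk
  obtain ⟨a, ha, _, ⟨b, rfl⟩, rfl⟩ := Submodule.mem_sup.1 hk
  obtain ⟨k', hk', b', hb', rfl⟩ := top b
  refine ⟨a, ha, b', hb', c, hc, ?_⟩
  rw [LinearMap.mem_ker] at hk'
  rw [map_add, hk', zero_add]

theorem IsHOrthogonal.eq_zero_of_d (h : o.IsHOrthogonal H C) {c : V} (hc : c ∈ C)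
    (hd : V.d c = 0) : c = 0 :=
  Submodule.disjoint_def.1 h.coexact_isCompl.disjoint c hd hc

/-- The inverse of `d : C → im d`, extended by zero to `H ⊕ C`. -/
theorem IsHOrthogonal.exists_inverse (h : o.IsHOrthogonal H C) :
    ∃ g : V →ₗ[K] V, (∀ c ∈ C, g (V.d c) = c) ∧ (∀ a ∈ H, g a = 0) ∧ ∀ c ∈ C, g c = 0 := by
  -- The map `(b, x) ↦ d b + x` is injective, and the first component of any left inverse is the
  -- required map.
  let Φ : (C × (H ⊔ C : Submodule K V)) →ₗ[K] V :=
    (V.d ∘ₗ C.subtype).coprod (H ⊔ C : Submodule K V).subtype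
  have hΦ : LinearMap.ker Φ = ⊥ := by
    rw [LinearMap.ker_eq_bot']
    rintro ⟨⟨b, hb⟩, ⟨y, hy⟩⟩ h0
    obtain ⟨a, ha, c, hc, rfl⟩ := Submodule.mem_sup.1 hy
    have h0' : V.d b + (a + c) = 0 := h0
    have hda : V.d a = 0 := h.isHarmonic.d_eq_zero ha
    have hc0 : c = 0 := h.eq_zero_of_d hc (by
      have := congrArg V.d h0'
      simpa [V.d_d, hda] using this)
    subst hc0
    have ha0 : a = 0 := by
      refine Submodule.disjoint_def.1 h.harm_disjoint a ha ⟨-b, ?_⟩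
      rw [map_neg, neg_eq_iff_add_eq_zero]
      simpa using h0'
    subst ha0
    have hb0 : b = 0 := h.eq_zero_of_d hb (by simpa using h0')
    subst hb0
    simp
  obtain ⟨Ψ, hΨ⟩ := LinearMap.exists_leftInverse_of_injective Φ hΦ
  have key (z) : Ψ (Φ z) = z := LinearMap.congr_fun hΨ z
  refine ⟨C.subtype ∘ₗ LinearMap.fst K _ _ ∘ₗ Ψ, fun c hc => ?_, fun a ha => ?_, fun c hc => ?_⟩
  · have := key (⟨c, hc⟩, 0)
    have e : Φ (⟨c, hc⟩, 0) = V.d c := by simp [Φ]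
    rw [e] at this
    simp [this]
  · have := key (0, ⟨a, Submodule.mem_sup_left ha⟩)
    have e : Φ (0, ⟨a, Submodule.mem_sup_left ha⟩) = a := by simp [Φ]
    rw [e] at this
    simp [this]
  · have := key (0, ⟨c, Submodule.mem_sup_right hc⟩)
    have e : Φ (0, ⟨c, Submodule.mem_sup_right hc⟩) = c := by simp [Φ]
    rw [e] at this
    simp [this]

/-- The pairing on `E` in the middle degree is perfect. -/
theorem IsRadicalComplement.exists_pairing_eq {E : Submodule K V} {k : ℕ} (hk : k + k = n)
    (hfin : V.IsFiniteType) (hC : C.IsHomogeneous V.grading) (hE : o.IsRadicalComplement C E)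
    (F : ↥(E ⊓ V.grading k) →ₗ[K] K) :
    ∃ a ∈ E ⊓ V.grading k, ∀ e : ↥(E ⊓ V.grading k), o.pairing a e = F e := by
  have := hfin k
  have : Module.Finite K ↥(E ⊓ V.grading k) := Submodule.finiteDimensional_inf_right _ _
  -- An element of `E^k` orthogonal to `E^k` is orthogonal to all of `C`, since the rest of `C` is
  -- radical; so it vanishes. Finite dimension turns injectivity into surjectivity.
  let B : ↥(E ⊓ V.grading k) →ₗ[K] Module.Dual K ↥(E ⊓ V.grading k) :=
    o.pairing.domRestrict₁₂ _ _
  have hB : Function.Injective B := by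
    rw [injective_iff_map_eq_zero]
    rintro ⟨a, ha⟩ h0
    refine Subtype.ext (Submodule.disjoint_def.1 hE.disjoint a ha.1 ?_)
    refine o.mem_radical_of_comp hC ha.2 (hE.le ha.1) fun j hj c hc hcj => ?_
    obtain rfl : j = k := by omega
    rw [← hE.sup] at hc
    obtain ⟨e, he, b, hb, rfl⟩ := Submodule.mem_sup.1 hc
    rw [map_add, o.pairing_radical_right hC hb (hE.le ha.1), add_zero,
      ← o.pairing_comp_right hj ha.2]
    exact LinearMap.congr_fun h0 ⟨V.comp j e, comp_mem_of_mem hE.homogeneous j he, comp_mem j e⟩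
  have hs := (LinearMap.injective_iff_surjective_of_finrank_eq_finrank
    (Subspace.dual_finrank_eq (K := K) (V := ↥(E ⊓ V.grading k))).symm).1 hB
  obtain ⟨a, ha⟩ := hs F
  exact ⟨a, a.2, fun e => LinearMap.congr_fun ha e⟩

end Orientation

end QuasiIso

/-! ### The functionals that prescribe the pairing with the new generators. -/

section TwistFunctionals

variable {K : Type u} [Field K] {V : CDGA.{u, v} K}

theorem comp_of_mem_degPart {E : Submodule K V} {s : Set ℕ} {i : ℕ} (hi : i ∉ s) {a : V}
    (ha : a ∈ V.degPart E s) : V.comp i a = 0 := by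
  have h : V.degPart E s ≤ LinearMap.ker (V.comp i) := by
    refine iSup₂_le fun j hj a ha => ?_
    exact comp_of_mem_ne ha.2 (by rintro rfl; exact hi hj)
  exact h ha

/-- The functionals on `V`, concentrated in degree `n + 1 - l`, which vanish on `H`, on `C` and on
the image of `ρ`. -/
def twistFunctionals (H C : Submodule K V) (n l : ℕ) {D : Submodule K V}
    (ρ : D →ₗ[K] LinearMap.range V.d) : Submodule K (V →ₗ[K] K) where
  carrier := {τ | (∀ i, i + l ≠ n + 1 → ∀ a ∈ V.grading i, τ a = 0) ∧ (∀ a ∈ H, τ a = 0) ∧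
    (∀ c ∈ C, τ c = 0) ∧ ∀ e : D, τ (ρ e) = 0}
  add_mem' := fun {σ τ} hσ hτ =>
    ⟨fun i hi a ha => by rw [LinearMap.add_apply, hσ.1 i hi a ha, hτ.1 i hi a ha, add_zero],
      fun a ha => by rw [LinearMap.add_apply, hσ.2.1 a ha, hτ.2.1 a ha, add_zero],
      fun a ha => by rw [LinearMap.add_apply, hσ.2.2.1 a ha, hτ.2.2.1 a ha, add_zero],
      fun e => by rw [LinearMap.add_apply, hσ.2.2.2 e, hτ.2.2.2 e, add_zero]⟩
  zero_mem' := ⟨fun _ _ _ _ => rfl, fun _ _ => rfl, fun _ _ => rfl, fun _ => rfl⟩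
  smul_mem' := fun r τ hτ =>
    ⟨fun i hi a ha => by rw [LinearMap.smul_apply, hτ.1 i hi a ha, smul_zero],
      fun a ha => by rw [LinearMap.smul_apply, hτ.2.1 a ha, smul_zero],
      fun a ha => by rw [LinearMap.smul_apply, hτ.2.2.1 a ha, smul_zero],
      fun e => by rw [LinearMap.smul_apply, hτ.2.2.2 e, smul_zero]⟩

/-- Restriction to degree `n + 1 - l` is injective. If `l > n + 1` the subtraction truncates, but
then the space of functionals is zero. -/
theorem finite_twistFunctionals (hfin : V.IsFiniteType) (H C : Submodule K V) (n l : ℕ)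
    {D : Submodule K V} (ρ : D →ₗ[K] LinearMap.range V.d) :
    Module.Finite K (twistFunctionals H C n l ρ) := by
  have := hfin (n + 1 - l)
  let R : twistFunctionals H C n l ρ →ₗ[K] Module.Dual K (V.grading (n + 1 - l)) :=
    (LinearMap.lcomp K K (V.grading (n + 1 - l)).subtype) ∘ₗ (twistFunctionals H C n l ρ).subtype
  refine Module.Finite.of_injective R ?_
  rw [injective_iff_map_eq_zero]
  rintro ⟨τ, hτ⟩ h0
  refine Subtype.ext (linearMap_ext_hom fun i a ha => ?_)
  rcases eq_or_ne i (n + 1 - l) with rfl | hi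
  · exact LinearMap.congr_fun h0 ⟨a, ha⟩
  · exact hτ.1 i (by omega) a ha

namespace Orientation

variable {n : ℕ} {o : V.Orientation n} {H C E : Submodule K V} {l : ℕ}

/-- Ensures that generators of degree `l - 1`, if any are needed, have positive degree. For `l ≤ 1`,
exact elements of degree `n + 1 - l` could only come from `V^0`, where `d` vanishes by
connectedness, or from `V^1 = 0`; a functional killing `H` and `C` is then zero. -/
theorem IsHOrthogonal.two_le_of_functional_ne_zero (h : o.IsHOrthogonal H C)
    (hconn : V.IsConnected) (hl : (n + 1) / 2 < l ∨ (V.grading 1 = ⊥ ∧ l = (n + 1) / 2))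
    {D : Submodule K V} {ρ : D →ₗ[K] LinearMap.range V.d} {τ : V →ₗ[K] K}
    (hτ : τ ∈ twistFunctionals H C n l ρ) (h0 : τ ≠ 0) : 2 ≤ l := by
  by_contra hlt
  apply h0
  have hd : τ ∘ₗ V.d = 0 := by
    refine linearMap_ext_hom fun i b hb => ?_
    rw [LinearMap.comp_apply, LinearMap.zero_apply]
    by_cases hi : i + 1 + l = n + 1
    · have hb0 : V.d b = 0 := by
        rcases Nat.lt_or_ge i 1 with hi0 | hi1
        · obtain rfl : i = 0 := by omega
          rw [IsConnected] at hconn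
          rw [hconn, Submodule.mem_span_singleton] at hb
          obtain ⟨c, rfl⟩ := hb
          rw [map_smul, V.d_one, smul_zero]
        · rcases hl with hl | ⟨hV, hl⟩
          · omega
          · obtain rfl : i = 1 := by omega
            rw [hV, Submodule.mem_bot] at hb
            rw [hb, map_zero]
      rw [hb0, map_zero]
    · exact hτ.1 _ hi _ (V.d_mem hb)
  ext x
  obtain ⟨a, ha, b, -, c, hc, rfl⟩ := h.exists_decomp x
  have hdb : τ (V.d b) = 0 := LinearMap.congr_fun hd b
  rw [map_add, map_add, hτ.2.1 a ha, hdb, hτ.2.2.1 c hc]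
  simp

/-- Every functional on `C` in degree `n - l` has the form `c ↦ τ (d c) + ⟨d c, u⟩`. -/
theorem SolvesTwist.exists_functional (hfin : V.IsFiniteType) (h : o.IsHOrthogonal H C)
    (hE : o.IsRadicalComplement C E)
    {ρ : V.degPart E (Set.Ico ((n + 1) / 2) l) →ₗ[K] LinearMap.range V.d}
    (hρ : o.SolvesTwist C E (Set.Ico ((n + 1) / 2) l) ρ) (F : V →ₗ[K] K) :
    ∃ τ ∈ twistFunctionals H C n l ρ, ∃ u : V, (n + 2 ≠ 2 * l → u = 0) ∧
      ∀ i, i + l = n → ∀ c ∈ C, c ∈ V.grading i → τ (V.d c) + o.pairing (V.d c) u = F c := by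
  rcases lt_or_ge n l with hln | hln
  · exact ⟨0, Submodule.zero_mem _, 0, fun _ => rfl, fun i hi => by omega⟩
  obtain ⟨g, hg, hgH, hgC⟩ := h.exists_inverse
  have hdg (x : V) (hx : x ∈ LinearMap.range V.d) : V.d (g x) = x := by
    obtain ⟨b, rfl⟩ := hx
    obtain ⟨a, ha, b', -, c, hc, rfl⟩ := h.exists_decomp b
    have : V.d (a + V.d b' + c) = V.d c := by
      rw [map_add, map_add, h.isHarmonic.d_eq_zero ha, V.d_d, zero_add, zero_add]
    rw [this, hg c hc]
  -- `u` matches the prescribed values on the image of `ρ` in degree `n + 1 - l`. This degree lies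
  -- in the interval only if `n + 2 = 2 * l`, when it is the middle degree `l - 1`; otherwise there
  -- is nothing to match and `u = 0`.
  obtain ⟨u, hu0, hu⟩ : ∃ u : V, (n + 2 ≠ 2 * l → u = 0) ∧
      ∀ e : V.degPart E (Set.Ico ((n + 1) / 2) l), ∀ i, i + l = n + 1 → (e : V) ∈ V.grading i →
        o.pairing (ρ e) u = F (g (ρ e)) := by
    by_cases hn : n + 2 = 2 * l
    · have hk : (l - 1) + (l - 1) = n := by omega
      have hkI : l - 1 ∈ Set.Ico ((n + 1) / 2) l := ⟨by omega, by omega⟩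
      let j : ↥(E ⊓ V.grading (l - 1)) →ₗ[K] V.degPart E (Set.Ico ((n + 1) / 2) l) :=
        Submodule.inclusion fun a ha => mem_degPart hkI ha.1 ha.2
      obtain ⟨a, ha, haF⟩ := hE.exists_pairing_eq hk hfin h.coexact_homogeneous
        -- The sign compensates for exchanging `u` and `ρ e`, both of degree `l - 1`.
        ((-1 : K) ^ ((l - 1) * (l - 1)) •
          (F ∘ₗ g ∘ₗ (LinearMap.range V.d).subtype ∘ₗ ρ ∘ₗ j))
      refine ⟨a, fun hne => absurd hn hne, fun e i hi he => ?_⟩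
      obtain rfl : i = l - 1 := by omega
      rw [o.pairing_comm (hρ.homogeneous _ e he) ha.2,
        hρ.pairing_eq_of_mem h.coexact_homogeneous hE ((degPart_le _ _).trans hE.le) hkI e he
          (hE.le ha.1)]
      have := haF ⟨e, degPart_le _ _ e.2, he⟩
      rw [this]
      simp only [LinearMap.smul_apply, LinearMap.comp_apply, smul_eq_mul, ← mul_assoc, ← mul_pow]
      simp only [neg_mul_neg, one_mul, one_pow, j]
      rfl
    · refine ⟨0, fun _ => rfl, fun e i hi he => ?_⟩
      have hnot : i ∉ Set.Ico ((n + 1) / 2) l := fun hI => by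
        have := hI.1
        have := hI.2
        omega
      have : e = 0 := Subtype.ext (by rw [← comp_of_mem he, comp_of_mem_degPart hnot e.2]; rfl)
      simp [this]
  -- Subtracting the contribution of `u` is exactly what makes `τ` vanish on the image of `ρ`; `g`
  -- makes it vanish on `H` and on `C`.
  let τ : V →ₗ[K] K := (F - (o.pairing.flip u) ∘ₗ V.d) ∘ₗ g ∘ₗ V.comp (n + 1 - l)
  have hτ (x : V) : τ x = F (g (V.comp (n + 1 - l) x)) -
      o.pairing (V.d (g (V.comp (n + 1 - l) x))) u := rfl
  have hτ0 {x : V} (hx : g (V.comp (n + 1 - l) x) = 0) : τ x = 0 := by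
    rw [hτ, hx]; simp
  refine ⟨τ, ⟨fun i hi a ha => hτ0 ?_, fun a ha => hτ0 ?_, fun c hc => hτ0 ?_, fun e => ?_⟩,
    u, hu0, fun i hi c hc hci => ?_⟩
  · rw [comp_of_mem_ne ha (by omega), map_zero]
  · exact hgH _ (comp_mem_of_mem h.harm_homogeneous _ ha)
  · exact hgC _ (comp_mem_of_mem h.coexact_homogeneous _ hc)
  · have key : τ ∘ₗ (LinearMap.range V.d).subtype ∘ₗ ρ = 0 := by
      refine degPart_ext fun i hi e _ hei => ?_
      change τ (ρ e) = 0
      have hρe := hρ.homogeneous i e hei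
      rcases eq_or_ne i (n + 1 - l) with rfl | hne
      · rw [hτ, comp_of_mem hρe, hdg _ (ρ e).2, hu e _ (by omega) hei, sub_self]
      · exact hτ0 (by rw [comp_of_mem_ne hρe hne, map_zero])
    exact LinearMap.congr_fun key e
  · have hdc : V.comp (n + 1 - l) (V.d c) = V.d c :=
      comp_of_mem (by rw [show n + 1 - l = i + 1 by omega]; exact V.d_mem hci)
    rw [hτ, hdc, hg c hc]
    ring

end Orientation

end TwistFunctionals

/-! ### Abstract extensions by `y_j`, `d y_j` and radical elements, and solvability in them. -/

section TwistExtension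

variable {K : Type u} [Field K] {V : CDGA.{u, v} K} {A : CDGA.{u, w} K}

/-- An orientation-preserving extension `f : V → A` by elements `y_j` of degree `m = l - 1` and
their differentials, up to a graded subspace `N` in the radical of the pairing. The functionals
`τ_j` describe the pairing of `V` with the `y_j`. -/
structure IsTwistExtension {n : ℕ} (o : V.Orientation n) (o' : A.Orientation n) (f : Hom V A)
    (l m : ℕ) {r : ℕ} (τ : Fin r → V →ₗ[K] K) (y : Fin r → A) (N : Submodule K A) : Prop where
  quasiIso : f.IsQuasiIso
  injective : Function.Injective f
  orient : ∀ a, o'.toFun (f a) = o.toFun a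
  degree : Fin r → m + 1 = l
  y_mem : ∀ j, y j ∈ A.grading m
  pairing_y : ∀ a j, o'.pairing (f a) (y j) = τ j a
  pairing_y_y : ∀ i j, o'.pairing (y i) (y j) = 0
  pairing_y_dy : ∀ i j, o'.pairing (y i) (A.d (y j)) = 0
  N_homogeneous : N.IsHomogeneous A.grading
  N_pairing : ∀ x ∈ N, ∀ a, o'.pairing x a = 0
  pairing_N : ∀ a, ∀ x ∈ N, o'.pairing a x = 0
  independent : ∀ (a : V) (c : Fin r → K), ∀ x ∈ N,
    A.d (f a + ∑ j, c j • y j + x) = 0 → V.d a = 0 ∧ c = 0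
  cover : ∀ i, (i < l ∨ (i ≤ l ∧ V.grading 1 = ⊥)) → A.grading i ≤
    LinearMap.range f.toAlgHom.toLinearMap ⊔ Submodule.span K (Set.range y) ⊔
      Submodule.span K (Set.range fun j => A.d (y j)) ⊔ N

/-- The subspace `f(C) ⊕ span y ⊕ D`. -/
def twistCoexact (f : Hom V A) {r : ℕ} (y : Fin r → A) (C : Submodule K V) (D : Submodule K A) :
    Submodule K A :=
  C.map f.toAlgHom.toLinearMap ⊔ Submodule.span K (Set.range y) ⊔ D

theorem mem_twistCoexact {f : Hom V A} {r : ℕ} {y : Fin r → A} {C : Submodule K V}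
    {D : Submodule K A} {x : A} : x ∈ twistCoexact f y C D ↔
      ∃ c ∈ C, ∃ a : Fin r → K, ∃ z ∈ D, x = f c + ∑ j, a j • y j + z := by
  rw [twistCoexact, Submodule.mem_sup]
  constructor
  · rintro ⟨_, hp, z, hz, rfl⟩
    obtain ⟨_, ⟨c, hc, rfl⟩, q, hq, rfl⟩ := Submodule.mem_sup.1 hp
    obtain ⟨a, rfl⟩ := (Submodule.mem_span_range_iff_exists_fun K).1 hq
    exact ⟨c, hc, a, z, hz, rfl⟩
  · rintro ⟨c, hc, a, z, hz, rfl⟩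
    refine ⟨_, Submodule.add_mem_sup ⟨c, hc, rfl⟩ ?_, z, hz, rfl⟩
    exact (Submodule.mem_span_range_iff_exists_fun K).2 ⟨a, rfl⟩

namespace IsTwistExtension

variable {n : ℕ} {o : V.Orientation n} {o' : A.Orientation n} {f : Hom V A} {l m r : ℕ}
  {τ : Fin r → V →ₗ[K] K} {y : Fin r → A} {N : Submodule K A}
  {H C E : Submodule K V} {D : Submodule K A}

theorem pairing_map (X : IsTwistExtension o o' f l m τ y N)
    (a b : V) : o'.pairing (f a) (f b) = o.pairing a b := by
  rw [Orientation.pairing_apply, ← map_mul, X.orient, Orientation.pairing_apply]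

/-- Vanishing of `τ j` is needed on every component, because exchanging the arguments costs a sign
depending on the degree. -/
theorem y_pairing (X : IsTwistExtension o o' f l m τ y N)
    {j : Fin r} {a : V} (h : ∀ i, τ j (V.comp i a) = 0) :
    o'.pairing (y j) (f a) = 0 := by
  have key : ∀ i, V.comp i a ∈ LinearMap.ker (o'.pairing (y j) ∘ₗ f.toAlgHom.toLinearMap) := by
    intro i
    change o'.pairing (y j) (f (V.comp i a)) = 0
    rw [o'.pairing_comm (X.y_mem j) (f.map_mem (comp_mem i a)), X.pairing_y, h, mul_zero]
  exact mem_of_comp key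

theorem homogeneous_twistCoexact (X : IsTwistExtension o o' f l m τ y N)
    (hC : C.IsHomogeneous V.grading)
    (hD : D.IsHomogeneous A.grading) : (twistCoexact f y C D).IsHomogeneous A.grading := by
  refine homogeneous_sup (homogeneous_sup (homogeneous_map f hC) (homogeneous_span ?_)) hD
  rintro _ ⟨j, rfl⟩
  exact ⟨m, X.y_mem j⟩

theorem pairing_harmonic (X : IsTwistExtension o o' f l m τ y N)
    (hH : o.IsHOrthogonal H C) (hτH : ∀ j, ∀ a ∈ H, τ j a = 0) (hDN : D ≤ N)
    {h : V} (hh : h ∈ H) {x : A} (hx : x ∈ twistCoexact f y C D) : o'.pairing (f h) x = 0 := by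
  obtain ⟨c, hc, a, z, hz, rfl⟩ := mem_twistCoexact.1 hx
  rw [map_add, map_add, X.pairing_map, hH.orthogonal h hh c hc, X.pairing_N _ z (hDN hz), map_sum,
    zero_add, add_zero]
  exact Finset.sum_eq_zero fun j _ => by rw [map_smul, X.pairing_y, hτH j h hh, smul_zero]

/-- Injectivity of the differential on `twistCoexact` is what allows this space to be contained in a
coexact part. -/
theorem eq_zero_of_d (X : IsTwistExtension o o' f l m τ y N)
    (hC : ∀ c ∈ C, V.d c = 0 → c = 0) (hDN : D ≤ N)
    (hD : ∀ z ∈ D, A.d z = 0 → z = 0) {x : A} (hx : x ∈ twistCoexact f y C D)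
    (hdx : A.d x = 0) : x = 0 := by
  obtain ⟨c, hc, a, z, hz, rfl⟩ := mem_twistCoexact.1 hx
  obtain ⟨h1, rfl⟩ := X.independent c a z (hDN hz) hdx
  obtain rfl := hC c hc h1
  have e : f (0 : V) + ∑ j, (0 : Fin r → K) j • y j + z = z := by simp
  rw [e] at hdx ⊢
  exact hD z hz hdx

/-- The coexact part agrees with `f(C) ⊕ span y ⊕ D` as far as the generators reach. -/
theorem mem_twistCoexact_of_mem (X : IsTwistExtension o o' f l m τ y N)
    (hH : o.IsHOrthogonal H C)
    (hsup : D ⊔ N ⊓ LinearMap.ker A.d = N) {C' : Submodule K A}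
    (hC' : o'.IsHOrthogonal (H.map f.toAlgHom.toLinearMap) C')
    (hle : twistCoexact f y C D ≤ C') {i : ℕ} (hi : i < l ∨ (i ≤ l ∧ V.grading 1 = ⊥)) {x : A}
    (hx : x ∈ C') (hxi : x ∈ A.grading i) : x ∈ twistCoexact f y C D := by
  have hker (z : A) (hz : A.d z = 0) : ∃ h ∈ H, ∃ b, z = f h + A.d b := by
    have : z ∈ LinearMap.ker A.d := hz
    rw [← hC'.harm_sup] at this
    obtain ⟨_, ⟨h, hh, rfl⟩, _, ⟨b, rfl⟩, rfl⟩ := Submodule.mem_sup.1 this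
    exact ⟨h, hh, b, rfl⟩
  -- All closed terms of `x` are gathered into one harmonic and one exact term. What remains, `f c +
  -- t + z`, lies in `twistCoexact ≤ C'`, so the closed part lies in `C' ∩ ker d = 0`.
  obtain ⟨p, hp, ν, hν, rfl⟩ := Submodule.mem_sup.1 (X.cover i hi hxi)
  obtain ⟨q, hq, w, hw, rfl⟩ := Submodule.mem_sup.1 hp
  obtain ⟨_, ⟨v, rfl⟩, t, ht, rfl⟩ := Submodule.mem_sup.1 hq
  rw [← hsup] at hν
  obtain ⟨z, hz, k, hk, rfl⟩ := Submodule.mem_sup.1 hν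
  obtain ⟨h, hh, b, -, c, hc, rfl⟩ := hH.exists_decomp v
  have hw' : w ∈ LinearMap.range A.d := by
    refine Submodule.span_le.2 ?_ hw
    rintro _ ⟨j, rfl⟩
    exact ⟨y j, rfl⟩
  obtain ⟨w', rfl⟩ := hw'
  obtain ⟨h', hh', b', rfl⟩ := hker k hk.2
  have hx0 : f c + t + z ∈ twistCoexact f y C D :=
    Submodule.add_mem_sup (Submodule.add_mem_sup ⟨c, hc, rfl⟩ ht) hz
  have hdec : f.toAlgHom.toLinearMap (h + V.d b + c) + t + A.d w' + (z + (f h' + A.d b')) =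
      f (h + h') + A.d (f b + w' + b') + (f c + t + z) := by
    rw [map_add A.d, map_add A.d, ← f.map_d, AlgHom.toLinearMap_apply, map_add, map_add, map_add]
    abel
  rw [hdec] at hx ⊢
  have hsum : h + h' ∈ H := Submodule.add_mem _ hh hh'
  have hdiff : f (h + h') + A.d (f b + w' + b') ∈ C' := by
    have := Submodule.sub_mem _ hx (hle hx0)
    rwa [add_sub_cancel_right] at this
  have hz0 := Submodule.disjoint_def.1 hC'.coexact_isCompl.disjoint _ (by
    rw [← hC'.harm_sup]
    exact Submodule.add_mem_sup ⟨h + h', hsum, rfl⟩ ⟨_, rfl⟩) hdiff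
  rw [hz0, zero_add]
  exact hx0

/-- The `y_j` are orthogonal to one another, to `C` because the `τ_j` vanish there, and to `N`.
Wherever the coexact part agrees with `twistCoexact`, they contribute only radical elements. -/
theorem y_pairing_twistCoexact (X : IsTwistExtension o o' f l m τ y N)
    (hC : C.IsHomogeneous V.grading)
    (hτC : ∀ j, ∀ c ∈ C, τ j c = 0) (hDN : D ≤ N) {x : A} (hx : x ∈ twistCoexact f y C D)
    (j : Fin r) : o'.pairing (y j) x = 0 := by
  obtain ⟨c, hc, a, z, hz, rfl⟩ := mem_twistCoexact.1 hx
  rw [map_add, map_add, X.y_pairing fun i => hτC j _ (comp_mem_of_mem hC i hc),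
    X.pairing_N _ z (hDN hz), map_sum,
    Finset.sum_eq_zero fun k _ => by rw [map_smul, X.pairing_y_y, smul_zero]]
  simp

/-- Once `x` is orthogonal to the `y_j`, testing it against `twistCoexact` reduces to testing it
against `f(C)`. -/
theorem pairing_eq_of_y_pairing (X : IsTwistExtension o o' f l m τ y N)
    {c : V} {a : Fin r → K} {z x : A} (hz : z ∈ N)
    (hx : ∀ j, o'.pairing (y j) x = 0) :
    o'.pairing (f c + ∑ j, a j • y j + z) x = o'.pairing (f c) x := by
  rw [map_add o'.pairing, LinearMap.add_apply, X.N_pairing z hz, add_zero, map_add o'.pairing,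
    LinearMap.add_apply, add_eq_left, map_sum, LinearMap.sum_apply]
  exact Finset.sum_eq_zero fun j _ => by rw [map_smul, LinearMap.smul_apply, hx, smul_zero]

end IsTwistExtension

namespace Orientation

theorem pairing_d_add {n : ℕ} (o : V.Orientation n) {i : ℕ} {a : V} (ha : a ∈ V.grading i)
    (b : V) : o.pairing (V.d a) b + (-1 : K) ^ i * o.pairing a (V.d b) = 0 := by
  have := o.closed (a * b)
  rwa [V.leibniz ha, map_add, map_smul, smul_eq_mul] at this

/-- Pointwise solvability of the twist conditions in one degree implies linear solvability. -/
theorem exists_linear_solution {n : ℕ} (o : V.Orientation n) {S P T : Submodule K V}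
    (h : ∀ e ∈ S, ∃ x ∈ P, ∀ c ∈ T, o.pairing c x = o.pairing c e) :
    ∃ g : S →ₗ[K] P, ∀ e : S, ∀ c ∈ T, o.pairing c (g e) = o.pairing c e := by
  -- `B v` is `⟨·, v⟩` on `T`. The hypothesis says `B(S) ⊆ B(P)`, and projectivity of `S` lifts `B`
  -- on `S` through `P`.
  let B : V →ₗ[K] (T →ₗ[K] K) := LinearMap.lcomp K K T.subtype ∘ₗ o.pairing.flip
  have hle : S.map B ≤ P.map B := by
    rintro _ ⟨e, he, rfl⟩
    obtain ⟨x, hx, hxe⟩ := h e he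
    exact ⟨x, hx, LinearMap.ext fun c => hxe c c.2⟩
  have hmem (e : S) : B e ∈ LinearMap.range (B ∘ₗ P.subtype) := by
    obtain ⟨x, hx, hxe⟩ := hle ⟨e, e.2, rfl⟩
    exact ⟨⟨x, hx⟩, hxe⟩
  obtain ⟨g, hg⟩ := Module.projective_lifting_property (B ∘ₗ P.subtype).rangeRestrict
    ((B ∘ₗ S.subtype).codRestrict _ hmem) (B ∘ₗ P.subtype).surjective_rangeRestrict
  refine ⟨g, fun e c hc => ?_⟩
  exact LinearMap.congr_fun (congrArg Subtype.val (LinearMap.congr_fun hg e)) ⟨c, hc⟩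

end Orientation

namespace IsTwistExtension

variable {n : ℕ} {o : V.Orientation n} {o' : A.Orientation n} {f : Hom V A} {l m r : ℕ}
  {τ : Fin r → V →ₗ[K] K} {y : Fin r → A} {N : Submodule K A}
  {H C E : Submodule K V} {D : Submodule K A}
  {ρ : V.degPart E (Set.Ico ((n + 1) / 2) l) →ₗ[K] LinearMap.range V.d}

/-- The twist conditions are solvable in degree `l`. -/
theorem exists_solution_top (X : IsTwistExtension o o' f l m τ y N)
    (hfin : V.IsFiniteType)
    (hl : (n + 1) / 2 < l ∨ (V.grading 1 = ⊥ ∧ l = (n + 1) / 2)) (hH : o.IsHOrthogonal H C)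
    (hE : o.IsRadicalComplement C E) (hρ : o.SolvesTwist C E (Set.Ico ((n + 1) / 2) l) ρ)
    (hτ : Submodule.span K (Set.range τ) = twistFunctionals H C n l ρ) (hDN : D ≤ N)
    {C' : Submodule K A} (hlow : ∀ i, (i < l ∨ (i ≤ l ∧ V.grading 1 = ⊥)) → ∀ x ∈ C',
      x ∈ A.grading i → x ∈ twistCoexact f y C D) {e : A} (he : e ∈ C') (hel : e ∈ A.grading l)
    {j : ℕ} (hj : j + l = n) : ∃ x ∈ LinearMap.range A.d ⊓ A.grading l,
      ∀ c ∈ C' ⊓ A.grading j, o'.pairing c x = o'.pairing c e := by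
  have hτm (k : Fin r) : τ k ∈ twistFunctionals H C n l ρ := by
    rw [← hτ]; exact Submodule.subset_span ⟨k, rfl⟩
  -- Integration by parts gives `⟨d c, w⟩ = -(-1)^j ⟨c, d w⟩` for `c` of degree `j`, which dictates
  -- the sign of the functional.
  obtain ⟨σ, hσ, u, hu, hF⟩ := hρ.exists_functional hfin hH hE
    (-((-1 : K) ^ j • (o'.pairing.flip e ∘ₗ f.toAlgHom.toLinearMap)))
  rw [← hτ] at hσ
  obtain ⟨a, rfl⟩ := (Submodule.mem_span_range_iff_exists_fun K).1 hσ
  let w : A := ∑ k, a k • y k + f u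
  -- `u` is not known to be homogeneous, so only the degree `l` component of `d w` is used.
  have hx : A.comp l (A.d w) ∈ LinearMap.range A.d ⊓ A.grading l :=
    ⟨comp_mem_of_mem homogeneous_range_d l ⟨w, rfl⟩, comp_mem l _⟩
  -- A nonzero value requires `n = 2 * l - 1`. Then `l = (n + 1) / 2` and `V^1 = 0`, so the
  -- description of `C'` reaches the degree `l` of `e`.
  have hye (k : Fin r) : o'.pairing (y k) e = 0 := by
    have := X.degree k
    by_cases hml : m + l = n
    · refine X.y_pairing_twistCoexact hH.coexact_homogeneous (fun i => (hτm i).2.2.1) hDN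
        (hlow l ?_ e he hel) k
      rcases hl with hl | hl
      · omega
      · exact Or.inr ⟨le_rfl, hl.1⟩
    · exact o'.pairing_of_mem_ne hml (X.y_mem k) hel
  -- Again only `n = 2 * l - 1` matters; there `u = 0`, and `⟨y_i, d y_j⟩ = 0` suffices.
  have hyx (k : Fin r) : o'.pairing (y k) (A.comp l (A.d w)) = 0 := by
    have := X.degree k
    by_cases hml : m + l = n
    · have hu0 : u = 0 := hu (by omega)
      rw [o'.pairing_comp_right hml (X.y_mem k)]
      simp [w, hu0, X.pairing_y_dy]
    · exact o'.pairing_of_mem_ne hml (X.y_mem k) hx.2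
  refine ⟨_, hx, fun c hc => ?_⟩
  obtain ⟨c₀, hc₀, b, z, hz, rfl⟩ := mem_twistCoexact.1 (hlow j (by
    rcases hl with hl | hl
    · left; omega
    · right; exact ⟨by omega, hl.1⟩) c hc.1 hc.2)
  rw [X.pairing_eq_of_y_pairing (hDN hz) hye, X.pairing_eq_of_y_pairing (hDN hz) hyx,
    ← o'.pairing_comp_left hj _ hx.2, ← o'.pairing_comp_left hj _ hel, f.comp_apply,
    o'.pairing_comp_right hj (f.map_mem (comp_mem j c₀))]
  have h1 := hF j hj _ (comp_mem_of_mem hH.coexact_homogeneous j hc₀) (comp_mem j c₀)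
  have h2 := o'.pairing_d_add (f.map_mem (comp_mem j c₀)) w
  have h3 : o'.pairing (A.d (f (V.comp j c₀))) w =
      (∑ k, a k • τ k) (V.d (V.comp j c₀)) + o.pairing (V.d (V.comp j c₀)) u := by
    simp only [w, ← f.map_d, map_add, X.pairing_map, map_sum, map_smul, X.pairing_y,
      LinearMap.sum_apply, LinearMap.smul_apply]
  rw [h3, h1] at h2
  simp only [LinearMap.neg_apply, LinearMap.smul_apply, LinearMap.comp_apply, LinearMap.flip_apply,
    AlgHom.toLinearMap_apply, smul_eq_mul] at h2
  have h4 : (-1 : K) ^ j * (o'.pairing (f (V.comp j c₀)) (A.d w) -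
      o'.pairing (f (V.comp j c₀)) e) = 0 := by
    rw [mul_sub, sub_eq_add_neg, add_comm]; exact h2
  exact sub_eq_zero.1 ((mul_eq_zero.1 h4).resolve_left (pow_ne_zero _ (by simp)))

/-- The given solution still satisfies the twist conditions in the extension. -/
theorem pairing_solution (X : IsTwistExtension o o' f l m τ y N)
    (hH : o.IsHOrthogonal H C) (hE : o.IsRadicalComplement C E)
    (hρ : o.SolvesTwist C E (Set.Ico ((n + 1) / 2) l) ρ)
    (hτ : ∀ j, τ j ∈ twistFunctionals H C n l ρ) (hDN : D ≤ N) {i : ℕ}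
    (hi : i ∈ Set.Ico ((n + 1) / 2) l) (e : V.degPart E (Set.Ico ((n + 1) / 2) l))
    (he : (e : V) ∈ V.grading i) {c : A} (hc : c ∈ twistCoexact f y C D) :
    o'.pairing c (f (ρ e)) = o'.pairing c (f e) := by
  have heC : (e : V) ∈ C := hE.le (degPart_le _ _ e.2)
  obtain ⟨c₀, hc₀, b, z, hz, rfl⟩ := mem_twistCoexact.1 hc
  rw [X.pairing_eq_of_y_pairing (hDN hz), X.pairing_eq_of_y_pairing (hDN hz), X.pairing_map,
    X.pairing_map, hρ.pairing_eq_of_mem hH.coexact_homogeneous hE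
      ((degPart_le _ _).trans hE.le) hi e he hc₀]
  · exact fun j => X.y_pairing fun k =>
      (hτ j).2.2.1 _ (comp_mem_of_mem hH.coexact_homogeneous k heC)
  -- Here the vanishing of the `τ_j` on the image of `ρ` enters.
  · refine fun j => X.y_pairing fun k => ?_
    have h := hρ.homogeneous i e he
    rcases eq_or_ne i k with rfl | hk
    · rw [comp_of_mem h, (hτ j).2.2.2]
    · rw [comp_of_mem_ne h hk, map_zero]

/-- In the extension, the twist conditions are solvable up to degree `l`. -/
theorem exists_solution (X : IsTwistExtension o o' f l m τ y N)
    (hPD : o.IsPDGA) (hfin : V.IsFiniteType)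
    (hl : (n + 1) / 2 < l ∨ (V.grading 1 = ⊥ ∧ l = (n + 1) / 2)) (hH : o.IsHOrthogonal H C)
    (hE : o.IsRadicalComplement C E) (hρ : o.SolvesTwist C E (Set.Ico ((n + 1) / 2) l) ρ)
    (hτ : Submodule.span K (Set.range τ) = twistFunctionals H C n l ρ) :
    ∃ (H' C' E' : Submodule K A), o'.IsHOrthogonal H' C' ∧ o'.IsRadicalComplement C' E' ∧
      (∀ i ∈ Set.Ico ((n + 1) / 2) l, E' ⊓ A.grading i =
        (E ⊓ V.grading i).map f.toAlgHom.toLinearMap) ∧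
      ∃ ρ' : E' →ₗ[K] LinearMap.range A.d,
        (∀ (e : V.degPart E (Set.Ico ((n + 1) / 2) l)) (e' : E'),
          (e' : A) = f e → (ρ' e' : A) = f (ρ e)) ∧
        o'.SolvesTwist C' E' (Set.Icc ((n + 1) / 2) l) ρ' := by
  have hτm (k : Fin r) : τ k ∈ twistFunctionals H C n l ρ := by
    rw [← hτ]; exact Submodule.subset_span ⟨k, rfl⟩
  have hC := hH.coexact_homogeneous
  -- `D` complements the cocycles in `N`, so that `d` is injective on `twistCoexact f y C D`.
  obtain ⟨D, hD, -, hDk, hDsup⟩ := exists_homogeneous_compl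
    (homogeneous_inf X.N_homogeneous homogeneous_ker_d) X.N_homogeneous (D := ⊥) homogeneous_bot
    inf_le_left bot_le disjoint_bot_left
  have hDN : D ≤ N := le_sup_left.trans hDsup.le
  have hC0d : ∀ x ∈ twistCoexact f y C D, A.d x = 0 → x = 0 := fun x hx =>
    X.eq_zero_of_d (fun c => hH.eq_zero_of_d) hDN
      (fun z hz hdz => Submodule.disjoint_def.1 hDk z hz ⟨hDN hz, hdz⟩) hx
  obtain ⟨C', hC', hle⟩ := (hH.isHarmonic.map X.quasiIso).exists_isHOrthogonal
    (hPD.of_quasiIso X.quasiIso X.orient) (X.homogeneous_twistCoexact hC hD)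
    (by
      rintro _ ⟨h, hh, rfl⟩ c hc
      exact X.pairing_harmonic hH (fun j => (hτm j).2.1) hDN hh hc)
    (Submodule.disjoint_def.2 fun x hx hxr => hC0d x hx (range_d_le_ker hxr))
  have hlow : ∀ i, (i < l ∨ (i ≤ l ∧ V.grading 1 = ⊥)) → ∀ x ∈ C', x ∈ A.grading i →
      x ∈ twistCoexact f y C D := fun i hi x hx hxi =>
    X.mem_twistCoexact_of_mem hH hDsup hC' hle hi hx hxi
  have hmap : C.map f.toAlgHom.toLinearMap ≤ C' :=
    le_trans (le_sup_left.trans le_sup_left) hle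
  obtain ⟨E', hE', hEE'⟩ := Orientation.exists_isRadicalComplement (o := o') (C := C')
    (D := (V.degPart E (Set.Ico ((n + 1) / 2) l)).map f.toAlgHom.toLinearMap)
    hC'.coexact_homogeneous (homogeneous_map f (homogeneous_degPart _))
    ((Submodule.map_mono ((degPart_le _ _).trans hE.le)).trans hmap)
    (by
      rw [Submodule.disjoint_def]
      rintro _ ⟨e, he, rfl⟩ hr
      have heE := degPart_le _ _ he
      have : e = 0 := Submodule.disjoint_def.1 hE.disjoint e heE
        ⟨hE.le heE, fun c hc => by rw [← X.pairing_map]; exact hr.2 _ (hmap ⟨c, hc, rfl⟩)⟩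
      rw [this, map_zero])
  have hcompl : ∀ i ∈ Set.Ico ((n + 1) / 2) l, E' ⊓ A.grading i =
      (E ⊓ V.grading i).map f.toAlgHom.toLinearMap := by
    intro i hi
    apply le_antisymm
    · rintro x ⟨hxE, hxi⟩
      obtain ⟨c, hc, a, z, hz, rfl⟩ :=
        mem_twistCoexact.1 (hlow i (Or.inl hi.2) x (hE'.le hxE) hxi)
      rw [← hE.sup] at hc
      obtain ⟨e, he, b, hb, rfl⟩ := Submodule.mem_sup.1 hc
      -- `q` is the part of `x` outside `f(E)`. It is radical, tested against `C'` in degree `n - i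
      -- < l` where `C'` is known; it also lies in `E'`, so it is zero.
      let q : A := A.comp i (f b + ∑ j, a j • y j + z)
      have hbC : b ∈ C := hb.1
      have hqC0 : f b + ∑ j, a j • y j + z ∈ twistCoexact f y C D :=
        mem_twistCoexact.2 ⟨b, hbC, a, z, hz, rfl⟩
      have hdec : f (e + b) + ∑ j, a j • y j + z = f (V.comp i e) + q := by
        rw [← comp_of_mem hxi, ← f.comp_apply, ← map_add]
        congr 1
        rw [map_add]
        abel
      have heI : V.comp i e ∈ V.degPart E (Set.Ico ((n + 1) / 2) l) :=
        mem_degPart hi (comp_mem_of_mem hE.homogeneous i he) (comp_mem i e)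
      have hq : q ∈ o'.radical C' := by
        refine o'.mem_radical_of_comp hC'.coexact_homogeneous (comp_mem i _)
          (comp_mem_of_mem hC'.coexact_homogeneous i (hle hqC0)) fun j hj c hc hcj => ?_
        have hcC0 := hlow j (Or.inl (by have := hi.1; have := hi.2; omega)) c hc hcj
        rw [o'.pairing_comp_left hj _ hcj, X.pairing_eq_of_y_pairing (hDN hz)
          (X.y_pairing_twistCoexact hC (fun j => (hτm j).2.2.1) hDN hcC0)]
        obtain ⟨c', hc', a', z', hz', rfl⟩ := mem_twistCoexact.1 hcC0
        rw [map_add, map_add, X.pairing_map, hb.2 c' hc', X.pairing_N _ _ (hDN hz'), map_sum,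
          Finset.sum_eq_zero fun k _ => by
            rw [map_smul, X.pairing_y, (hτm k).2.2.1 b hbC, smul_zero]]
        simp
      have hq0 : q = 0 := by
        refine Submodule.disjoint_def.1 hE'.disjoint q ?_ hq
        have : q = (f (e + b) + ∑ j, a j • y j + z) - f (V.comp i e) := by
          rw [hdec, add_sub_cancel_left]
        rw [this]
        exact Submodule.sub_mem _ hxE (hEE' ⟨_, heI, rfl⟩)
      rw [hdec, hq0, add_zero]
      exact ⟨_, ⟨degPart_le _ _ heI, comp_mem i e⟩, rfl⟩
    · rintro _ ⟨e, he, rfl⟩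
      exact ⟨hEE' ⟨e, mem_degPart hi he.1 he.2, rfl⟩, f.map_mem he.2⟩
  refine ⟨_, C', E', hC', hE', hcompl, ?_⟩
  -- The new map is built by degree: `ρ` transported along `f` in the old degrees, a linear choice
  -- of solutions in degree `l`, and zero elsewhere.
  have hg (i : ℕ) : ∃ g : ↥(E' ⊓ A.grading i) →ₗ[K] LinearMap.range A.d,
      (∀ e, (g e : A) ∈ A.grading i) ∧
      (i ∈ Set.Icc ((n + 1) / 2) l → ∀ e, ∀ j, j + i = n → ∀ c ∈ C', c ∈ A.grading j →
        o'.pairing c (g e) = o'.pairing c e) ∧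
      (i ∈ Set.Ico ((n + 1) / 2) l → ∀ (e : V.degPart E (Set.Ico ((n + 1) / 2) l))
        (he : f e ∈ E' ⊓ A.grading i), (g ⟨f e, he⟩ : A) = f (ρ e)) := by
    by_cases hi : i ∈ Set.Ico ((n + 1) / 2) l
    · obtain ⟨s, hs⟩ := LinearMap.exists_leftInverse_of_injective f.toAlgHom.toLinearMap
        (LinearMap.ker_eq_bot.2 X.injective)
      have hsf (a : V) : s (f a) = a := LinearMap.congr_fun hs a
      have hrep (e : ↥(E' ⊓ A.grading i)) : ∃ e₀ ∈ E ⊓ V.grading i, f e₀ = e := by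
        have : (e : A) ∈ (E ⊓ V.grading i).map f.toAlgHom.toLinearMap := (hcompl i hi).le e.2
        exact this
      let t : ↥(E' ⊓ A.grading i) →ₗ[K] V.degPart E (Set.Ico ((n + 1) / 2) l) :=
        (s ∘ₗ Submodule.subtype _).codRestrict _ fun e => by
          obtain ⟨e₀, he₀, hee⟩ := hrep e
          change s e ∈ _
          rw [← hee, hsf]
          exact mem_degPart hi he₀.1 he₀.2
      have ht (e : ↥(E' ⊓ A.grading i)) : f (t e) = e ∧ (t e : V) ∈ V.grading i := by
        obtain ⟨e₀, he₀, hee⟩ := hrep e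
        have : (t e : V) = e₀ := by
          change s e = _
          rw [← hee, hsf]
        rw [this]
        exact ⟨hee, he₀.2⟩
      let fr : LinearMap.range V.d →ₗ[K] LinearMap.range A.d :=
        f.toAlgHom.toLinearMap.restrict (by
          rintro _ ⟨a, rfl⟩
          exact ⟨f a, (f.map_d a).symm⟩)
      refine ⟨fr ∘ₗ ρ ∘ₗ t, fun e => ?_, fun _ e j hj c hc hcj => ?_, fun _ e he => ?_⟩
      · exact f.map_mem (hρ.homogeneous i _ (ht e).2)
      · have h1 := X.pairing_solution hH hE hρ hτm hDN hi (t e) (ht e).2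
          (hlow j (Or.inl (by have := hi.1; have := hi.2; omega)) c hc hcj)
        rw [(ht e).1] at h1
        exact h1
      · have : t ⟨f e, he⟩ = e := Subtype.ext (hsf e)
        change f (ρ (t ⟨f e, he⟩)) = _
        rw [this]
    · rcases eq_or_ne i l with rfl | hil
      · rcases lt_or_ge n i with hn | hn
        · exact ⟨0, fun _ => Submodule.zero_mem _, fun _ e j hj => by omega,
            fun h => absurd h hi⟩
        · obtain ⟨g, hg⟩ := o'.exists_linear_solution (S := E' ⊓ A.grading i)
            (P := LinearMap.range A.d ⊓ A.grading i) (T := C' ⊓ A.grading (n - i))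
            fun e he => X.exists_solution_top hfin hl hH hE hρ hτ hDN hlow (hE'.le he.1) he.2
              (by omega)
          refine ⟨Submodule.inclusion inf_le_left ∘ₗ g, fun e => (g e).2.2,
            fun _ e j hj c hc hcj => ?_, fun h => absurd h hi⟩
          obtain rfl : j = n - i := by omega
          exact hg e c ⟨hc, hcj⟩
      · exact ⟨0, fun _ => Submodule.zero_mem _, fun h => absurd ⟨h.1, lt_of_le_of_ne h.2 hil⟩ hi,
          fun h => absurd h hi⟩
  choose g hg1 hg2 hg3 using hg
  obtain ⟨ρ', hρ'⟩ := exists_linearMap_of_components g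
  refine ⟨ρ', ?_, Orientation.SolvesTwist.of_pairing_eq o' hE' hE'.le ?_ ?_⟩
  · have key : (LinearMap.range A.d).subtype ∘ₗ ρ' ∘ₗ
        (Submodule.inclusion hEE' ∘ₗ
          f.toAlgHom.toLinearMap.submoduleMap (V.degPart E (Set.Ico ((n + 1) / 2) l))) =
        f.toAlgHom.toLinearMap ∘ₗ (LinearMap.range V.d).subtype ∘ₗ ρ := by
      refine degPart_ext fun i hi e _ hei => ?_
      have h1 := hρ' i ⟨f e, hEE' ⟨e, e.2, rfl⟩⟩ (f.map_mem hei)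
      exact (congrArg Subtype.val h1).trans (hg3 i hi e _)
    intro e e' hee
    have : e' = ⟨f e, hEE' ⟨e, e.2, rfl⟩⟩ := Subtype.ext hee
    rw [this]
    exact LinearMap.congr_fun key e
  · intro i e he
    rw [hρ' i e he]
    exact hg1 i _
  · intro i hi e he j hj c hc hcj
    rw [hρ' i e he]
    exact hg2 i hi _ j hj c hc hcj

end IsTwistExtension

end TwistExtension

/-! ### Linear maps out of tensor products of CDGAs. -/

section TensorMaps

variable {K : Type u} [Field K] {V : CDGA.{u, v} K} {W : CDGA.{u, w} K}

variable (V W) in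
/-- The bilinear map `(a, b) ↦ a ⊗ b` into the tensor product of CDGAs. -/
noncomputable def tmul : V →ₗ[K] W →ₗ[K] V.tensor W := TensorProduct.mk K V W

/-- Linear maps out of the tensor product of CDGAs. -/
noncomputable def tensorLift {M : Type*} [AddCommGroup M] [Module K M] (B : V →ₗ[K] W →ₗ[K] M) :
    V.tensor W →ₗ[K] M :=
  TensorProduct.lift B ∘ₗ (GradedTensorProduct.of K V.grading W.grading).symm.toLinearMap

@[simp] theorem tensorLift_tmul {M : Type*} [AddCommGroup M] [Module K M]
    (B : V →ₗ[K] W →ₗ[K] M) (a : V) (b : W) : tensorLift B (tmul V W a b) = B a b :=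
  TensorProduct.lift.tmul a b

theorem tensor_hom_induction {P : V.tensor W → Prop} (h0 : P 0)
    (hadd : ∀ a b, P a → P b → P (a + b))
    (hom : ∀ i j, ∀ a ∈ V.grading i, ∀ b ∈ W.grading j, P (tmul V W a b)) (t : V.tensor W) : P t :=
  tensor_induction V W h0 hadd hom t

theorem tensor_linearMap_ext {M : Type*} [AddCommGroup M] [Module K M] {f g : V.tensor W →ₗ[K] M}
    (h : ∀ a b, f (tmul V W a b) = g (tmul V W a b)) : f = g := by
  refine LinearMap.ext fun t => ?_
  induction t using tensor_hom_induction with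
  | h0 => rw [map_zero, map_zero]
  | hadd a b ha hb => rw [map_add, map_add, ha, hb]
  | hom i j a ha b hb => exact h a b

theorem tensor_grading_le {k : ℕ} {S : Submodule K (V.tensor W)}
    (h : ∀ i j, i + j = k → ∀ a ∈ V.grading i, ∀ b ∈ W.grading j, tmul V W a b ∈ S) :
    (V.tensor W).grading k ≤ S := by
  refine Submodule.span_le.2 ?_
  rintro _ ⟨i, j, hij, a, ha, b, hb, rfl⟩
  exact h i j hij a ha b hb

theorem tmul_mem_grading {i j k : ℕ} (h : i + j = k) {a : V} {b : W} (ha : a ∈ V.grading i)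
    (hb : b ∈ W.grading j) : tmul V W a b ∈ (V.tensor W).grading k :=
  tmul_mem V W h ha hb

theorem tmul_mul {j i' : ℕ} (a : V) {b : W} (hb : b ∈ W.grading j) {a' : V}
    (ha' : a' ∈ V.grading i') (b' : W) : tmul V W a b * tmul V W a' b' =
      (-1 : K) ^ (j * i') • tmul V W (a * a') (b * b') :=
  tmul_mul_tmul V W a hb ha' b'

theorem d_tmul (a : V) (b : W) : (V.tensor W).d (tmul V W a b) =
    tmul V W (V.d a) b + tmul V W (V.sgn a) (W.d b) :=
  tensorD_tmul' V W a b

theorem inl_eq_tmul (a : V) : V.inl W a = tmul V W a 1 := rfl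

theorem one_mem_grading (V : CDGA.{u, v} K) : (1 : V) ∈ V.grading 0 :=
  SetLike.GradedOne.one_mem (A := V.grading)

theorem sgn_one : V.sgn (1 : V) = 1 := by
  rw [V.sgn_of_mem (one_mem_grading V), pow_zero, one_smul]

/-- Contraction of the second factor with a functional. -/
noncomputable def contractRight (φ : W →ₗ[K] K) : V.tensor W →ₗ[K] V :=
  tensorLift (LinearMap.lsmul K V ∘ₗ φ).flip

@[simp] theorem contractRight_tmul (φ : W →ₗ[K] K) (a : V) (b : W) :
    contractRight φ (tmul V W a b) = φ b • a := by
  simp [contractRight]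

end TensorMaps

/-! ### The tensor product with the contractible algebra as a twist extension. -/

section KoszulTensor

variable {K : Type u} [Field K] (V : CDGA.{u, v} K) (r m : ℕ)

/-- The retraction `V ⊗ Λ → V` given by the augmentation. -/
noncomputable def koszulRetract : V.tensor (koszul K r m) →ₗ[K] V :=
  contractRight (koszulAug K r m).toLinearMap

@[simp] theorem koszulRetract_tmul (a : V) (b : koszul K r m) :
    koszulRetract V r m (tmul V _ a b) = koszulAug K r m b • a := contractRight_tmul _ a b

theorem koszulRetract_inl (a : V) : koszulRetract V r m (V.inl (koszul K r m) a) = a := by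
  rw [inl_eq_tmul, koszulRetract_tmul, map_one, one_smul]

theorem koszulRetract_d (t : V.tensor (koszul K r m)) :
    koszulRetract V r m ((V.tensor (koszul K r m)).d t) = V.d (koszulRetract V r m t) := by
  have h : koszulRetract V r m ∘ₗ (V.tensor (koszul K r m)).d = V.d ∘ₗ koszulRetract V r m :=
    tensor_linearMap_ext fun a b => by
      rw [LinearMap.comp_apply, LinearMap.comp_apply, d_tmul, map_add, koszulRetract_tmul,
        koszulRetract_tmul, koszulRetract_tmul, koszulAug_d, zero_smul, add_zero, map_smul]
  exact LinearMap.congr_fun h t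

variable (K) in
/-- The contracting homotopy, as a map on the contractible CDGA. -/
noncomputable def koszulContraction : koszul K r m →ₗ[K] koszul K r m := koszulHomotopy K r m

/-- The homotopy contracting `V ⊗ Λ` to `V`. -/
noncomputable def koszulTensorHomotopy :
    V.tensor (koszul K r m) →ₗ[K] V.tensor (koszul K r m) :=
  tensorLift ((tmul V (koszul K r m)).compl₁₂ V.sgn (koszulContraction K r m))

/-- The sign on the first factor makes the terms with `d a` cancel, which leaves the homotopy
identity of the second factor. -/
theorem koszulTensorHomotopy_spec [CharZero K] (t : V.tensor (koszul K r m)) :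
    (V.tensor (koszul K r m)).d (koszulTensorHomotopy V r m t) +
      koszulTensorHomotopy V r m ((V.tensor (koszul K r m)).d t) +
      V.inl (koszul K r m) (koszulRetract V r m t) = t := by
  have h : (V.tensor (koszul K r m)).d ∘ₗ koszulTensorHomotopy V r m +
      koszulTensorHomotopy V r m ∘ₗ (V.tensor (koszul K r m)).d +
      (V.inl (koszul K r m)).toAlgHom.toLinearMap ∘ₗ koszulRetract V r m = LinearMap.id := by
    refine tensor_linearMap_ext fun a b => ?_
    have e (a : V) (b : koszul K r m) : koszulTensorHomotopy V r m (tmul V _ a b) =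
        tmul V (koszul K r m) (V.sgn a) (koszulContraction K r m b) := tensorLift_tmul _ a b
    have hb : (koszul K r m).d (koszulContraction K r m b) +
        koszulContraction K r m ((koszul K r m).d b) + koszulAug K r m b • 1 = b :=
      koszulHomotopy_spec K r m b
    simp only [LinearMap.add_apply, LinearMap.comp_apply, LinearMap.id_apply, d_tmul, e, map_add,
      V.sgn_sgn, V.sgn_d, map_neg, LinearMap.neg_apply, AlgHom.toLinearMap_apply,
      koszulRetract_tmul, map_smul, inl_eq_tmul]
    conv_rhs => rw [← hb]
    rw [map_add, map_add, map_smul]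
    abel
  exact LinearMap.congr_fun h t

theorem koszul_inl_isQuasiIso [CharZero K] : (V.inl (koszul K r m)).IsQuasiIso := by
  rw [Hom.isQuasiIso_iff]
  constructor
  · rintro a - ⟨t, ht⟩
    refine ⟨koszulRetract V r m t, ?_⟩
    rw [← koszulRetract_d, ht, koszulRetract_inl]
  · intro t ht
    refine ⟨koszulRetract V r m t, by rw [← koszulRetract_d, ht, map_zero],
      koszulTensorHomotopy V r m t, ?_⟩
    have h := koszulTensorHomotopy_spec V r m t
    rw [ht, map_zero, add_zero] at h
    exact eq_sub_of_add_eq h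

variable {V r m} {n : ℕ} (o : V.Orientation n) (τ : Fin r → V →ₗ[K] K)

/-- The functional `a ⊗ b ↦ φ a * ψ b`. -/
noncomputable def tensorFunctional {W : CDGA.{u, w} K} (φ : V →ₗ[K] K) (ψ : W →ₗ[K] K) :
    V.tensor W →ₗ[K] K :=
  tensorLift ((LinearMap.mul K K).compl₁₂ φ ψ)

@[simp] theorem tensorFunctional_tmul {W : CDGA.{u, w} K} (φ : V →ₗ[K] K) (ψ : W →ₗ[K] K) (a : V)
    (b : W) : tensorFunctional φ ψ (tmul V W a b) = φ a * ψ b := tensorLift_tmul _ a b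

variable (m) in
/-- The extension of `Or` to `V ⊗ Λ` with `Or (a ⊗ y_j) = τ_j a`, vanishing on words of length at
least two. -/
noncomputable def twistFunctional : V.tensor (koszul K r m) →ₗ[K] K :=
  tensorFunctional o.toFun (koszulAug K r m).toLinearMap +
    ∑ j, tensorFunctional (τ j) (coeffY K r m j) -
    ∑ j, tensorFunctional (τ j ∘ₗ V.d ∘ₗ V.sgn) (coeffZ K r m j)

theorem twistFunctional_tmul (a : V) (b : koszul K r m) :
    twistFunctional m o τ (tmul V _ a b) = o.toFun a * koszulAug K r m b +
      ∑ j, τ j a * coeffY K r m j b - ∑ j, τ j (V.d (V.sgn a)) * coeffZ K r m j b := by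
  simp [twistFunctional, LinearMap.sum_apply]

/-- The values on `a ⊗ z_j` are made for this: in `d (a ⊗ y_j)` the term `τ_j (d a)` must cancel
against the value on `sgn a ⊗ z_j`. -/
theorem twistFunctional_d (t : V.tensor (koszul K r m)) :
    twistFunctional m o τ ((V.tensor (koszul K r m)).d t) = 0 := by
  have h : twistFunctional m o τ ∘ₗ (V.tensor (koszul K r m)).d = 0 := by
    refine tensor_linearMap_ext fun a b => ?_
    rw [LinearMap.comp_apply, d_tmul, map_add, twistFunctional_tmul, twistFunctional_tmul,
      koszulAug_d, o.closed, LinearMap.zero_apply]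
    have h1 (j : Fin r) : coeffY K r m j ((koszul K r m).d b) = 0 := (coeff_d K r m b j).1
    have h2 (j : Fin r) : coeffZ K r m j ((koszul K r m).d b) = coeffY K r m j b :=
      (coeff_d K r m b j).2
    simp [V.sgn_d, V.sgn_sgn, V.d_d, h1, h2]
  exact LinearMap.congr_fun h t

variable {l : ℕ}

theorem twistFunctional_degree (hm : Fin r → m + 1 = l)
    (hτ : ∀ j i, i + l ≠ n + 1 → ∀ a ∈ V.grading i, τ j a = 0) {i : ℕ}
    {t : V.tensor (koszul K r m)} (hi : i ≠ n) (ht : t ∈ (V.tensor (koszul K r m)).grading i) :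
    twistFunctional m o τ t = 0 := by
  have h : (V.tensor (koszul K r m)).grading i ≤ LinearMap.ker (twistFunctional m o τ) := by
    refine tensor_grading_le fun p q hpq a ha b hb => ?_
    rw [LinearMap.mem_ker, twistFunctional_tmul]
    have h1 : o.toFun a * koszulAug K r m b = 0 := by
      rcases eq_or_ne q 0 with rfl | hq
      · rw [o.degree (by omega) ha, zero_mul]
      · rw [koszulAug_of_mem K r m hq hb, mul_zero]
    have h2 (j : Fin r) : τ j a * coeffY K r m j b = 0 := by
      have := hm j
      rcases eq_or_ne q m with rfl | hq
      · rw [hτ j p (by omega) a ha, zero_mul]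
      · rw [coeffY_of_mem K r m hq hb, mul_zero]
    have h3 (j : Fin r) : τ j (V.d (V.sgn a)) * coeffZ K r m j b = 0 := by
      have := hm j
      rcases eq_or_ne q (m + 1) with rfl | hq
      · rw [V.sgn_of_mem ha, map_smul, map_smul, hτ j (p + 1) (by omega) _ (V.d_mem ha), smul_zero,
          zero_mul]
      · rw [coeffZ_of_mem K r m hq hb, mul_zero]
    simp [h1, h2, h3]
  exact h ht

theorem twistFunctional_inl (a : V) :
    twistFunctional m o τ (V.inl (koszul K r m) a) = o.toFun a := by
  rw [inl_eq_tmul, twistFunctional_tmul]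
  simp [coeffY_one, coeffZ_one]

/-- The orientation on `V ⊗ Λ` extending `Or` with `Or (a ⊗ y_j) = τ_j a`. -/
noncomputable def twistOrientation (hm : Fin r → m + 1 = l)
    (hτ : ∀ j i, i + l ≠ n + 1 → ∀ a ∈ V.grading i, τ j a = 0) :
    (V.tensor (koszul K r m)).Orientation n where
  toFun := twistFunctional m o τ
  degree := twistFunctional_degree o τ hm hτ
  closed := twistFunctional_d o τ
  ne_zero h := o.ne_zero (LinearMap.ext fun a => by
    rw [← twistFunctional_inl (m := m) o τ a, h]; rfl)

variable (V r m) in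
/-- The span of the tensors whose second factor has no constant and linear part. -/
noncomputable def decomposables : Submodule K (V.tensor (koszul K r m)) :=
  Submodule.span K {t | ∃ i j, ∃ a ∈ V.grading i, ∃ b ∈ (koszul K r m).grading j,
    koszulAug K r m b = 0 ∧ (∀ k, coeffY K r m k b = 0) ∧ (∀ k, coeffZ K r m k b = 0) ∧
    t = tmul V _ a b}

theorem decomposables_le {S : Submodule K (V.tensor (koszul K r m))}
    (h : ∀ i j, ∀ a ∈ V.grading i, ∀ b ∈ (koszul K r m).grading j, koszulAug K r m b = 0 →
      (∀ k, coeffY K r m k b = 0) → (∀ k, coeffZ K r m k b = 0) → tmul V _ a b ∈ S) :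
    decomposables V r m ≤ S := by
  refine Submodule.span_le.2 ?_
  rintro _ ⟨i, j, a, ha, b, hb, h1, h2, h3, rfl⟩
  exact h i j a ha b hb h1 h2 h3

theorem tmul_mem_decomposables {i j : ℕ} {a : V} (ha : a ∈ V.grading i) {b : koszul K r m}
    (hb : b ∈ (koszul K r m).grading j) (h1 : koszulAug K r m b = 0)
    (h2 : ∀ k, coeffY K r m k b = 0) (h3 : ∀ k, coeffZ K r m k b = 0) :
    tmul V _ a b ∈ decomposables V r m :=
  Submodule.subset_span ⟨i, j, a, ha, b, hb, h1, h2, h3, rfl⟩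

/-- Multiplication cannot create constant or linear parts in the second factor, and
`twistFunctional` sees nothing else; so the decomposables lie in the radical. -/
theorem decomposables_mul {x : V.tensor (koszul K r m)} (hx : x ∈ decomposables V r m)
    (t : V.tensor (koszul K r m)) : twistFunctional m o τ (x * t) = 0 := by
  have h : decomposables V r m ≤ LinearMap.ker (twistFunctional m o τ ∘ₗ
      LinearMap.mulRight K t) := by
    refine decomposables_le fun i j a ha b hb h1 h2 h3 => ?_
    rw [LinearMap.mem_ker, LinearMap.comp_apply, LinearMap.mulRight_apply]
    induction t using tensor_hom_induction with
    | h0 => rw [mul_zero, map_zero]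
    | hadd s t hs ht => rw [mul_add, map_add, hs, ht, add_zero]
    | hom p q a' ha' b' hb' =>
      rw [tmul_mul a hb ha' b', map_smul, twistFunctional_tmul]
      simp [coeffY_mul, coeffZ_mul, h1, h2, h3]
  exact h hx

theorem mul_decomposables {x : V.tensor (koszul K r m)} (hx : x ∈ decomposables V r m)
    (t : V.tensor (koszul K r m)) : twistFunctional m o τ (t * x) = 0 := by
  have h : decomposables V r m ≤ LinearMap.ker (twistFunctional m o τ ∘ₗ
      LinearMap.mulLeft K t) := by
    refine decomposables_le fun i j a ha b hb h1 h2 h3 => ?_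
    rw [LinearMap.mem_ker, LinearMap.comp_apply, LinearMap.mulLeft_apply]
    induction t using tensor_hom_induction with
    | h0 => rw [zero_mul, map_zero]
    | hadd s t hs ht => rw [add_mul, map_add, hs, ht, add_zero]
    | hom p q a' ha' b' hb' =>
      rw [tmul_mul a' hb' ha b, map_smul, twistFunctional_tmul]
      simp [coeffY_mul, coeffZ_mul, h1, h2, h3]
  exact h hx

theorem d_mem_decomposables {x : V.tensor (koszul K r m)} (hx : x ∈ decomposables V r m) :
    (V.tensor (koszul K r m)).d x ∈ decomposables V r m := by
  have h : decomposables V r m ≤ (decomposables V r m).comap (V.tensor (koszul K r m)).d := by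
    refine decomposables_le fun i j a ha b hb h1 h2 h3 => ?_
    rw [Submodule.mem_comap, d_tmul, V.sgn_of_mem ha]
    refine Submodule.add_mem _ (tmul_mem_decomposables (V.d_mem ha) hb h1 h2 h3)
      (tmul_mem_decomposables (Submodule.smul_mem _ _ ha) ((koszul K r m).d_mem hb)
        (koszulAug_d K r m b) (fun k => (coeff_d K r m b k).1) fun k => ?_)
    rw [(coeff_d K r m b k).2, h2]
  exact h hx

theorem contractRight_decomposables {φ : koszul K r m →ₗ[K] K}
    (hφ : ∀ b, koszulAug K r m b = 0 → (∀ k, coeffY K r m k b = 0) →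
      (∀ k, coeffZ K r m k b = 0) → φ b = 0) {x : V.tensor (koszul K r m)}
    (hx : x ∈ decomposables V r m) : contractRight φ x = 0 := by
  have h : decomposables V r m ≤ LinearMap.ker (contractRight (V := V) φ) := by
    refine decomposables_le fun i j a ha b hb h1 h2 h3 => ?_
    rw [LinearMap.mem_ker, contractRight_tmul, hφ b h1 h2 h3, zero_smul]
  exact h hx

theorem d_tmul_genY (j : Fin r) : (V.tensor (koszul K r m)).d (tmul V _ 1 (genY K r m j)) =
    tmul V _ 1 (genZ K r m j) := by
  rw [d_tmul, V.d_one, map_zero, LinearMap.zero_apply, zero_add, sgn_one, d_genY]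

/-- If `a` has positive degree, `a ⊗ y_j` has degree at least `l`, with equality only for `a ∈ V^1`;
and `a ⊗ z_j` has degree greater than `l`. Otherwise `a` is a scalar by connectedness. -/
theorem koszul_cover (hconn : V.IsConnected) (hm : Fin r → m + 1 = l) {i : ℕ}
    (hi : i < l ∨ (i ≤ l ∧ V.grading 1 = ⊥)) :
    (V.tensor (koszul K r m)).grading i ≤
      LinearMap.range (V.inl (koszul K r m)).toAlgHom.toLinearMap ⊔
        Submodule.span K (Set.range fun j => tmul V (koszul K r m) 1 (genY K r m j)) ⊔
        Submodule.span K (Set.range fun j => (V.tensor (koszul K r m)).d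
          (tmul V (koszul K r m) 1 (genY K r m j))) ⊔ decomposables V r m := by
  refine tensor_grading_le fun p q hpq a ha b hb => ?_
  obtain ⟨b', hb', h1, h2, h3, hbb⟩ := exists_linear_part K r m hb
  have hscalar (hp : p = 0) : ∃ c : K, a = c • 1 := by
    subst hp
    rw [IsConnected] at hconn
    rw [hconn, Submodule.mem_span_singleton] at ha
    obtain ⟨c, rfl⟩ := ha
    exact ⟨c, rfl⟩
  rw [hbb, map_add, map_add, map_add, map_sum, map_sum]
  refine Submodule.add_mem_sup (Submodule.add_mem_sup (Submodule.add_mem_sup ?_ ?_) ?_)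
    (tmul_mem_decomposables ha hb' h1 h2 h3)
  · rw [map_smul]
    exact Submodule.smul_mem _ _ ⟨a, rfl⟩
  · refine Submodule.sum_mem _ fun j _ => ?_
    have hml := hm j
    rcases eq_or_ne q m with rfl | hq
    · rcases Nat.eq_zero_or_pos p with hp | hp
      · obtain ⟨c, rfl⟩ := hscalar hp
        rw [map_smul, map_smul, LinearMap.smul_apply]
        exact Submodule.smul_mem _ _ (Submodule.smul_mem _ _ (Submodule.subset_span ⟨j, rfl⟩))
      · rcases hi with hi | ⟨hi, hV⟩
        · omega
        · obtain rfl : p = 1 := by omega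
          rw [hV, Submodule.mem_bot] at ha
          rw [ha, map_zero, LinearMap.zero_apply]
          exact Submodule.zero_mem _
    · rw [coeffY_of_mem K r m hq hb, zero_smul, map_zero]
      exact Submodule.zero_mem _
  · refine Submodule.sum_mem _ fun j _ => ?_
    have hml := hm j
    rcases eq_or_ne q (m + 1) with rfl | hq
    · obtain ⟨c, rfl⟩ := hscalar (by omega)
      rw [map_smul, map_smul, LinearMap.smul_apply]
      exact Submodule.smul_mem _ _ (Submodule.smul_mem _ _
        (Submodule.subset_span ⟨j, d_tmul_genY j⟩))
    · rw [coeffZ_of_mem K r m hq hb, zero_smul, map_zero]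
      exact Submodule.zero_mem _

/-- The augmentation of the second factor detects `d a`, and the coefficient of `z_k` detects `c k`;
decomposables are invisible to both and stable under `d`. -/
theorem koszul_independent (hV : (1 : V) ≠ 0) (a : V) (c : Fin r → K)
    {x : V.tensor (koszul K r m)} (hx : x ∈ decomposables V r m)
    (hd : (V.tensor (koszul K r m)).d (V.inl (koszul K r m) a +
      ∑ j, c j • tmul V _ 1 (genY K r m j) + x) = 0) : V.d a = 0 ∧ c = 0 := by
  constructor
  · have h := congrArg (koszulRetract V r m) hd
    rw [koszulRetract_d, map_add (koszulRetract V r m), map_add (koszulRetract V r m),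
      koszulRetract_inl, map_sum, map_zero] at h
    have hx0 : koszulRetract V r m x = 0 := contractRight_decomposables (fun b h1 _ _ => h1) hx
    rw [hx0, add_zero, Finset.sum_eq_zero fun j _ => by
      rw [map_smul, koszulRetract_tmul, koszulAug_genY, zero_smul, smul_zero], add_zero] at h
    exact h
  · funext k
    have h := congrArg (contractRight (V := V) (coeffZ K r m k)) hd
    have hx0 : contractRight (V := V) (coeffZ K r m k) ((V.tensor (koszul K r m)).d x) = 0 :=
      contractRight_decomposables (fun b _ _ h3 => h3 k) (d_mem_decomposables hx)
    have ha0 : contractRight (V := V) (coeffZ K r m k)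
        ((V.tensor (koszul K r m)).d (V.inl (koszul K r m) a)) = 0 := by
      rw [← (V.inl (koszul K r m)).map_d, inl_eq_tmul, contractRight_tmul, coeffZ_one, zero_smul]
    rw [map_add, map_add, map_add, map_add, hx0, ha0, map_sum, map_sum, map_zero, zero_add,
      add_zero] at h
    have h2 (j : Fin r) : contractRight (V := V) (coeffZ K r m k) ((V.tensor (koszul K r m)).d
        (c j • tmul V _ 1 (genY K r m j))) = (c j * (Pi.single j 1 : Fin r → K) k) • 1 := by
      rw [map_smul, d_tmul_genY, map_smul, contractRight_tmul, coeffZ_genZ, smul_smul]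
    simp only [h2, ← Finset.sum_smul] at h
    have h3 := (smul_eq_zero.1 h).resolve_right hV
    simpa [Pi.single_apply] using h3

/-- The tensor product with the contractible algebra is an extension of the required kind. -/
theorem isTwistExtension_koszul [CharZero K] (hconn : V.IsConnected) (hm : Fin r → m + 1 = l)
    (hτ : ∀ j i, i + l ≠ n + 1 → ∀ a ∈ V.grading i, τ j a = 0) :
    IsTwistExtension o (twistOrientation o τ hm hτ) (V.inl (koszul K r m)) l m τ
      (fun j => tmul V _ 1 (genY K r m j)) (decomposables V r m) where
  quasiIso := koszul_inl_isQuasiIso V r m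
  injective := Function.LeftInverse.injective (koszulRetract_inl V r m)
  orient := twistFunctional_inl o τ
  degree := hm
  y_mem j := tmul_mem_grading (zero_add m) (one_mem_grading V) (genY_mem K r m j)
  pairing_y a j := by
    change twistFunctional m o τ (tmul V _ a 1 * tmul V _ 1 (genY K r m j)) = _
    rw [tmul_mul a (one_mem_grading _) (one_mem_grading V), map_smul, mul_one, one_mul,
      twistFunctional_tmul]
    simp [koszulAug_genY, coeffY_genY, coeffZ_genY, Pi.single_apply]
  pairing_y_y i j := by
    change twistFunctional m o τ (tmul V _ 1 (genY K r m i) * tmul V _ 1 (genY K r m j)) = _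
    rw [tmul_mul 1 (genY_mem K r m i) (one_mem_grading V), map_smul, twistFunctional_tmul]
    simp [coeffY_mul, coeffZ_mul, koszulAug_genY]
  pairing_y_dy i j := by
    rw [d_tmul_genY]
    change twistFunctional m o τ (tmul V _ 1 (genY K r m i) * tmul V _ 1 (genZ K r m j)) = _
    rw [tmul_mul 1 (genY_mem K r m i) (one_mem_grading V), map_smul, twistFunctional_tmul]
    simp [coeffY_mul, coeffZ_mul, koszulAug_genY, koszulAug_genZ]
  N_homogeneous := homogeneous_span (by
    rintro _ ⟨i, j, a, ha, b, hb, -, -, -, rfl⟩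
    exact ⟨i + j, tmul_mem_grading rfl ha hb⟩)
  N_pairing _ hx a := decomposables_mul o τ hx a
  pairing_N a _ hx := mul_decomposables o τ hx a
  independent a c x hx hd := koszul_independent (fun h1 => o.ne_zero (LinearMap.ext fun a => by
    rw [← mul_one a, h1, mul_zero, map_zero, map_zero])) a c hx hd
  cover _ hi := koszul_cover hconn hm hi

end KoszulTensor

/-! ### Assembly of the extension and the theorem. -/

/-- Extension of a solution of the twist conditions to degree `l`. -/
theorem exists_twist_extension {K : Type u} [Field K] [CharZero K] (V : CDGA.{u, v} K) {n : ℕ}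
    {o : V.Orientation n} (hPD : o.IsPDGA) (hconn : V.IsConnected) (hfin : V.IsFiniteType) {l : ℕ}
    (hl : (n + 1) / 2 < l ∨ (V.grading 1 = ⊥ ∧ l = (n + 1) / 2)) {H C E : Submodule K V}
    (hH : o.IsHOrthogonal H C) (hE : o.IsRadicalComplement C E)
    {ρ : V.degPart E (Set.Ico ((n + 1) / 2) l) →ₗ[K] LinearMap.range V.d}
    (hρ : o.SolvesTwist C E (Set.Ico ((n + 1) / 2) l) ρ) :
    ∃ (Λ : CDGA.{u, u} K), Λ.IsSullivanIn {i | i + 1 = l ∨ i = l} ∧ Λ.IsAcyclic ∧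
    ∃ (o' : (V.tensor Λ).Orientation n), o'.IsPDGA ∧
      (V.inl Λ).IsQuasiIso ∧ (∀ a : V, o'.toFun (V.inl Λ a) = o.toFun a) ∧
    ∃ (H' C' E' : Submodule K (V.tensor Λ)),
      o'.IsHOrthogonal H' C' ∧ o'.IsRadicalComplement C' E' ∧
      (∀ i ∈ Set.Ico ((n + 1) / 2) l, E' ⊓ (V.tensor Λ).grading i =
        (E ⊓ V.grading i).map (V.inl Λ).toAlgHom.toLinearMap) ∧
    ∃ (ρ' : E' →ₗ[K] LinearMap.range (V.tensor Λ).d),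
      (∀ (e : V.degPart E (Set.Ico ((n + 1) / 2) l)) (e' : E'),
        (e' : V.tensor Λ) = V.inl Λ e → (ρ' e' : V.tensor Λ) = V.inl Λ (ρ e)) ∧
      o'.SolvesTwist C' E' (Set.Icc ((n + 1) / 2) l) ρ' := by
  -- If the only functional is zero, no generators are adjoined and `l` is unrestricted; otherwise
  -- `l ≥ 2`, so `l - 1` is a positive degree and is not truncated.
  obtain ⟨r, τ, hτ, h2l⟩ : ∃ (r : ℕ) (τ : Fin r → V →ₗ[K] K),
      Submodule.span K (Set.range τ) = twistFunctionals H C n l ρ ∧ (Fin r → 2 ≤ l) := by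
    by_cases hT : twistFunctionals H C n l ρ = ⊥
    · exact ⟨0, 0, by rw [hT, Set.range_eq_empty, Submodule.span_empty], fun j => j.elim0⟩
    · obtain ⟨r, τ, hτ⟩ := Submodule.fg_iff_exists_fin_generating_family.1
        (Module.Finite.iff_fg.1 (finite_twistFunctionals hfin H C n l ρ))
      obtain ⟨φ, hφ, h0⟩ := Submodule.exists_mem_ne_zero_of_ne_bot hT
      exact ⟨r, τ, hτ, fun _ => hH.two_le_of_functional_ne_zero hconn hl hφ h0⟩
  have hmem (j : Fin r) : τ j ∈ twistFunctionals H C n l ρ :=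
    hτ ▸ Submodule.subset_span (Set.mem_range_self j)
  have hm (j : Fin r) : l - 1 + 1 = l := by
    have := h2l j
    omega
  have X := isTwistExtension_koszul o τ hconn hm fun j => (hmem j).1
  refine ⟨koszul K _ (l - 1), koszul_isSullivanIn K _ _ fun j => ?_, koszul_isAcyclic K _ _,
    twistOrientation o τ hm fun j => (hmem j).1, hPD.of_quasiIso X.quasiIso X.orient,
    X.quasiIso, X.orient, X.exists_solution hPD hfin hl hH hE hρ hτ⟩
  have := h2l j
  exact ⟨by omega, Or.inl (hm j), Or.inr (hm j)⟩

end CDGA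

theorem mainTheorem2 {K : Type u} [Field K] [CharZero K] (V : CDGA.{u, v} K) (n : ℕ)
    (o : V.Orientation n) (hPD : o.IsPDGA) (hconn : V.IsConnected) (hfin : V.IsFiniteType) :
    (∀ (l : ℕ), (n + 1) / 2 < l →
      ∀ (H C E : Submodule K V), o.IsHOrthogonal H C → o.IsRadicalComplement C E →
      ∀ (ρ : V.degPart E (Set.Ico ((n + 1) / 2) l) →ₗ[K] LinearMap.range V.d),
      o.SolvesTwist C E (Set.Ico ((n + 1) / 2) l) ρ →
      (V.grading 1 ≠ ⊥ → ∀ k, 1 ≤ k → n = 2 * k → l = k + 1 → E ⊓ V.grading k = ⊥) →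
      ∃ (Λ : CDGA.{u, u} K), Λ.IsSullivanIn {i | i + 1 = l ∨ i = l} ∧ Λ.IsAcyclic ∧
      ∃ (o' : (V.tensor Λ).Orientation n), o'.IsPDGA ∧
        (V.inl Λ).IsQuasiIso ∧ (∀ a : V, o'.toFun (V.inl Λ a) = o.toFun a) ∧
      ∃ (H' C' E' : Submodule K (V.tensor Λ)),
        o'.IsHOrthogonal H' C' ∧ o'.IsRadicalComplement C' E' ∧
        (∀ i ∈ Set.Ico ((n + 1) / 2) l, E' ⊓ (V.tensor Λ).grading i =
          (E ⊓ V.grading i).map (V.inl Λ).toAlgHom.toLinearMap) ∧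
      ∃ (ρ' : E' →ₗ[K] LinearMap.range (V.tensor Λ).d),
        (∀ (e : V.degPart E (Set.Ico ((n + 1) / 2) l)) (e' : E'),
          (e' : V.tensor Λ) = V.inl Λ e → (ρ' e' : V.tensor Λ) = V.inl Λ (ρ e)) ∧
        o'.SolvesTwist C' E' (Set.Icc ((n + 1) / 2) l) ρ') ∧
    (V.grading 1 = ⊥ → ∀ (l : ℕ), l = (n + 1) / 2 →
      ∃ (Λ : CDGA.{u, u} K), Λ.IsSullivanIn {i | i + 1 = l ∨ i = l} ∧ Λ.IsAcyclic ∧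
      ∃ (o' : (V.tensor Λ).Orientation n), o'.IsPDGA ∧
        (V.inl Λ).IsQuasiIso ∧ (∀ a : V, o'.toFun (V.inl Λ a) = o.toFun a) ∧
      ∃ (H' C' E' : Submodule K (V.tensor Λ)),
        o'.IsHOrthogonal H' C' ∧ o'.IsRadicalComplement C' E' ∧
      ∃ (ρ' : (V.tensor Λ).degPart E' {l} →ₗ[K] LinearMap.range (V.tensor Λ).d),
        o'.SolvesTwist C' E' {l} ρ') := by
  refine ⟨fun l hl H C E hH hE ρ hρ _ =>
    V.exists_twist_extension hPD hconn hfin (Or.inl hl) hH hE hρ, fun hV l hl => ?_⟩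
  obtain ⟨H, hH⟩ := V.exists_isHarmonic
  obtain ⟨C, hC, -⟩ := hH.exists_isHOrthogonal hPD (D := ⊥) CDGA.homogeneous_bot
    (fun h _ c hc => by rw [(Submodule.mem_bot K).1 hc, map_zero]) disjoint_bot_left
  obtain ⟨E, hE, -⟩ := CDGA.Orientation.exists_isRadicalComplement (o := o) (D := ⊥)
    hC.coexact_homogeneous CDGA.homogeneous_bot bot_le disjoint_bot_left
  -- With `l = (n + 1) / 2` the interval of old degrees is empty, so the zero map is a solution for
  -- any decomposition.
  have hρ : o.SolvesTwist C E (Set.Ico ((n + 1) / 2) l)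
      (0 : V.degPart E (Set.Ico ((n + 1) / 2) l) →ₗ[K] LinearMap.range V.d) :=
    ⟨fun _ _ _ => Submodule.zero_mem _, fun i hi => absurd hi.2 (by have := hi.1; omega),
      fun i hi => absurd hi.2 (by have := hi.1; omega)⟩
  obtain ⟨Λ, h1, h2, o', h3, h4, h5, H', C', E', h6, h7, -, ρ', -, h8⟩ :=
    V.exists_twist_extension hPD hconn hfin (Or.inr ⟨hV, hl⟩) hC hE hρ
  refine ⟨Λ, h1, h2, o', h3, h4, h5, H', C', E', h6, h7,
    ρ' ∘ₗ Submodule.inclusion (CDGA.degPart_le _ _), fun i e he => h8.homogeneous i _ he, ?_, ?_⟩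
  · rintro i rfl j hj e₁ he₁ e₂ he₂
    exact h8.pairing_eq i ⟨hl.ge, le_rfl⟩ j hj e₁ he₁ _ he₂
  · rintro i rfl j hj c hc e₂ he₂
    exact h8.pairing_radical i ⟨hl.ge, le_rfl⟩ j hj c hc _ he₂
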